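/- **Data.** Let $\tau_l$ ($l\ge1$), $\phi_{kl}=\phi_{lk}$ ($k,l\ge1$) and $\psi_{kl}$ ($k,l\ge0$) be complex numbers with $|\tau_1|+|\tau_3|>0$, $\psi_{00}=0$ and $\psi_{kl}+\psi_{lk}+\psi_{0k}\psi_{0l}=0$. They define a local super spectral curve with involution $\sigma(z)=-z$; it is regular if $\tau_1=0$ and irregular otherwise. Let $\Theta$ be a $\sigma$-invariant symbol with $\Theta_z^2=z\,dz$, and put $$d\xi_{-l}=\Big(z^{-l-1}+\sum_{m\ge1}\tfrac{\phi_{lm}}{l}z^{m-1}\Big)dz\ (l\ge1),\qquad \eta_{-l}=\Big(z^{-l-1}+\sum_{k\ge0}\psi_{lk}z^{k-1}\Big)\Theta\ (l\ge0),$$ $V^{B-}=\mathrm{span}_{\mathbb C}(d\xi_{-l})_{l\ge1}$, $V^{F0,-}=\mathrm{span}_{\mathbb C}(\eta_{-l})_{l\ge0}$, $\omega_{0,1|0}(z)=\sum_{l\ge1}\tau_lz^{l-1}dz$, $\omega_{0,2|0}(z_1,z_2)=\frac{dz_1dz_2}{(z_1-z_2)^2}+\sum_{k,l\ge1}\phi_{kl}z_1^{k-1}z_2^{l-1}dz_1dz_2$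 and $$\omega_{0,0|2}(|z_1,z_2)=-\tfrac12\tfrac{z_1+z_2}{z_1-z_2}\tfrac{\Theta_1\Theta_2}{z_1z_2}-\sum_{k,l\ge0}\tfrac{\psi_{kl}-\psi_{lk}}{1+\delta_{kl,0}}\,\tfrac12z_1^{l-1}z_2^{k-1}\Theta_1\Theta_2$$ (here $\delta_{kl,0}=1$ if $kl=0$ and $0$ otherwise). **Loop equations.** For $g,n,m\ge0$ with $2g+n+2m>2$ let $\omega_{g,n|2m}\in\big(\bigotimes_{j=1}^nV^{B-}_{z_j}\big)\otimes\big(\bigotimes_{k=1}^{2m}V^{F0,-}_{u_k}\big)$ (algebraic tensor product), symmetric in the first $n$ and antisymmetric in the last $2m$ slots. Write $J,K$ for tuples of bosonic and fermionic variables, $(-1)^\rho$ for the sign of the permutation $K\to(K_1,K_2)$, $\mathcal D_z(f\Theta)=df\,\Theta$, let $\sum$ below run over $g_1+g_2=g$, $J_1\sqcup J_2=J$, $K_1\sqcup K_2=K$ (terms with $\omega_{0,1|0},\omega_{0,2|0},\omega_{0,0|2}$ included, expanded for $z$ smaller than the other variables), and set $$\begin{aligned}\mathcal Q^{FB}_{g,n|2m}(J|z,K)=&\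 \omega_{g-1,n+1|2m}(z,J|\sigma(z),K)+\omega_{g-1,n+1|2m}(\sigma(z),J|z,K)\\&+\sum(-1)^\rho\big[\omega_{g_1}(z,J_1|K_1)\,\omega_{g_2}(J_2|\sigma(z),K_2)+\omega_{g_1}(\sigma(z),J_1|K_1)\,\omega_{g_2}(J_2|z,K_2)\big],\\ \mathcal Q^{BB}_{g,n+1|2m}(z,J|K)=&\ \omega_{g-1,n+2|2m}(z,\sigma(z),J|K)+\sum(-1)^\rho\omega_{g_1}(z,J_1|K_1)\,\omega_{g_2}(\sigma(z),J_2|K_2),\\ \mathcal Q^{FF}_{g,n+1|2m}(z,J|K)=&-\tfrac12\big(\mathcal D_z\omega_{g-1,n|2m+2}(J|z,u,K)+\mathcal D_u\omega_{g-1,n|2m+2}(J|u,z,K)\big)\big|_{u=\sigma(z)}\\&+\tfrac12\sum(-1)^\rho\big[\mathcal D_z\omega_{g_1}(J_1|z,K_1)\,\omega_{g_2}(J_2|\sigma(z),K_2)+\mathcal D_z\omega_{g_1}(J_1|\sigma(z),K_1)\,\omega_{g_2}(J_2|z,K_2)\big],\end{aligned}$$ with $\omega_{-1,\cdot|\cdot}=0$.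 The $\mathcal N=1$ abstract super loop equations are: (1) $\omega_{g,n+1|2m}(z,J|K)+\omega_{g,n+1|2m}(\sigma(z),J|K)\in\mathbb C[[z]]dz$; (2) $\omega_{g,n|2m}(J|z,K)+\omega_{g,n|2m}(J|\sigma(z),K)\in\mathbb C[[z]]\Theta$; (3) $\mathcal Q^{BB}_{g,n+1|2m}+\mathcal Q^{FF}_{g,n+1|2m}\in z^{2-s}\mathbb C[[z]]dz^2$; (4) $\mathcal Q^{FB}_{g,n|2m}\in z^{1-s}\mathbb C[[z]]dz\,\Theta$; where $s=0$ for regular and $s=2$ for irregular curves. **Super Airy structure.** For bosonic variables $x^1,x^2,\dots$ and Grassmann variables $\theta^0,\theta^1,\dots$ let, for $a\ge1$, $J_a=\hbar\partial_{x^a}$, $J_0=0$, $J_{-a}=ax^a$, $\Gamma_a=\hbar\partial_{\theta^a}$, $\Gamma_0=\frac{\theta^0}2+\hbar\partial_{\theta^0}$, $\Gamma_{-a}=\theta^a$, $$L_{2n}=\tfrac12\sum_{j\in\mathbb Z}(-1)^{j-1}{:}J_{-j}J_{2n+j}{:}+\tfrac\hbar4\delta_{n,0}+\tfrac12\sum_{j\in\mathbb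 Z}(-1)^j(n+j){:}\Gamma_{-j}\Gamma_{j+2n}{:},\quad G_{2n+1}=\sum_{j\in\mathbb Z}(-1)^{j-1}{:}J_{-j}\Gamma_{j+2n+1}{:},$$ $\Phi=\exp\frac1\hbar\big(\sum_{l\ge1}\frac{\tau_l}lJ_l+\sum_{k,l\ge1}\frac{\phi_{kl}}{2kl}J_kJ_l+\sum_{k,l\ge0}\frac{\psi_{kl}}2\Gamma_k\Gamma_l\big)$, and let $\mathcal S_{\mathcal A}$ consist of $J_{2i}$, $\Gamma_{2i-1}$, $\Phi L_{2i-\epsilon-1}\Phi^{-1}$, $\Phi G_{2i-\epsilon}\Phi^{-1}$ for $i\ge1$, with $\epsilon=3$ for regular and $\epsilon=1$ for irregular curves. A free energy of $\mathcal S_{\mathcal A}$ is a formal series $$F=\sum_{2g+n+2m>2}\frac{\hbar^{g-1}}{n!(2m)!}\sum_{i_1,\dots,i_n\ge1;\ j_1,\dots,j_{2m}\ge0}F_{g,n|2m}(i_1,\dots,i_n|j_1,\dots,j_{2m})\prod_kx^{i_k}\prod_l\theta^{j_l}$$ with $F_{g,n|2m}$ finitely supported, symmetric in the $i$'s and antisymmetric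 in the $j$'s, such that $He^F=0$ for all $H\in\mathcal S_{\mathcal A}$. **Theorem.** Suppose that $(\omega_{g,n|2m})_{2g+n+2m>2}$ as above satisfies the $\mathcal N=1$ abstract super loop equations. Then each $\omega_{g,n|2m}$ has a unique expansion $$\omega_{g,n|2m}=\sum_{i_1,\dots,i_n\ge1;\ j_1,\dots,j_{2m}\ge0}\hat F_{g,n|2m}(i_1,\dots,i_n|j_1,\dots,j_{2m})\bigotimes_{k=1}^nd\xi_{-i_k}(z_k)\otimes\bigotimes_{l=1}^{2m}\eta_{-j_l}(u_l),$$ the $\hat F_{g,n|2m}$ are the coefficients of a free energy of $\mathcal S_{\mathcal A}$, and this free energy is unique up to the additive constants $F_{g,0|0}$: for every free energy $F$ of $\mathcal S_{\mathcal A}$ and all $(n,m)\ne(0,0)$, $\hat F_{g,n|2m}=F_{g,n|2m}$. -/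

import Mathlib

open scoped TensorProduct

noncomputable section

namespace SuperTR

/-- Formal Laurent series in `z`. A series `f` stands for the one-form `f(z) dz` in bosonic slots,
for `f(z) Θ` in fermionic slots (where `Θ² = z dz`), and for `f(z) dz²` or `f(z) dz Θ` in the
quadratic loop equations. -/
abbrev LS := LaurentSeries ℂ

/-- The `ℂ`-algebra structure on Laurent series by constants, compatible with the module structure. -/
instance lsAlgebra : Algebra ℂ LS := HahnSeries.instAlgebra

/-- The data of a local super spectral curve with one component: dilaton shift parameters `τ_l`
(`l ≥ 1`), bosonic polarization parameters `φ_{kl}` (`k, l ≥ 1`) and fermionic polarization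
parameters `ψ_{kl}` (`k, l ≥ 0`). The relations on `φ` and `ψ` say that the bases below satisfy
`Ω^B(dξ_k, dξ_l) = δ_{k+l,0} / k` and `Ω^F(η_k, η_l) = δ_{k+l,0}`. -/
structure LocalSuperSpectralCurve where
  τ : ℕ+ → ℂ
  φ : ℕ+ → ℕ+ → ℂ
  ψ : ℕ → ℕ → ℂ
  admissible : 0 < ‖τ 1‖ + ‖τ 3‖
  φ_symm : ∀ k l, φ k l = φ l k
  ψ_zero : ψ 0 0 = 0
  ψ_rel : ∀ k l, ψ k l + ψ l k + ψ 0 k * ψ 0 l = 0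

/-! ### Operations on Laurent series -/

/-- `f(z) ↦ f(-z)`: the involution `σ` on fermionic forms `f(z) Θ`, as `Θ` is `σ`-invariant. -/
def sigmaF : LS →ₗ[ℂ] LS where
  toFun f := ⟨fun a => (-1) ^ a * f.coeff a,
    f.isPWO_support.mono (fun a ha => by
      simp only [Function.mem_support] at ha
      exact right_ne_zero_of_mul ha)⟩
  map_add' f g := by ext a; simp [mul_add]
  map_smul' c f := by ext a; simp [mul_left_comm]

/-- `f(z) dz ↦ f(-z) d(-z)`: the involution `σ` on one-forms. -/
def sigmaB : LS →ₗ[ℂ] LS := -sigmaF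

/-- `f ↦ f'`; the operator `𝒟_z` sends `f Θ` to `df Θ = f' dz Θ`. -/
def deriv : LS →ₗ[ℂ] LS := LaurentSeries.derivative ℂ

/-- The coefficient of the `a`-th power, as a constant series. -/
def coeffAt (a : ℤ) : LS →ₗ[ℂ] LS :=
  Algebra.linearMap ℂ LS ∘ₗ HahnSeries.coeff.linearMap a

/-- `f ∈ z^d ℂ[[z]]`. -/
def OrdGE (d : ℤ) (f : LS) : Prop := ∀ a < d, f.coeff a = 0

/-- A power series, as a Laurent series, from its coefficients. -/
def ofCoeffs (c : ℕ → ℂ) : LS := HahnSeries.ofPowerSeries ℤ ℂ (PowerSeries.mk c)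

namespace LocalSuperSpectralCurve

variable (C : LocalSuperSpectralCurve)

/-! ### Bases, polarization, and the unstable differentials -/

/-- `dξ_{-l} = (z^{-l-1} + ∑_{m ≥ 1} (φ_{lm} / l) z^{m-1}) dz`, for `l ≥ 1`. -/
def dxiNeg (l : ℕ+) : LS :=
  HahnSeries.single (-(l : ℤ) - 1) 1 + ofCoeffs fun m => C.φ l m.succPNat / (l : ℂ)

/-- `η_{-l} = (z^{-l-1} + ∑_{k ≥ 0} ψ_{lk} z^{k-1}) Θ`, for `l ≥ 0`; the zero mode is `l = 0`. -/
def etaNeg (l : ℕ) : LS :=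
  HahnSeries.single (-(l : ℤ) - 1) 1 + HahnSeries.single (-1) 1 * ofCoeffs fun k => C.ψ l k

/-- `V^{B-}`. -/
def VBminus : Submodule ℂ LS := Submodule.span ℂ (Set.range C.dxiNeg)

/-- `V^{F 0,-} = V^{F 0} ⊕ V^{F-}`. -/
def VFzeroMinus : Submodule ℂ LS := Submodule.span ℂ (Set.range C.etaNeg)

/-- `dξ_{-l}` as an element of `V^{B-}`. -/
def dxiBasis (l : ℕ+) : C.VBminus := ⟨C.dxiNeg l, Submodule.subset_span ⟨l, rfl⟩⟩

/-- `η_{-l}` as an element of `V^{F 0,-}`. -/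
def etaBasis (l : ℕ) : C.VFzeroMinus := ⟨C.etaNeg l, Submodule.subset_span ⟨l, rfl⟩⟩

/-- `ω_{0,1|0}(z) = ∑_{l ≥ 1} τ_l z^{l-1} dz`. -/
def omega01 : LS := ofCoeffs fun a => C.τ a.succPNat

/-- `ω_{0,2|0}(z, z₁)`, expanded for `|z| < |z₁|`: the coefficient of `z₁^b`, as a series in `z`.
Here `1 / (z - z₁)² = ∑_{a ≥ 0} (a+1) z^a z₁^{-a-2}`. -/
def omega02 (b : ℤ) : LS := ofCoeffs fun a =>
  (if b = -(a : ℤ) - 2 then (a : ℂ) + 1 else 0) +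
    (if 0 ≤ b then C.φ a.succPNat b.toNat.succPNat else 0)

/-- The coefficient of `z₁^{l-1} z₂^{k-1}` in the regular part of `ω_{0,0|2}(|z₁, z₂)`. -/
def omega002Reg (l k : ℕ) : ℂ :=
  -((C.ψ k l - C.ψ l k) / (if k * l = 0 then 2 else 1)) / 2

/-- `ω_{0,0|2}(|z, u)`, expanded for `|z| < |u|`: the coefficient of `u^b`, as a series in `z`.
Here `-(1/2) (z+u) / (z-u) / (zu) = (1/2) z⁻¹ u⁻¹ + ∑_{l ≥ 1} z^{l-1} u^{-l-1}`. -/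
def omega002 (b : ℤ) : LS := HahnSeries.single (-1) 1 * ofCoeffs fun l =>
  (if b = -(l : ℤ) - 1 then (if l = 0 then 1 / 2 else 1) else 0) +
    (if -1 ≤ b then C.omega002Reg l (b + 1).toNat else 0)

/-- `ω_{0,2|0}(z, σ(z))`, as a multiple of `dz²`. -/
def omega02Diag : LS :=
  HahnSeries.single (-2) (-1 / 4) +
    ofCoeffs fun N => -∑ p ∈ Finset.HasAntidiagonal.antidiagonal N,
      C.φ p.1.succPNat p.2.succPNat * (-1) ^ p.2

/-- `𝒟_z ω_{0,0|2}(|z, u)` at `u = σ(z)`, as a multiple of `dz Θ²`. The `z`-derivative of the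
singular part `-(1/2) (z+u) / (z-u) / (zu)` at `u = -z` is `1 / (4 z³)`; the regular part
contributes `∑_{l,k ≥ 0} r_{lk} (l-1) z^{l-2} (-z)^{k-1}`. -/
def omega002Diag : LS :=
  HahnSeries.single (-3) (1 / 4) +
    HahnSeries.single (-3) 1 * ofCoeffs fun N => ∑ p ∈ Finset.HasAntidiagonal.antidiagonal N,
      C.omega002Reg p.1 p.2 * ((p.1 : ℂ) - 1) * (-1) ^ (p.2 + 1)

/-! ### Multilinear differentials -/

/-- `(⨂_{j=1}^n V^{B-}) ⊗ (⨂_{l=1}^k V^{F 0,-})`. -/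
abbrev Tens (n k : ℕ) : Type :=
  (⨂[ℂ] _ : Fin n, C.VBminus) ⊗[ℂ] (⨂[ℂ] _ : Fin k, C.VFzeroMinus)

/-- A family of multilinear differentials `ω_{g,n|k}` that respect the polarization. -/
abbrev Correlators : Type := (g n k : ℕ) → C.Tens n k

/-- Substitution into a multilinear differential: apply a linear map to each tensor slot and
multiply the resulting series. -/
def evalT {n k : ℕ} (u : Fin n → LS →ₗ[ℂ] LS) (v : Fin k → LS →ₗ[ℂ] LS) : C.Tens n k →ₗ[ℂ] LS :=
  TensorProduct.lift ((Algebra.lmul ℂ LS).toLinearMap.compl₁₂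
    (PiTensorProduct.lift ((MultilinearMap.mkPiAlgebra ℂ (Fin n) LS).compLinearMap
      fun i => u i ∘ₗ C.VBminus.subtype))
    (PiTensorProduct.lift ((MultilinearMap.mkPiAlgebra ℂ (Fin k) LS).compLinearMap
      fun i => v i ∘ₗ C.VFzeroMinus.subtype)))

/-- The number of fermionic slots is even, and `ω_{g,n|k}` is symmetric in the bosonic and
antisymmetric in the fermionic slots. -/
structure IsSuperSymmetric (ω : C.Correlators) : Prop where
  even : ∀ g n k, 2 < 2 * g + n + k → Odd k → ω g n k = 0
  symm : ∀ g n k, 2 < 2 * g + n + k → ∀ π : Equiv.Perm (Fin n),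
    TensorProduct.map (PiTensorProduct.reindex ℂ (fun _ => C.VBminus) π).toLinearMap
      LinearMap.id (ω g n k) = ω g n k
  antisymm : ∀ g n k, 2 < 2 * g + n + k → ∀ π : Equiv.Perm (Fin k),
    TensorProduct.map LinearMap.id
      (PiTensorProduct.reindex ℂ (fun _ => C.VFzeroMinus) π).toLinearMap (ω g n k) =
        (Equiv.Perm.sign π : ℤ) • ω g n k

variable (ω : C.Correlators)

/-- `ω_{g,n+1|k}(z, J|K)`: the coefficient of the monomial with exponents `α` in the variables `J`
and `β` in the variables `K`, as a series in `z` (`z` smaller than the other variables). -/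
def corrB : (g n k : ℕ) → (Fin n → ℤ) → (Fin k → ℤ) → LS
  | 0, 0, 0, _, _ => C.omega01
  | 0, 1, 0, α, _ => C.omega02 (α 0)
  | 0, 0, 1, _, _ => 0
  | g, n, k, α, β => C.evalT (Matrix.vecCons LinearMap.id fun i => coeffAt (α i))
      (fun j => coeffAt (β j)) (ω g (n + 1) k)

/-- `ω_{g,n|k+1}(J|z, K)`: the coefficient of the monomial with exponents `α`, `β` in `J`, `K`. -/
def corrF : (g n k : ℕ) → (Fin n → ℤ) → (Fin k → ℤ) → LS
  | 0, 0, 0, _, _ => 0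
  | 0, 1, 0, _, _ => 0
  | 0, 0, 1, _, β => C.omega002 (β 0)
  | g, n, k, α, β => C.evalT (fun i => coeffAt (α i))
      (Matrix.vecCons LinearMap.id fun j => coeffAt (β j)) (ω g n (k + 1))

/-- `ω_{g,n+2|k}(z, σ(z), J|K)`. -/
def diagBB : (g n k : ℕ) → (Fin n → ℤ) → (Fin k → ℤ) → LS
  | 0, 0, 0, _, _ => C.omega02Diag
  | g, n, k, α, β => C.evalT
      (Matrix.vecCons LinearMap.id (Matrix.vecCons sigmaB fun i => coeffAt (α i)))
      (fun j => coeffAt (β j)) (ω g (n + 2) k)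

/-- `𝒟_z ω_{g,n|k+2}(J|z, u, K)` at `u = σ(z)`. -/
def diagFF : (g n k : ℕ) → (Fin n → ℤ) → (Fin k → ℤ) → LS
  | 0, 0, 0, _, _ => C.omega002Diag
  | g, n, k, α, β => C.evalT (fun i => coeffAt (α i))
      (Matrix.vecCons deriv (Matrix.vecCons sigmaF fun j => coeffAt (β j))) (ω g n (k + 2))

/-- `ω_{g,n+1|k+1}(z, J|σ(z), K)`; it is only used with `k` odd, where it is never unstable. -/
def diagBF (g n k : ℕ) (α : Fin n → ℤ) (β : Fin k → ℤ) : LS :=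
  C.evalT (Matrix.vecCons LinearMap.id fun i => coeffAt (α i))
    (Matrix.vecCons sigmaF fun j => coeffAt (β j)) (ω g (n + 1) (k + 1))

end LocalSuperSpectralCurve

/-! ### Sums over splittings -/

/-- The subtuple of `a` with positions in `S`, in increasing order. -/
def restr {n : ℕ} (a : Fin n → ℤ) (S : Finset (Fin n)) : Fin S.card → ℤ :=
  fun i => a (S.orderEmbOfFin rfl i)

/-- The sign `(-1)^ρ` of the permutation that lists first the positions in `S`, then the others,
each in increasing order. -/
def shuffleSign {k : ℕ} (S : Finset (Fin k)) : ℤ :=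
  (-1) ^ ((S ×ˢ Sᶜ).filter fun p => p.2 < p.1).card

/-- `∑_{g₁+g₂=g} ∑_{J₁∪J₂=J, K₁∪K₂=K} (-1)^ρ A_{g₁}(J₁|K₁) B_{g₂}(J₂|K₂)`. -/
def splitSum (A B : (g n k : ℕ) → (Fin n → ℤ) → (Fin k → ℤ) → LS)
    (g n k : ℕ) (α : Fin n → ℤ) (β : Fin k → ℤ) : LS :=
  ∑ h ∈ Finset.HasAntidiagonal.antidiagonal g, ∑ S : Finset (Fin n), ∑ R : Finset (Fin k),
    shuffleSign R • (A h.1 S.card R.card (restr α S) (restr β R) *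
      B h.2 Sᶜ.card Rᶜ.card (restr α Sᶜ) (restr β Rᶜ))

namespace LocalSuperSpectralCurve

variable (C : LocalSuperSpectralCurve) (ω : C.Correlators)

/-! ### Abstract super loop equations -/

/-- `𝒬^{FB}_{g,n|k+1}(J|z, K)` as a multiple of `dz Θ`, where `K` consists of `k` variables. -/
def QFB (g n k : ℕ) (α : Fin n → ℤ) (β : Fin k → ℤ) : LS :=
  (match g with
    | 0 => 0
    | g' + 1 =>
      -- the second term, with `z` and `σ(z)` exchanged, is the pullback of the first one
      C.diagBF ω g' n k α β + sigmaB (C.diagBF ω g' n k α β)) +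
  splitSum (C.corrB ω) (fun g n k α β => sigmaF (C.corrF ω g n k α β)) g n k α β +
  splitSum (fun g n k α β => sigmaB (C.corrB ω g n k α β)) (C.corrF ω) g n k α β

/-- `𝒬^{BB}_{g,n+1|k}(z, J|K)` as a multiple of `dz²`. -/
def QBB (g n k : ℕ) (α : Fin n → ℤ) (β : Fin k → ℤ) : LS :=
  (match g with
    | 0 => 0
    | g' + 1 => C.diagBB ω g' n k α β) +
  splitSum (C.corrB ω) (fun g n k α β => sigmaB (C.corrB ω g n k α β)) g n k α β

/-- `𝒬^{FF}_{g,n+1|k}(z, J|K)` as a multiple of `dz²`; the factor `z` is `Θ² = z dz`. -/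
def QFF (g n k : ℕ) (α : Fin n → ℤ) (β : Fin k → ℤ) : LS :=
  HahnSeries.single 1 1 *
  ((match g with
    | 0 => 0
    | g' + 1 =>
      -- the second term, with `z` and `σ(z)` exchanged, is the pullback of the first one
      (-1 / 2 : ℂ) • (C.diagFF ω g' n k α β + sigmaB (C.diagFF ω g' n k α β))) +
  (1 / 2 : ℂ) • splitSum (fun g n k α β => deriv (C.corrF ω g n k α β))
    (fun g n k α β => sigmaF (C.corrF ω g n k α β)) g n k α β +
  (1 / 2 : ℂ) • splitSum (fun g n k α β => deriv (sigmaF (C.corrF ω g n k α β)))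
    (C.corrF ω) g n k α β)

open Classical in
/-- `0` for regular curves (`τ₁ = 0`) and `2` for irregular ones. -/
def shift : ℤ := if C.τ 1 = 0 then 0 else 2

/-- The `𝒩 = 1` abstract super loop equations. The quadratic ones are
`𝒬^{BB} + 𝒬^{FF} ∈ z² ℂ[[z]] dz²` and `𝒬^{FB} ∈ z ℂ[[z]] dz Θ` for regular curves; for irregular
curves two more orders in `z` are allowed. -/
structure SuperLoopEquations : Prop where
  linearB : ∀ (g n k : ℕ) (α : Fin n → ℤ) (β : Fin k → ℤ), Even k → 2 < 2 * g + (n + 1) + k →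
    OrdGE 0 (C.corrB ω g n k α β + sigmaB (C.corrB ω g n k α β))
  linearF : ∀ (g n k : ℕ) (α : Fin n → ℤ) (β : Fin k → ℤ), Odd k → 2 < 2 * g + n + (k + 1) →
    OrdGE 0 (C.corrF ω g n k α β + sigmaF (C.corrF ω g n k α β))
  quadraticB : ∀ (g n k : ℕ) (α : Fin n → ℤ) (β : Fin k → ℤ), Even k → 2 < 2 * g + (n + 1) + k →
    OrdGE (2 - C.shift) (C.QBB ω g n k α β + C.QFF ω g n k α β)
  quadraticF : ∀ (g n k : ℕ) (α : Fin n → ℤ) (β : Fin k → ℤ), Odd k → 2 < 2 * g + n + (k + 1) →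
    OrdGE (1 - C.shift) (C.QFB ω g n k α β)

end LocalSuperSpectralCurve

/-! ### Coefficient families and expansions -/

/-- A finitely supported family of coefficients `F(i_1, …, i_n|j_1, …, j_k)`,
`i_a ≥ 1`, `j_b ≥ 0`. -/
abbrev Coeffs (n k : ℕ) : Type := ((Fin n → ℕ+) × (Fin k → ℕ)) →₀ ℂ

/-- `w = ∑ F(i|j) dξ_{-i_1} ⊗ ⋯ ⊗ dξ_{-i_n} ⊗ η_{-j_1} ⊗ ⋯ ⊗ η_{-j_k}`. -/
def IsExpansion (C : LocalSuperSpectralCurve) {n k : ℕ} (w : C.Tens n k) (F : Coeffs n k) : Prop :=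
  w = F.sum fun p c => c • ((⨂ₜ[ℂ] a, C.dxiBasis (p.1 a)) ⊗ₜ[ℂ] (⨂ₜ[ℂ] b, C.etaBasis (p.2 b)))

/-! ### The super Airy structure -/

/-- `ℂ[ħ, ħ⁻¹]`. -/
def Hb : Type := LaurentPolynomial ℂ

instance hbCommRing : CommRing Hb := inferInstanceAs (CommRing (LaurentPolynomial ℂ))

/-- `ħ^p`. -/
def hb (p : ℤ) : Hb := (LaurentPolynomial.T p : LaurentPolynomial ℂ)

/-- Complex constants. -/
def cst (c : ℂ) : Hb := (LaurentPolynomial.C c : LaurentPolynomial ℂ)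

/-- Polynomials over `ℂ[ħ, ħ⁻¹]` in the variables `x^1, x^2, …` and the Grassmann variables
`θ^0, θ^1, …`. -/
abbrev SuperPoly := MvPolynomial ℕ+ Hb ⊗[Hb] ExteriorAlgebra Hb (ℕ →₀ Hb)

/-- The variable `x^i`. -/
def xvar (i : ℕ+) : SuperPoly := MvPolynomial.X i ⊗ₜ[Hb] 1

/-- The Grassmann variable `θ^j`. -/
def thvar (j : ℕ) : SuperPoly := 1 ⊗ₜ[Hb] ExteriorAlgebra.ι Hb (Finsupp.single j 1)

/-- `∂ / ∂x^i`. -/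
def dx (i : ℕ+) : Module.End Hb SuperPoly :=
  LinearMap.rTensor _ (MvPolynomial.pderiv i).toLinearMap

/-- The left derivative `∂ / ∂θ^j`. -/
def dth (j : ℕ) : Module.End Hb SuperPoly :=
  LinearMap.lTensor _ (CliffordAlgebra.contractLeft (Finsupp.lapply j))

/-- `J_a = ħ ∂/∂x^a`, `J_0 = 0`, `J_{-a} = a x^a`. -/
def J : ℤ → Module.End Hb SuperPoly
  | Int.ofNat 0 => 0
  | Int.ofNat (a + 1) => hb 1 • dx a.succPNat
  | Int.negSucc a => cst (a + 1) • LinearMap.mulLeft Hb (xvar a.succPNat)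

/-- `Γ_a = ħ ∂/∂θ^a`, `Γ_0 = θ^0 / 2 + ħ ∂/∂θ^0`, `Γ_{-a} = θ^a`. -/
def Gam : ℤ → Module.End Hb SuperPoly
  | Int.ofNat 0 => cst (1 / 2) • LinearMap.mulLeft Hb (thvar 0) + hb 1 • dth 0
  | Int.ofNat (a + 1) => hb 1 • dth (a + 1)
  | Int.negSucc a => LinearMap.mulLeft Hb (thvar (a + 1))

/-- `:J_a J_b:` -/
def normJJ (a b : ℤ) : Module.End Hb SuperPoly := if a ≤ b then J a * J b else J b * J a

/-- `:Γ_a Γ_b:` -/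
def normGG (a b : ℤ) : Module.End Hb SuperPoly := if a ≤ b then Gam a * Gam b else -(Gam b * Gam a)

/-- `L_{2n}`. On each superpolynomial only finitely many terms of each sum are nonzero. -/
def L (n : ℤ) (f : SuperPoly) : SuperPoly :=
  cst (1 / 2) • (∑ᶠ j : ℤ, cst ((-1) ^ (j - 1)) • normJJ (-j) (2 * n + j) f) +
  (if n = 0 then cst (1 / 4) * hb 1 else 0) • f +
  cst (1 / 2) • (∑ᶠ j : ℤ, cst ((-1) ^ j * (n + j)) • normGG (-j) (j + 2 * n) f)

/-- `G_{2m+1}`; `J` and `Γ` modes commute, so normal ordering is immaterial. -/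
def G (m : ℤ) (f : SuperPoly) : SuperPoly :=
  ∑ᶠ j : ℤ, cst ((-1) ^ (j - 1)) • J (-j) (Gam (j + 2 * m + 1) f)

namespace LocalSuperSpectralCurve

variable (C : LocalSuperSpectralCurve)

/-- The exponent of `Φ`:
`ħ⁻¹ (∑ (τ_l / l) J_l + ∑ (φ_{kl} / 2kl) J_k J_l + ∑ (ψ_{kl} / 2) Γ_k Γ_l)`. -/
def PhiExponent (f : SuperPoly) : SuperPoly :=
  hb (-1) • ((∑ᶠ l : ℕ+, cst (C.τ l / l) • J l f) +
    (∑ᶠ p : ℕ+ × ℕ+, cst (C.φ p.1 p.2 / (2 * p.1 * p.2)) • J p.1 (J p.2 f)) +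
    (∑ᶠ p : ℕ × ℕ, cst (C.ψ p.1 p.2 / 2) • Gam p.1 (Gam p.2 f)))

/-- `exp (c · PhiExponent)`; the exponent is locally nilpotent, so the sum is finite on each
superpolynomial. `c = 1` gives `Φ` and `c = -1` gives `Φ⁻¹`. -/
def expPhi (c : ℂ) (f : SuperPoly) : SuperPoly :=
  ∑ᶠ r : ℕ, cst (c ^ r / (r.factorial : ℂ)) • (C.PhiExponent)^[r] f

/-- `Φ T Φ⁻¹`. -/
def conj (T : SuperPoly → SuperPoly) (f : SuperPoly) : SuperPoly :=
  C.expPhi 1 (T (C.expPhi (-1) f))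

open Classical in
/-- `ε = 3` for regular curves and `ε = 1` for irregular ones. -/
def eps : ℤ := if C.τ 1 = 0 then 3 else 1

/-- The set `𝒮_𝒜` of operators `J_{2i}`, `Γ_{2i-1}`, `Φ L_{2i-ε-1} Φ⁻¹`, `Φ G_{2i-ε} Φ⁻¹`, `i ≥ 1`
(`L n` is `L_{2n}` and `G m` is `G_{2m+1}`). -/
def airyOperators : Set (SuperPoly → SuperPoly) :=
  {T | ∃ i : ℤ, 1 ≤ i ∧ (T = J (2 * i) ∨ T = Gam (2 * i - 1) ∨
    (∃ n : ℤ, 2 * n = 2 * i - C.eps - 1 ∧ T = C.conj (L n)) ∨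
    (∃ m : ℤ, 2 * m + 1 = 2 * i - C.eps ∧ T = C.conj (G m)))}

end LocalSuperSpectralCurve

/-! ### Free energies -/

/-- A family `F_{g,n|k}` of coefficients of a free energy. -/
abbrev FreeCoeffs : Type := (g n k : ℕ) → Coeffs n k

/-- `(ħ^{g-1} / (n! k!)) ∑ F_{g,n|k}(i|j) x^{i_1} ⋯ x^{i_n} θ^{j_1} ⋯ θ^{j_k}`. -/
def freeTerm (F : FreeCoeffs) (g n k : ℕ) : SuperPoly :=
  (cst (1 / ((n.factorial : ℂ) * (k.factorial : ℂ))) * hb ((g : ℤ) - 1)) •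
    (F g n k).sum fun p c => cst c •
      ((List.ofFn fun a => xvar (p.1 a)).prod * (List.ofFn fun b => thvar (p.2 b)).prod)

/-- The partial sums of the free energy. -/
def freeTrunc (F : FreeCoeffs) (W : ℕ) : SuperPoly :=
  ∑ g ∈ Finset.range W, ∑ n ∈ Finset.range W, ∑ k ∈ Finset.range W, freeTerm F g n k

/-- The partial sums of the partition function `Z = e^F`. -/
def expTrunc (F : FreeCoeffs) (W : ℕ) : SuperPoly :=
  ∑ r ∈ Finset.range W, cst (1 / (r.factorial : ℂ)) • freeTrunc F W ^ r

/-- The superpolynomials all of whose terms have degree at least `w`, where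
`deg x^i = deg θ^j = 1` and `deg ħ = 2`. -/
def degGE (w : ℤ) : AddSubgroup SuperPoly :=
  AddSubgroup.closure {f | ∃ (c : ℂ) (p : ℤ) (I : List ℕ+) (K : List ℕ),
    w ≤ 2 * p + I.length + K.length ∧
      f = (cst c * hb p) • ((I.map xvar).prod * (K.map thvar).prod)}

/-- `T e^F = 0` in the completion of `SuperPoly` by degree: `T` applied to the partial sums of
`e^F` tends to `0` in the topology given by the degree filtration. -/
def Annihilates (T : SuperPoly → SuperPoly) (F : FreeCoeffs) : Prop :=
  ∀ w : ℤ, ∃ W₀ : ℕ, ∀ W ≥ W₀, T (expTrunc F W) ∈ degGE w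

/-- `F` is a free energy of the super Airy structure `𝒮_𝒜`: `ħ F` has no terms of degree at most
two, all its terms are even, its coefficients are symmetric in the bosonic and antisymmetric in
the fermionic indices, and all operators of `𝒮_𝒜` annihilate `e^F`. -/
structure IsFreeEnergy (C : LocalSuperSpectralCurve) (F : FreeCoeffs) : Prop where
  stable : ∀ g n k, 2 * g + n + k ≤ 2 → F g n k = 0
  even : ∀ g n k, Odd k → F g n k = 0
  symm : ∀ g n k (π : Equiv.Perm (Fin n)) (i : Fin n → ℕ+) (j : Fin k → ℕ),
    F g n k (i ∘ π, j) = F g n k (i, j)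
  antisymm : ∀ g n k (π : Equiv.Perm (Fin k)) (i : Fin n → ℕ+) (j : Fin k → ℕ),
    F g n k (i, j ∘ π) = (Equiv.Perm.sign π : ℤ) * F g n k (i, j)
  annihilated : ∀ T ∈ C.airyOperators, Annihilates T F

end SuperTR

end

open scoped TensorProduct

noncomputable section

namespace SuperTR

open Filter

/-! ### Scalars -/

/-! The correlators and the free energy encode the same numbers. The `dξ_{-l}` and `η_{-l}` are
bases, so each stable correlator has unique tensor coordinates (`isExpansion_iff`). These are
collected in `coeffsOf` and form a potential `F`. It remains to see that the loop equations, read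
coefficient by coefficient in `z`, are the equations `H e^F = 0`, and that these equations fix `F`
up to constants. The dictionary rests on conjugation by `Φ` (`phiE_Jm`, `phiE_Gm`). It turns
`J_{-p-1}` into multiplication by the `z^p`-coefficient of `ω_{0,1|0} + ∑ l x^l z^{l-1}` plus `ħ`
times the derivative in the direction formed by the `z^p`-coefficients of all `dξ_{-i}`. The
fermionic modes behave in the same way with the `η_{-j}`; there the quadratic relation on `ψ`
absorbs the double commutator caused by the zero mode. Dividing by `e^F` replaces operators by
symbols, and annihilation means that the symbols tend to zero in the degree filtration
(`annihilates_iff_of_symbol`). Taylor coefficients at the origin in the basis-coefficient directions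
detect degree (`mem_dge_of_jetVanish`), and those of the linear symbols are exactly the Laurent
coefficients of the correlators, unstable ones included (`hcoef_jet_sB`, `hcoef_jet_sF`). For
quadratic symbols, the Leibniz rule produces the sums over splittings with their shuffle signs
(`tay_mul`), second derivatives of `F` produce the diagonal terms, and the normal-ordering scalars
are the diagonal values of `ω_{0,2|0}` and `𝒟ω_{0,0|2}` (`ordConst_eq`). The Taylor coefficients of
the symbols of `L_{2r}` and `G_{2r+1}` thus become `-1/2` times the coefficients of `z^{-2r-2}` in
`𝒬^{BB} + 𝒬^{FF}` and of `z^{-2r-3}` in `𝒬^{FB}` (`hcoef_jet_symL`, `hasFinSum_QFB`). The loop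
equations make them vanish in the stable range; the few unstable cases follow from the order of
`ω_{0,1|0}`. Uniqueness is an induction on `2g + n + k`. If two free energies agree at lower order,
the quadratic constraints become linear in the difference, with the `τ_l` as coefficients. The
operators `J_{2i}` and `Γ_{2i-1}` remove half of the indices. Descending induction from the finite
support removes the others, because the leading coefficient `τ_1`, or `τ_3` when `τ_1 = 0`, is
nonzero (`eq_zero_of_tau_recursion`). The fermionic zero mode escapes this argument and is handled
by antisymmetry. -/

/-- Complex constants, as a ring homomorphism. -/
def cstHom : ℂ →+* Hb := (LaurentPolynomial.C : ℂ →+* LaurentPolynomial ℂ)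

@[simp] theorem cst_zero : cst 0 = 0 := map_zero cstHom
@[simp] theorem cst_one : cst 1 = 1 := map_one cstHom
theorem cst_add (a b : ℂ) : cst (a + b) = cst a + cst b := map_add cstHom a b
theorem cst_neg (a : ℂ) : cst (-a) = -cst a := map_neg cstHom a
theorem cst_mul (a b : ℂ) : cst (a * b) = cst a * cst b := map_mul cstHom a b
theorem cst_sum {ι : Type*} (s : Finset ι) (f : ι → ℂ) :
    cst (∑ i ∈ s, f i) = ∑ i ∈ s, cst (f i) := map_sum cstHom f s
theorem cst_natCast (n : ℕ) : cst n = n := map_natCast cstHom n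

@[simp] theorem hb_zero : hb 0 = 1 := LaurentPolynomial.T_zero
theorem hb_add (p q : ℤ) : hb (p + q) = hb p * hb q := LaurentPolynomial.T_add p q

/-- The coefficient of `ħ^p`. -/
def hcoef (p : ℤ) : Hb →+ ℂ where
  toFun h := AddMonoidAlgebra.coeff (h : LaurentPolynomial ℂ) p
  map_zero' := rfl
  map_add' _ _ := rfl

theorem hcoef_cst_mul_hb (p q : ℤ) (c : ℂ) :
    hcoef p (cst c * hb q) = if q = p then c else 0 := by
  have h : (cst c * hb q : Hb) = (AddMonoidAlgebra.single q c : LaurentPolynomial ℂ) :=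
    (LaurentPolynomial.single_eq_C_mul_T c q).symm
  rw [h]
  exact Finsupp.single_apply

theorem hb_induction {P : Hb → Prop} (h : Hb) (add : ∀ a b, P a → P b → P (a + b))
    (mono : ∀ c p, P (cst c * hb p)) : P h :=
  LaurentPolynomial.induction_on' (motive := P) h (fun a b ha hb => add a b ha hb)
    (fun p c => mono c p)

theorem hcoef_cst_mul (p : ℤ) (c : ℂ) (h : Hb) : hcoef p (cst c * h) = c * hcoef p h := by
  induction h using hb_induction with
  | add a b ha hb => rw [mul_add, map_add, map_add, ha, hb, mul_add]
  | mono d q =>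
    rw [← mul_assoc, ← cst_mul, hcoef_cst_mul_hb, hcoef_cst_mul_hb]
    split_ifs <;> simp

theorem hcoef_hb_mul (p q : ℤ) (h : Hb) : hcoef p (hb q * h) = hcoef (p - q) h := by
  induction h using hb_induction with
  | add a b ha hb => rw [mul_add, map_add, map_add, ha, hb]
  | mono d r =>
    rw [mul_left_comm, ← hb_add, hcoef_cst_mul_hb, hcoef_cst_mul_hb]
    congr 1
    simp only [eq_iff_iff]
    omega

theorem hcoef_cst (p : ℤ) (c : ℂ) : hcoef p (cst c) = if p = 0 then c else 0 := by
  have := hcoef_cst_mul_hb p 0 c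
  rw [hb_zero, mul_one] at this
  rw [this]
  simp [eq_comm]

/-! ### Superpolynomials as an algebra -/

/-- The algebra of superpolynomials. -/
def SP : Type := SuperPoly

instance spRing : Ring SP := inferInstanceAs (Ring SuperPoly)

instance spAlgebra : Algebra Hb SP := inferInstanceAs (Algebra Hb SuperPoly)

/-- The variable `x^i`. -/
def xv (i : ℕ+) : SP := xvar i

/-- The variable `θ^j`. -/
def tv (j : ℕ) : SP := thvar j

/-- The even derivation with `x^i ↦ v i`. -/
def der (v : ℕ+ → ℂ) : Module.End Hb SP :=
  (LinearMap.rTensor _ (MvPolynomial.mkDerivation Hb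
    fun i => (MvPolynomial.C (cst (v i)) : MvPolynomial ℕ+ Hb)).toLinearMap : Module.End Hb SuperPoly)

/-- The odd left derivation with `θ^j ↦ w j`. -/
def oder (w : ℕ → ℂ) : Module.End Hb SP :=
  (LinearMap.lTensor _ (CliffordAlgebra.contractLeft (Finsupp.linearCombination Hb fun j => cst (w j))) :
    Module.End Hb SuperPoly)

/-- The parity involution. -/
def par : SP →ₐ[Hb] SP :=
  (Algebra.TensorProduct.map (AlgHom.id Hb _) CliffordAlgebra.involute :
    SuperPoly →ₐ[Hb] SuperPoly)

/-- The value at `x = θ = 0`. -/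
def aug : SP →ₐ[Hb] Hb :=
  (Algebra.TensorProduct.lift (MvPolynomial.aeval fun _ => (0 : Hb)) ExteriorAlgebra.algebraMapInv
    (fun _ _ => Commute.all _ _) : SuperPoly →ₐ[Hb] Hb)

/-- The pure tensor `p ⊗ q`. -/
def tm (p : MvPolynomial ℕ+ Hb) (q : ExteriorAlgebra Hb (ℕ →₀ Hb)) : SP := p ⊗ₜ[Hb] q

theorem tm_one_one : tm 1 1 = 1 := rfl
theorem tm_add (p : MvPolynomial ℕ+ Hb) (q q' : ExteriorAlgebra Hb (ℕ →₀ Hb)) :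
    tm p (q + q') = tm p q + tm p q' := TensorProduct.tmul_add _ _ _
theorem add_tm (p p' : MvPolynomial ℕ+ Hb) (q : ExteriorAlgebra Hb (ℕ →₀ Hb)) :
    tm (p + p') q = tm p q + tm p' q := TensorProduct.add_tmul _ _ _
theorem tm_smul (h : Hb) (p : MvPolynomial ℕ+ Hb) (q : ExteriorAlgebra Hb (ℕ →₀ Hb)) :
    tm p (h • q) = h • tm p q := TensorProduct.tmul_smul _ _ _
theorem smul_tm (h : Hb) (p : MvPolynomial ℕ+ Hb) (q : ExteriorAlgebra Hb (ℕ →₀ Hb)) :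
    tm (h • p) q = h • tm p q := rfl
theorem tm_zero (p : MvPolynomial ℕ+ Hb) : tm p 0 = 0 := TensorProduct.tmul_zero _ _
theorem zero_tm (q : ExteriorAlgebra Hb (ℕ →₀ Hb)) : tm 0 q = 0 := TensorProduct.zero_tmul _ _
theorem tm_neg (p : MvPolynomial ℕ+ Hb) (q : ExteriorAlgebra Hb (ℕ →₀ Hb)) :
    tm p (-q) = -tm p q := TensorProduct.tmul_neg _ _
theorem tm_mul_tm (p p' : MvPolynomial ℕ+ Hb) (q q' : ExteriorAlgebra Hb (ℕ →₀ Hb)) :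
    tm p q * tm p' q' = tm (p * p') (q * q') := Algebra.TensorProduct.tmul_mul_tmul _ _ _ _

theorem tm_induction {P : SP → Prop} (a : SP) (zero : P 0) (tmul : ∀ p q, P (tm p q))
    (add : ∀ a b, P a → P b → P (a + b)) : P a :=
  TensorProduct.induction_on (motive := P) a zero tmul add

theorem xv_eq (i : ℕ+) : xv i = tm (MvPolynomial.X i) 1 := rfl
theorem tv_eq (j : ℕ) : tv j = tm 1 (ExteriorAlgebra.ι Hb (Finsupp.single j 1)) := rfl

theorem der_tm (v : ℕ+ → ℂ) (p : MvPolynomial ℕ+ Hb) (q : ExteriorAlgebra Hb (ℕ →₀ Hb)) :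
    der v (tm p q) = tm (MvPolynomial.mkDerivation Hb
      (fun i => (MvPolynomial.C (cst (v i)) : MvPolynomial ℕ+ Hb)) p) q := rfl

theorem oder_tm (w : ℕ → ℂ) (p : MvPolynomial ℕ+ Hb) (q : ExteriorAlgebra Hb (ℕ →₀ Hb)) :
    oder w (tm p q) =
      tm p (CliffordAlgebra.contractLeft (Finsupp.linearCombination Hb fun j => cst (w j)) q) := rfl

theorem par_tm (p : MvPolynomial ℕ+ Hb) (q : ExteriorAlgebra Hb (ℕ →₀ Hb)) :
    par (tm p q) = tm p (CliffordAlgebra.involute q) := rfl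

theorem aug_tm (p : MvPolynomial ℕ+ Hb) (q : ExteriorAlgebra Hb (ℕ →₀ Hb)) :
    aug (tm p q) = MvPolynomial.aeval (fun _ => (0 : Hb)) p * ExteriorAlgebra.algebraMapInv q := rfl

theorem dx_eq_der (i : ℕ+) : (dx i : Module.End Hb SuperPoly) = der (Pi.single i 1) := by
  have : (fun j => (MvPolynomial.C (cst ((Pi.single i 1 : ℕ+ → ℂ) j)) : MvPolynomial ℕ+ Hb)) =
      Pi.single i 1 := by
    funext j
    by_cases h : j = i
    · subst h; simp
    · simp [Pi.single_eq_of_ne h]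
  rw [der, this, dx, MvPolynomial.pderiv_def]

theorem dth_eq_oder (j : ℕ) : (dth j : Module.End Hb SuperPoly) = oder (Pi.single j 1) := by
  have : Finsupp.linearCombination Hb (fun k => cst ((Pi.single j 1 : ℕ → ℂ) k)) = Finsupp.lapply j := by
    ext k
    by_cases h : k = j
    · subst h; simp
    · simp [Pi.single_eq_of_ne h, Finsupp.single_eq_of_ne (Ne.symm h)]
  rw [oder, this, dth]

/-- Left multiplications by generators build everything from `1`. Operator identities are therefore
verified on `1` and propagated by the commutation rules of the operators with `x^i` and `θ^j`. -/
theorem sp_induction {P : SP → Prop} (a : SP) (one : P 1)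
    (add : ∀ a b, P a → P b → P (a + b)) (smul : ∀ (h : Hb) a, P a → P (h • a))
    (xmul : ∀ i a, P a → P (xv i * a)) (thmul : ∀ j a, P a → P (tv j * a)) : P a := by
  have zero : P 0 := by simpa using smul 0 1 one
  -- The exterior factor is built first; a vector is a finite combination of the `θ^j`, so linearity
  -- reduces `ι m` to a single generator.
  have ext (q : ExteriorAlgebra Hb (ℕ →₀ Hb)) : P (tm 1 q) := by
    induction q using CliffordAlgebra.left_induction with
    | algebraMap r =>
      have := smul r 1 one
      rwa [← tm_one_one, ← tm_smul, ← Algebra.algebraMap_eq_smul_one] at this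
    | add x y hx hy => rw [tm_add]; exact add _ _ hx hy
    | ι_mul x m hx =>
      induction m using Finsupp.induction_linear with
      | zero => rwa [map_zero, zero_mul, tm_zero]
      | add f g hf hg => rw [map_add, add_mul, tm_add]; exact add _ _ hf hg
      | single j c =>
        have h1 := smul c _ (thmul j _ hx)
        rw [tv_eq, tm_mul_tm, ← tm_smul, one_mul, ← smul_mul_assoc, ← map_smul,
          Finsupp.smul_single, smul_eq_mul, mul_one] at h1
        exact h1
  induction a using tm_induction with
  | zero => exact zero
  | add x y hx hy => exact add _ _ hx hy
  | tmul p q =>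
    induction p using MvPolynomial.induction_on with
    | C c =>
      have := smul c _ (ext q)
      rwa [← smul_tm, ← MvPolynomial.C_mul', mul_one] at this
    | add p p' hp hp' => rw [add_tm]; exact add _ _ hp hp'
    | mul_X p i hp =>
      have := xmul i _ hp
      rwa [xv_eq, tm_mul_tm, one_mul, mul_comm] at this

/-! ### Values on generators and Leibniz rules -/

@[simp] theorem der_one (v : ℕ+ → ℂ) : der v 1 = 0 := by
  rw [← tm_one_one, der_tm]; simp [zero_tm]

@[simp] theorem oder_one (w : ℕ → ℂ) : oder w 1 = 0 := by
  rw [← tm_one_one, oder_tm, CliffordAlgebra.contractLeft_one, tm_zero]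

theorem der_mul (v : ℕ+ → ℂ) (a b : SP) :
    der v (a * b) = der v a * b + a * der v b := by
  induction a using tm_induction with
  | zero => simp
  | add x y hx hy => rw [add_mul, map_add, hx, hy, map_add]; noncomm_ring
  | tmul p q =>
    induction b using tm_induction with
    | zero => simp
    | add x y hx hy => rw [mul_add, map_add, hx, hy, map_add]; noncomm_ring
    | tmul p' q' =>
      simp only [tm_mul_tm, der_tm, Derivation.leibniz, smul_eq_mul]
      rw [add_tm, add_comm, mul_comm p']

/-- Contraction is an odd derivation: crossing one vector costs a sign, and crossing `a` costs its
grade involution. This is the source of every fermionic sign below. -/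
theorem contractLeft_mul {R M : Type*} [CommRing R] [AddCommGroup M] [Module R M]
    {Q : QuadraticForm R M} (d : Module.Dual R M) (a b : CliffordAlgebra Q) :
    CliffordAlgebra.contractLeft d (a * b) = CliffordAlgebra.contractLeft d a * b +
      CliffordAlgebra.involute a * CliffordAlgebra.contractLeft d b := by
  induction a using CliffordAlgebra.left_induction with
  | algebraMap r => simp [CliffordAlgebra.contractLeft_algebraMap_mul]
  | add x y hx hy => simp only [add_mul, map_add, hx, hy]; abel
  | ι_mul x m hx =>
    rw [mul_assoc, CliffordAlgebra.contractLeft_ι_mul, hx, CliffordAlgebra.contractLeft_ι_mul,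
      map_mul, CliffordAlgebra.involute_ι]
    simp only [sub_mul, smul_mul_assoc, mul_add, neg_mul, mul_assoc]
    abel

theorem oder_mul (w : ℕ → ℂ) (a b : SP) :
    oder w (a * b) = oder w a * b + par a * oder w b := by
  induction a using tm_induction with
  | zero => simp
  | add x y hx hy => rw [add_mul, map_add, hx, hy, map_add, map_add]; noncomm_ring
  | tmul p q =>
    induction b using tm_induction with
    | zero => simp
    | add x y hx hy => rw [mul_add, map_add, hx, hy, map_add]; noncomm_ring
    | tmul p' q' =>
      simp only [tm_mul_tm, oder_tm, par_tm]
      rw [← tm_add]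
      exact congrArg _ (contractLeft_mul _ q q')

@[simp] theorem der_xv (v : ℕ+ → ℂ) (i : ℕ+) : der v (xv i) = algebraMap Hb SP (cst (v i)) := by
  rw [xv_eq, der_tm, MvPolynomial.mkDerivation_X]
  rfl

@[simp] theorem der_tv (v : ℕ+ → ℂ) (j : ℕ) : der v (tv j) = 0 := by
  rw [tv_eq, der_tm]; simp [zero_tm]

@[simp] theorem oder_xv (w : ℕ → ℂ) (i : ℕ+) : oder w (xv i) = 0 := by
  rw [xv_eq, oder_tm, CliffordAlgebra.contractLeft_one, tm_zero]

@[simp] theorem oder_tv (w : ℕ → ℂ) (j : ℕ) : oder w (tv j) = algebraMap Hb SP (cst (w j)) := by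
  have h : CliffordAlgebra.contractLeft (Finsupp.linearCombination Hb fun j => cst (w j))
      (ExteriorAlgebra.ι Hb (Finsupp.single j 1)) = algebraMap Hb _ (cst (w j)) := by
    refine (CliffordAlgebra.contractLeft_ι _ _ _).trans ?_
    rw [Finsupp.linearCombination_single, one_smul]
  rw [tv_eq, oder_tm, h, Algebra.algebraMap_eq_smul_one, tm_smul, tm_one_one,
    Algebra.algebraMap_eq_smul_one]

@[simp] theorem par_xv (i : ℕ+) : par (xv i) = xv i := by
  rw [xv_eq, par_tm, map_one]

@[simp] theorem par_tv (j : ℕ) : par (tv j) = -tv j := by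
  rw [tv_eq, par_tm, ← tm_neg]
  exact congrArg _ (CliffordAlgebra.involute_ι _)

@[simp] theorem aug_xv (i : ℕ+) : aug (xv i) = 0 := by
  rw [xv_eq, aug_tm]; simp

@[simp] theorem aug_tv (j : ℕ) : aug (tv j) = 0 := by
  rw [tv_eq, aug_tm]; simp [ExteriorAlgebra.algebraMapInv]

/-! ### Supercommutation relations. -/

theorem xv_comm (i : ℕ+) (a : SP) : a * xv i = xv i * a := by
  induction a using tm_induction with
  | zero => simp
  | add x y hx hy => rw [add_mul, hx, hy, mul_add]
  | tmul p q => rw [xv_eq, tm_mul_tm, tm_mul_tm, mul_comm, mul_one, one_mul]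

theorem tv_mul_self (j : ℕ) : tv j * tv j = 0 := by
  rw [tv_eq, tm_mul_tm, ExteriorAlgebra.ι_sq_zero, tm_zero]

theorem tv_mul_tv (i j : ℕ) : tv i * tv j = -(tv j * tv i) := by
  rw [tv_eq, tv_eq, tm_mul_tm, tm_mul_tm, ← tm_neg]
  congr 1
  exact eq_neg_of_add_eq_zero_left (ExteriorAlgebra.ι_add_mul_swap _ _)

theorem tv_comm (j : ℕ) (a : SP) : tv j * a = par a * tv j := by
  induction a using sp_induction with
  | one => simp
  | add x y hx hy => rw [mul_add, hx, hy, map_add, add_mul]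
  | smul h a ha => rw [mul_smul_comm, ha, map_smul, smul_mul_assoc]
  | xmul i a ha => rw [← mul_assoc, xv_comm, mul_assoc, ha, map_mul, par_xv, mul_assoc]
  | thmul k a ha =>
    rw [← mul_assoc, tv_mul_tv, neg_mul, mul_assoc, ha, map_mul, par_tv, neg_mul, neg_mul,
      mul_assoc]

@[simp] theorem par_par (a : SP) : par (par a) = a := by
  induction a using sp_induction with
  | one => simp
  | add x y hx hy => rw [map_add, map_add, hx, hy]
  | smul h a ha => rw [map_smul, map_smul, ha]
  | xmul i a ha => rw [map_mul, map_mul, ha, par_xv, par_xv]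
  | thmul k a ha => rw [map_mul, map_mul, ha, par_tv, map_neg, par_tv, neg_neg]

@[simp] theorem aug_par (a : SP) : aug (par a) = aug a := by
  induction a using sp_induction with
  | one => simp
  | add x y hx hy => rw [map_add, map_add, map_add, hx, hy]
  | smul h a ha => rw [map_smul, map_smul, map_smul, ha]
  | xmul i a ha => rw [map_mul, map_mul, map_mul, ha, par_xv]
  | thmul k a ha => simp

theorem der_xv_mul (v : ℕ+ → ℂ) (i : ℕ+) (a : SP) :
    der v (xv i * a) = cst (v i) • a + xv i * der v a := by
  rw [der_mul, der_xv, Algebra.smul_def]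

theorem der_tv_mul (v : ℕ+ → ℂ) (j : ℕ) (a : SP) :
    der v (tv j * a) = tv j * der v a := by
  rw [der_mul, der_tv, zero_mul, zero_add]

theorem oder_xv_mul (w : ℕ → ℂ) (i : ℕ+) (a : SP) :
    oder w (xv i * a) = xv i * oder w a := by
  rw [oder_mul, oder_xv, zero_mul, zero_add, par_xv]

theorem oder_tv_mul (w : ℕ → ℂ) (j : ℕ) (a : SP) :
    oder w (tv j * a) = cst (w j) • a - tv j * oder w a := by
  rw [oder_mul, oder_tv, par_tv, Algebra.smul_def, neg_mul, sub_eq_add_neg]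

theorem der_par (v : ℕ+ → ℂ) (a : SP) : der v (par a) = par (der v a) := by
  induction a using sp_induction with
  | one => simp
  | add x y hx hy => rw [map_add, map_add, map_add, hx, hy, map_add]
  | smul h a ha => rw [map_smul, map_smul, map_smul, map_smul, ha]
  | xmul i a ha =>
    rw [map_mul, par_xv, der_xv_mul, der_xv_mul, map_add, map_smul, map_mul, par_xv, ha]
  | thmul k a ha =>
    rw [map_mul, par_tv, neg_mul, map_neg, der_tv_mul, der_tv_mul, map_mul, par_tv, ha,
      neg_mul]

theorem oder_par (w : ℕ → ℂ) (a : SP) : oder w (par a) = -par (oder w a) := by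
  induction a using sp_induction with
  | one => simp
  | add x y hx hy => rw [map_add, map_add, map_add, hx, hy, map_add]; abel
  | smul h a ha => rw [map_smul, map_smul, map_smul, map_smul, ha, smul_neg]
  | xmul i a ha =>
    rw [map_mul, par_xv, oder_xv_mul, oder_xv_mul, map_mul, par_xv, ha, mul_neg]
  | thmul k a ha =>
    rw [map_mul, par_tv, neg_mul, map_neg, oder_tv_mul, oder_tv_mul, map_sub, map_mul,
      par_tv, ha, map_smul]
    noncomm_ring

theorem der_comm (v v' : ℕ+ → ℂ) (a : SP) : der v (der v' a) = der v' (der v a) := by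
  induction a using sp_induction with
  | one => simp
  | add x y hx hy => simp only [map_add, hx, hy]
  | smul h a ha => simp only [map_smul, ha]
  | xmul i a ha => simp only [der_xv_mul, map_add, map_smul, ha]; abel
  | thmul k a ha => simp only [der_tv_mul, ha]

theorem der_oder (v : ℕ+ → ℂ) (w : ℕ → ℂ) (a : SP) :
    der v (oder w a) = oder w (der v a) := by
  induction a using sp_induction with
  | one => simp
  | add x y hx hy => simp only [map_add, hx, hy]
  | smul h a ha => simp only [map_smul, ha]
  | xmul i a ha => simp only [der_xv_mul, oder_xv_mul, map_add, map_smul, ha]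
  | thmul k a ha => simp only [der_tv_mul, oder_tv_mul, map_sub, map_smul, ha]

theorem oder_anticomm (w w' : ℕ → ℂ) (a : SP) :
    oder w (oder w' a) = -oder w' (oder w a) := by
  induction a using sp_induction with
  | one => simp
  | add x y hx hy => simp only [map_add, hx, hy]; abel
  | smul h a ha => simp only [map_smul, ha, smul_neg]
  | xmul i a ha => simp only [oder_xv_mul, ha, mul_neg]
  | thmul k a ha => simp only [oder_tv_mul, map_sub, map_smul, ha, mul_neg]; abel

/-- An even superpolynomial is central. -/
theorem comm_of_par_eq {a : SP} (ha : par a = a) (b : SP) : a * b = b * a := by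
  induction b using sp_induction with
  | one => simp
  | add x y hx hy => rw [mul_add, hx, hy, add_mul]
  | smul h b hb => rw [mul_smul_comm, hb, smul_mul_assoc]
  | xmul i b hb => rw [← mul_assoc, xv_comm, mul_assoc, hb, mul_assoc]
  | thmul k b hb =>
    have := tv_comm k a
    rw [ha] at this
    rw [← mul_assoc, ← this, mul_assoc, hb, mul_assoc]

/-- Odd superpolynomials anticommute. -/
theorem anticomm_of_par_eq_neg {a b : SP} (ha : par a = -a) (hb : par b = -b) :
    a * b = -(b * a) := by
  -- Oddness of `b` is not inherited along the induction, so the claim is proved for `b - par b`,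
  -- twice the odd part of an arbitrary `b`.
  have key : ∀ b : SP, a * (b - par b) = -((b - par b) * a) := by
    intro b
    induction b using sp_induction with
    | one => simp
    | add x y hx hy =>
      have : x + y - par (x + y) = (x - par x) + (y - par y) := by rw [map_add]; abel
      rw [this, mul_add, hx, hy, add_mul, neg_add]
    | smul h b hb => rw [map_smul, ← smul_sub, mul_smul_comm, hb, smul_mul_assoc, smul_neg]
    | xmul i b hb =>
      rw [map_mul, par_xv, ← mul_sub, ← mul_assoc, xv_comm, mul_assoc, hb, mul_assoc, mul_neg]
    | thmul k b hb =>
      -- The odd part of `θ^k b` is `θ^k` times the even part of `b`, which is central; only `θ^k`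
      -- has to cross `a`.
      have h1 : par (b + par b) = b + par b := by rw [map_add, par_par, add_comm]
      have h2 := comm_of_par_eq h1 a
      have h3 := tv_comm k a
      rw [map_mul, par_tv, neg_mul, sub_neg_eq_add, ← mul_add, ← mul_assoc, mul_assoc (tv k),
        h2, ← mul_assoc, h3, ha]
      noncomm_ring
  have h2 : b - par b = (2 : Hb) • b := by rw [hb, two_smul]; abel
  have h := key b
  rw [h2, mul_smul_comm, smul_mul_assoc, ← smul_neg] at h
  have h3 : cst (1 / 2) * 2 = 1 := by
    rw [show (2 : Hb) = cst 2 by exact (map_ofNat cstHom 2).symm, ← cst_mul]; norm_num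
  have h4 := congrArg (fun t => cst (1 / 2) • t) h
  simpa only [smul_smul, h3, one_smul] using h4

/-! ### The degree filtration -/

/-- The degree filtration on the algebra of superpolynomials. -/
def dge (w : ℤ) : AddSubgroup SP := degGE w

theorem mono_mem_dge (c : ℂ) (p : ℤ) (I : List ℕ+) (K : List ℕ) {w : ℤ}
    (h : w ≤ 2 * p + I.length + K.length) :
    (cst c * hb p) • ((I.map xv).prod * (K.map tv).prod) ∈ dge w :=
  AddSubgroup.subset_closure ⟨c, p, I, K, h, rfl⟩

theorem dge_induction {w : ℤ} {P : (a : SP) → a ∈ dge w → Prop} (zero : P 0 (zero_mem _))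
    (add : ∀ a b ha hb, P a ha → P b hb → P (a + b) (add_mem ha hb))
    (neg : ∀ a ha, P a ha → P (-a) (neg_mem ha))
    (mono : ∀ (c : ℂ) (p : ℤ) (I : List ℕ+) (K : List ℕ) (h : w ≤ 2 * p + I.length + K.length),
      P ((cst c * hb p) • ((I.map xv).prod * (K.map tv).prod)) (mono_mem_dge c p I K h))
    {a : SP} (ha : a ∈ dge w) : P a ha := by
  refine AddSubgroup.closure_induction (p := P) ?_ zero add neg ha
  rintro _ ⟨c, p, I, K, h, rfl⟩
  exact mono c p I K h

theorem dge_anti {w w' : ℤ} (h : w ≤ w') {a : SP} (ha : a ∈ dge w') : a ∈ dge w := by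
  induction ha using dge_induction with
  | zero => exact zero_mem _
  | add a b _ _ ha hb => exact add_mem ha hb
  | neg a _ ha => exact neg_mem ha
  | mono c p I K hw => exact mono_mem_dge c p I K (h.trans hw)

theorem xprod_comm (I : List ℕ+) (a : SP) : a * (I.map xv).prod = (I.map xv).prod * a := by
  induction I with
  | nil => simp
  | cons i I ih => rw [List.map_cons, List.prod_cons, ← mul_assoc, xv_comm, mul_assoc, ih, mul_assoc]

/-- The `x` variables are central, so a product of two ordered monomials is again one, with
concatenated index lists and added powers of `ħ`. -/
theorem mul_mem_dge {w w' : ℤ} {a b : SP} (ha : a ∈ dge w) (hb : b ∈ dge w') :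
    a * b ∈ dge (w + w') := by
  induction ha using dge_induction with
  | zero => rw [zero_mul]; exact zero_mem _
  | add x y _ _ hx hy => rw [add_mul]; exact add_mem hx hy
  | neg a _ ha => rw [neg_mul]; exact neg_mem ha
  | mono c p I K h =>
    induction hb using dge_induction with
    | zero => rw [mul_zero]; exact zero_mem _
    | add x y _ _ hx hy => rw [mul_add]; exact add_mem hx hy
    | neg a _ ha => rw [mul_neg]; exact neg_mem ha
    | mono c' p' I' K' h' =>
      have : ((cst c * hb p) • ((I.map xv).prod * (K.map tv).prod)) *
          ((cst c' * hb p') • ((I'.map xv).prod * (K'.map tv).prod)) =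
          (cst (c * c') * hb (p + p')) •
            (((I ++ I').map xv).prod * ((K ++ K').map tv).prod) := by
        rw [smul_mul_smul_comm, cst_mul, hb_add, List.map_append, List.map_append,
          List.prod_append, List.prod_append, mul_mul_mul_comm]
        congr 1
        rw [mul_assoc, ← mul_assoc (K.map tv).prod, xprod_comm, mul_assoc, mul_assoc]
      rw [this]
      apply mono_mem_dge
      simp only [List.length_append]
      push_cast
      linarith

theorem algebraMap_mem_dge (c : ℂ) (p : ℤ) : algebraMap Hb SP (cst c * hb p) ∈ dge (2 * p) := by
  rw [Algebra.algebraMap_eq_smul_one]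
  simpa using mono_mem_dge c p [] [] (w := 2 * p) (by simp)

theorem one_mem_dge : (1 : SP) ∈ dge 0 := by
  simpa using algebraMap_mem_dge 1 0

theorem xv_mem_dge (i : ℕ+) : xv i ∈ dge 1 := by
  simpa using mono_mem_dge 1 0 [i] [] (w := 1) (by simp)

theorem tv_mem_dge (j : ℕ) : tv j ∈ dge 1 := by
  simpa using mono_mem_dge 1 0 [] [j] (w := 1) (by simp)

theorem cst_mul_hb_smul_mem_dge {w : ℤ} {a : SP} (ha : a ∈ dge w) (c : ℂ) (p : ℤ) :
    (cst c * hb p) • a ∈ dge (w + 2 * p) := by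
  rw [Algebra.smul_def, add_comm]
  exact mul_mem_dge (algebraMap_mem_dge c p) ha

theorem cst_smul_mem_dge {w : ℤ} {a : SP} (ha : a ∈ dge w) (c : ℂ) : cst c • a ∈ dge w := by
  simpa using cst_mul_hb_smul_mem_dge ha c 0

theorem hb_smul_mem_dge {w : ℤ} {a : SP} (ha : a ∈ dge w) (p : ℤ) : hb p • a ∈ dge (w + 2 * p) := by
  simpa using cst_mul_hb_smul_mem_dge ha 1 p

theorem pow_mem_dge {a : SP} (ha : a ∈ dge 1) (n : ℕ) : a ^ n ∈ dge n := by
  induction n with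
  | zero => simpa using one_mem_dge
  | succ n ih => rw [pow_succ]; exact_mod_cast mul_mem_dge ih ha

/-- A superpolynomial has finitely many terms, so its degree is bounded below, possibly by a
negative number because of `ħ⁻¹`. This starts the iteration in `mem_dge_of_mul_mem`. -/
theorem exists_mem_dge (a : SP) : ∃ w, a ∈ dge w := by
  have key {w w' : ℤ} {a b : SP} (ha : a ∈ dge w) (hb : b ∈ dge w') : ∃ u, a + b ∈ dge u :=
    ⟨min w w', add_mem (dge_anti (min_le_left _ _) ha) (dge_anti (min_le_right _ _) hb)⟩
  induction a using sp_induction with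
  | one => exact ⟨0, one_mem_dge⟩
  | add a b ha hb => obtain ⟨w, hw⟩ := ha; obtain ⟨u, hu⟩ := hb; exact key hw hu
  | smul h a ha =>
    obtain ⟨w, hw⟩ := ha
    induction h using hb_induction with
    | add h h' ih ih' =>
      rw [add_smul]; obtain ⟨w, hw⟩ := ih; obtain ⟨u, hu⟩ := ih'; exact key hw hu
    | mono c p => exact ⟨_, cst_mul_hb_smul_mem_dge hw c p⟩
  | xmul i a ha => obtain ⟨w, hw⟩ := ha; exact ⟨_, mul_mem_dge (xv_mem_dge i) hw⟩
  | thmul i a ha => obtain ⟨w, hw⟩ := ha; exact ⟨_, mul_mem_dge (tv_mem_dge i) hw⟩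

theorem der_tprod (v : ℕ+ → ℂ) (K : List ℕ) : der v (K.map tv).prod = 0 := by
  induction K with
  | nil => simp
  | cons j K ih => rw [List.map_cons, List.prod_cons, der_tv_mul, ih, mul_zero]

theorem oder_xprod (w : ℕ → ℂ) (I : List ℕ+) : oder w (I.map xv).prod = 0 := by
  induction I with
  | nil => simp
  | cons j K ih => rw [List.map_cons, List.prod_cons, oder_xv_mul, ih, mul_zero]

theorem par_xprod (I : List ℕ+) : par (I.map xv).prod = (I.map xv).prod := by
  induction I with
  | nil => simp
  | cons j K ih => rw [List.map_cons, List.prod_cons, map_mul, ih, par_xv]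

theorem xprod_mem_dge (I : List ℕ+) : (I.map xv).prod ∈ dge I.length := by
  simpa using mono_mem_dge 1 0 I [] (w := I.length) (by simp)

theorem tprod_mem_dge (K : List ℕ) : (K.map tv).prod ∈ dge K.length := by
  simpa using mono_mem_dge 1 0 [] K (w := K.length) (by simp)

theorem der_mem_dge (v : ℕ+ → ℂ) {w : ℤ} {a : SP} (ha : a ∈ dge w) : der v a ∈ dge (w - 1) := by
  induction ha using dge_induction with
  | zero => rw [map_zero]; exact zero_mem _
  | add x y _ _ hx hy => rw [map_add]; exact add_mem hx hy
  | neg a _ ha => rw [map_neg]; exact neg_mem ha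
  | mono c p I K h =>
    have hI : ∀ I : List ℕ+, der v (I.map xv).prod ∈ dge (I.length - 1) := by
      intro I
      induction I with
      | nil => simp only [List.map_nil, List.prod_nil, der_one]; exact zero_mem _
      | cons i I ih =>
        rw [List.map_cons, List.prod_cons, der_xv_mul]
        have h1 := cst_smul_mem_dge (xprod_mem_dge I) (v i)
        have h2 := mul_mem_dge (xv_mem_dge i) ih
        refine add_mem (dge_anti ?_ h1) (dge_anti ?_ h2) <;> simp
    rw [map_smul, der_mul, der_tprod, mul_zero, add_zero]
    exact dge_anti (by linarith)
      (cst_mul_hb_smul_mem_dge (mul_mem_dge (hI I) (tprod_mem_dge K)) c p)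

theorem oder_mem_dge (v : ℕ → ℂ) {w : ℤ} {a : SP} (ha : a ∈ dge w) : oder v a ∈ dge (w - 1) := by
  induction ha using dge_induction with
  | zero => rw [map_zero]; exact zero_mem _
  | add x y _ _ hx hy => rw [map_add]; exact add_mem hx hy
  | neg a _ ha => rw [map_neg]; exact neg_mem ha
  | mono c p I K h =>
    have hK : ∀ K : List ℕ, oder v (K.map tv).prod ∈ dge (K.length - 1) := by
      intro I
      induction I with
      | nil => simp only [List.map_nil, List.prod_nil, oder_one]; exact zero_mem _
      | cons i I ih =>
        rw [List.map_cons, List.prod_cons, oder_tv_mul]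
        have h1 := cst_smul_mem_dge (tprod_mem_dge I) (v i)
        have h2 := mul_mem_dge (tv_mem_dge i) ih
        refine sub_mem (dge_anti ?_ h1) (dge_anti ?_ h2) <;> simp
    rw [map_smul, oder_mul, oder_xprod, zero_mul, zero_add, par_xprod]
    exact dge_anti (by linarith)
      (cst_mul_hb_smul_mem_dge (mul_mem_dge (xprod_mem_dge I) (hK K)) c p)

/-! ### Taylor coefficients -/

/-- Iterated even derivatives, the first one in the list applied first. -/
def ders : List (ℕ+ → ℂ) → Module.End Hb SP
  | [] => 1
  | v :: l => ders l * der v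

/-- Iterated odd derivatives, the first one in the list applied first. -/
def oders : List (ℕ → ℂ) → Module.End Hb SP
  | [] => 1
  | w :: m => oders m * oder w

@[simp] theorem ders_nil (a : SP) : ders [] a = a := rfl
@[simp] theorem ders_cons (v : ℕ+ → ℂ) (l : List (ℕ+ → ℂ)) (a : SP) :
    ders (v :: l) a = ders l (der v a) := rfl
@[simp] theorem oders_nil (a : SP) : oders [] a = a := rfl
@[simp] theorem oders_cons (w : ℕ → ℂ) (m : List (ℕ → ℂ)) (a : SP) :
    oders (w :: m) a = oders m (oder w a) := rfl

/-- Taylor coefficients at `x = θ = 0`. -/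
def tay (l : List (ℕ+ → ℂ)) (m : List (ℕ → ℂ)) : SP →ₗ[Hb] Hb :=
  aug.toLinearMap ∘ₗ oders m ∘ₗ ders l

theorem tay_apply (l : List (ℕ+ → ℂ)) (m : List (ℕ → ℂ)) (a : SP) :
    tay l m a = aug (oders m (ders l a)) := rfl

theorem oder_ders (w : ℕ → ℂ) (l : List (ℕ+ → ℂ)) (a : SP) :
    oder w (ders l a) = ders l (oder w a) := by
  induction l generalizing a with
  | nil => rfl
  | cons v l ih => rw [ders_cons, ders_cons, ih, der_oder]

theorem tay_cons_left (v : ℕ+ → ℂ) (l : List (ℕ+ → ℂ)) (m : List (ℕ → ℂ)) (a : SP) :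
    tay (v :: l) m a = tay l m (der v a) := rfl

theorem tay_cons_right (l : List (ℕ+ → ℂ)) (w : ℕ → ℂ) (m : List (ℕ → ℂ)) (a : SP) :
    tay l (w :: m) a = tay l m (oder w a) := by
  rw [tay_apply, oders_cons, oder_ders, tay_apply]

theorem hcoef_aug_of_mem_dge {w : ℤ} {a : SP} (ha : a ∈ dge w) {p : ℤ} (hp : 2 * p < w) :
    hcoef p (aug a) = 0 := by
  induction ha using dge_induction with
  | zero => simp
  | add x y _ _ hx hy => rw [map_add, map_add, hx, hy, add_zero]
  | neg a _ ha => rw [map_neg, map_neg, ha, neg_zero]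
  | mono c q I K h =>
    rw [map_smul, map_mul]
    cases I with
    | cons i I => simp
    | nil =>
      cases K with
      | cons j K => simp
      | nil =>
        simp only [List.map_nil, List.prod_nil, map_one, mul_one, smul_eq_mul]
        rw [hcoef_cst_mul_hb, if_neg]
        rintro rfl
        simp only [List.length_nil, Nat.cast_zero, add_zero] at h
        omega

/-- Each derivative costs one degree, and evaluation at the origin leaves only powers of `ħ`, each
of degree two. -/
theorem hcoef_tay_of_mem_dge (l : List (ℕ+ → ℂ)) (m : List (ℕ → ℂ)) {w : ℤ} {a : SP}
    (ha : a ∈ dge w) {p : ℤ} (hp : 2 * p + l.length + m.length < w) :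
    hcoef p (tay l m a) = 0 := by
  induction l generalizing a w with
  | cons v l ih =>
    rw [tay_cons_left]
    refine ih (der_mem_dge v ha) ?_
    simp only [List.length_cons] at hp
    push_cast at hp
    linarith
  | nil =>
    induction m generalizing a w with
    | cons v l ih =>
      rw [tay_cons_right]
      refine ih (oder_mem_dge v ha) ?_
      simp only [List.length_cons] at hp
      push_cast at hp
      linarith
    | nil => exact hcoef_aug_of_mem_dge ha (by simpa using hp)

theorem hb_eq_sum (h : Hb) : ∃ s : Finset ℤ, h = ∑ p ∈ s, cst (hcoef p h) * hb p := by
  classical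
  have key : ∀ (s : Finset ℤ) (c : ℤ → ℂ) (q : ℤ), hcoef q (∑ p ∈ s, cst (c p) * hb p) =
      if q ∈ s then c q else 0 := by
    intro s c q
    simp [map_sum, hcoef_cst_mul_hb]
  have ex : ∃ (s : Finset ℤ) (c : ℤ → ℂ), h = ∑ p ∈ s, cst (c p) * hb p := by
    induction h using hb_induction with
    | mono c p => exact ⟨{p}, fun _ => c, by simp⟩
    | add a b ha hb =>
      obtain ⟨s, c, rfl⟩ := ha
      obtain ⟨t, d, rfl⟩ := hb
      refine ⟨s ∪ t, fun p => (if p ∈ s then c p else 0) + (if p ∈ t then d p else 0), ?_⟩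
      simp only [cst_add, add_mul, Finset.sum_add_distrib, apply_ite cst, cst_zero, ite_mul,
        zero_mul]
      rw [← Finset.sum_filter, ← Finset.sum_filter]
      congr 2
      · ext p; simp only [Finset.mem_filter, Finset.mem_union]; tauto
      · ext p; simp only [Finset.mem_filter, Finset.mem_union]; tauto
  obtain ⟨s, c, hs⟩ := ex
  refine ⟨s, ?_⟩
  conv_lhs => rw [hs]
  refine Finset.sum_congr rfl fun p hp => ?_
  rw [hs, key, if_pos hp]

theorem smul_mem_dge {h : Hb} {u w : ℤ} (hh : ∀ p, 2 * p < u → hcoef p h = 0) {a : SP}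
    (ha : a ∈ dge w) : h • a ∈ dge (u + w) := by
  obtain ⟨s, hs⟩ := hb_eq_sum h
  rw [hs, Finset.sum_smul]
  refine sum_mem fun p _ => ?_
  by_cases hp : 2 * p < u
  · rw [hh p hp, cst_zero, zero_mul, zero_smul]; exact zero_mem _
  · exact dge_anti (by linarith) (cst_mul_hb_smul_mem_dge ha _ p)

/-! ### Superpolynomials are determined by their Taylor coefficients -/

theorem der_single_tm_one (i : ℕ+) (P : MvPolynomial ℕ+ Hb) :
    der (Pi.single i 1) (tm P 1) = tm (MvPolynomial.pderiv i P) 1 := by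
  rw [← dx_eq_der]; rfl

/-- Differentiating in a variable that occurs in the monomial multiplies its coefficient by a
nonzero integer and lowers the degree, so in characteristic zero the derivatives at the origin
recover all coefficients. -/
theorem hcoef_coeff_eq_zero {p : ℤ} (d : ℕ) (P : MvPolynomial ℕ+ Hb)
    (h : ∀ I : List ℕ+, I.length = d →
      hcoef p (tay (I.map fun i => Pi.single i 1) [] (tm P 1)) = 0)
    (m : ℕ+ →₀ ℕ) (hm : m.degree = d) : hcoef p (MvPolynomial.coeff m P) = 0 := by
  induction d generalizing P m with
  | zero =>
    have h0 := h [] rfl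
    rw [Finsupp.degree_eq_zero_iff] at hm
    subst hm
    have : tay [] [] (tm P 1) = MvPolynomial.coeff 0 P := by
      rw [tay_apply, ders_nil, oders_nil, aug_tm, map_one, mul_one, MvPolynomial.aeval_zero']
      rfl
    rw [List.map_nil, this] at h0
    exact h0
  | succ d ih =>
    have hne : m ≠ 0 := by rintro rfl; simp at hm
    obtain ⟨i, hi⟩ := Finsupp.ne_iff.mp hne
    have hle : Finsupp.single i 1 ≤ m := by
      rw [Finsupp.single_le_iff]; exact Nat.one_le_iff_ne_zero.mpr hi
    obtain ⟨m', rfl⟩ := exists_add_of_le hle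
    rw [map_add, Finsupp.degree_single, add_comm] at hm
    have h1 := ih (MvPolynomial.pderiv i P) (fun I hI => by
      have := h (i :: I) (by simp [hI])
      rwa [List.map_cons, tay_cons_left, der_single_tm_one] at this) m' (by omega)
    rw [MvPolynomial.coeff_pderiv, mul_comm] at h1
    have h2 : ((m' i : Hb) + 1) = cst ((m' i : ℂ) + 1) := by
      rw [cst_add, cst_natCast, cst_one]
    rw [h2, hcoef_cst_mul, mul_eq_zero] at h1
    rcases h1 with h1 | h1
    · exact absurd h1 (Nat.cast_add_one_ne_zero (m' i))
    · rwa [add_comm]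

theorem tm_monomial_mem_dge (m : ℕ+ →₀ ℕ) :
    tm (MvPolynomial.monomial m 1) 1 ∈ dge m.degree := by
  induction m using Finsupp.induction_linear with
  | zero => exact_mod_cast one_mem_dge
  | add f g hf hg =>
    have := mul_mem_dge hf hg
    rw [tm_mul_tm, MvPolynomial.monomial_mul, one_mul, one_mul] at this
    simpa using this
  | single i n =>
    have h := pow_mem_dge (xv_mem_dge i) n
    have : xv i ^ n = tm (MvPolynomial.X i ^ n) 1 := by
      induction n with
      | zero => rfl
      | succ n ih => rw [pow_succ, ih (pow_mem_dge (xv_mem_dge i) n), xv_eq, tm_mul_tm, pow_succ,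
          one_mul]
    rw [this, MvPolynomial.X_pow_eq_monomial] at h
    simpa using h

theorem tm_one_mem_dge {w : ℤ} (P : MvPolynomial ℕ+ Hb)
    (h : ∀ (I : List ℕ+) (p : ℤ), 2 * p + I.length < w →
      hcoef p (tay (I.map fun i => Pi.single i 1) [] (tm P 1)) = 0) : tm P 1 ∈ dge w := by
  have hsum : ∀ s : Finset (ℕ+ →₀ ℕ), tm (∑ m ∈ s,
      MvPolynomial.monomial m (MvPolynomial.coeff m P)) 1 =
      ∑ m ∈ s, MvPolynomial.coeff m P • tm (MvPolynomial.monomial m 1) 1 := by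
    classical
    intro s
    induction s using Finset.induction_on with
    | empty => simp [zero_tm]
    | insert m s hm ih =>
      rw [Finset.sum_insert hm, Finset.sum_insert hm, add_tm, ih, ← smul_tm,
        MvPolynomial.smul_monomial, smul_eq_mul, mul_one]
  rw [MvPolynomial.as_sum P, hsum]
  refine sum_mem fun m _ => ?_
  refine dge_anti (le_of_eq ?_) (smul_mem_dge (u := w - m.degree) (fun p hp => ?_)
    (tm_monomial_mem_dge m))
  · ring
  · refine hcoef_coeff_eq_zero m.degree P (fun I hI => h I p ?_) m rfl
    rw [hI]; linarith

/-- Superpolynomials in `θ^0, …, θ^{N-1}` and all `x^i`. -/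
def thetaBelow : ℕ → Submodule Hb SP
  | 0 =>
    { carrier := {a | ∃ P, tm P 1 = a}
      zero_mem' := ⟨0, zero_tm 1⟩
      add_mem' := by rintro _ _ ⟨P, rfl⟩ ⟨Q, rfl⟩; exact ⟨P + Q, add_tm P Q 1⟩
      smul_mem' := by rintro c _ ⟨P, rfl⟩; exact ⟨c • P, smul_tm c P 1⟩ }
  | N + 1 => thetaBelow N ⊔ (thetaBelow N).map (LinearMap.mulLeft Hb (tv N))

theorem mem_thetaBelow_zero {a : SP} : a ∈ thetaBelow 0 ↔ ∃ P, tm P 1 = a := Iff.rfl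

theorem mem_thetaBelow_succ {N : ℕ} {a : SP} :
    a ∈ thetaBelow (N + 1) ↔ ∃ s ∈ thetaBelow N, ∃ t ∈ thetaBelow N, s + tv N * t = a := by
  simp [thetaBelow, Submodule.mem_sup]

theorem thetaBelow_mono {N M : ℕ} (h : N ≤ M) : thetaBelow N ≤ thetaBelow M :=
  monotone_nat_of_le_succ (f := thetaBelow) (fun _ => le_sup_left) h

theorem xv_mul_mem_thetaBelow (i : ℕ+) {N : ℕ} {a : SP} (ha : a ∈ thetaBelow N) :
    xv i * a ∈ thetaBelow N := by
  induction N generalizing a with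
  | zero =>
    obtain ⟨P, rfl⟩ := mem_thetaBelow_zero.mp ha
    rw [xv_eq, tm_mul_tm, one_mul]
    exact mem_thetaBelow_zero.mpr ⟨_, rfl⟩
  | succ N ih =>
    obtain ⟨s, hs, t, ht, rfl⟩ := mem_thetaBelow_succ.mp ha
    refine mem_thetaBelow_succ.mpr ⟨_, ih hs, _, ih ht, ?_⟩
    rw [mul_add, ← mul_assoc, xv_comm, mul_assoc]

theorem tv_mul_mem_thetaBelow {j N : ℕ} (hj : j < N) {a : SP} (ha : a ∈ thetaBelow N) :
    tv j * a ∈ thetaBelow N := by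
  induction N generalizing a with
  | zero => omega
  | succ N ih =>
    obtain ⟨s, hs, t, ht, rfl⟩ := mem_thetaBelow_succ.mp ha
    rcases Nat.lt_succ_iff_lt_or_eq.mp hj with hj | rfl
    · refine mem_thetaBelow_succ.mpr ⟨_, ih hj hs, _, neg_mem (ih hj ht), ?_⟩
      rw [mul_add, mul_neg, ← mul_assoc, ← mul_assoc, tv_mul_tv j N, neg_mul]
    · refine mem_thetaBelow_succ.mpr ⟨0, zero_mem _, s, hs, ?_⟩
      rw [mul_add, ← mul_assoc, tv_mul_self, zero_mul, add_zero, zero_add]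

theorem exists_mem_thetaBelow (a : SP) : ∃ N, a ∈ thetaBelow N := by
  induction a using sp_induction with
  | one => exact ⟨0, mem_thetaBelow_zero.mpr ⟨1, rfl⟩⟩
  | add a b ha hb =>
    obtain ⟨N, hN⟩ := ha
    obtain ⟨M, hM⟩ := hb
    exact ⟨max N M, add_mem (thetaBelow_mono (le_max_left _ _) hN)
      (thetaBelow_mono (le_max_right _ _) hM)⟩
  | smul h a ha => obtain ⟨N, hN⟩ := ha; exact ⟨N, Submodule.smul_mem _ _ hN⟩
  | xmul i a ha => obtain ⟨N, hN⟩ := ha; exact ⟨N, xv_mul_mem_thetaBelow i hN⟩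
  | thmul j a ha =>
    obtain ⟨N, hN⟩ := ha
    exact ⟨max N (j + 1), tv_mul_mem_thetaBelow (lt_of_lt_of_le (Nat.lt_succ_self j)
      (le_max_right _ _)) (thetaBelow_mono (le_max_left _ _) hN)⟩

theorem oder_single_eq_zero {N j : ℕ} (hj : N ≤ j) {a : SP} (ha : a ∈ thetaBelow N) :
    oder (Pi.single j 1) a = 0 := by
  induction N generalizing a with
  | zero =>
    obtain ⟨P, rfl⟩ := mem_thetaBelow_zero.mp ha
    rw [oder_tm, CliffordAlgebra.contractLeft_one, tm_zero]
  | succ N ih =>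
    obtain ⟨s, hs, t, ht, rfl⟩ := mem_thetaBelow_succ.mp ha
    rw [map_add, oder_tv_mul, ih (by omega) hs, ih (by omega) ht, mul_zero, sub_zero, zero_add,
      Pi.single_eq_of_ne (by omega), cst_zero, zero_smul]

/-- Converse of `hcoef_tay_of_mem_dge`. Peel off the highest Grassmann variable, `a = s + θ^N t`.
Since `∂/∂θ^N` maps `a` to `t`, the hypothesis controls `t`, then `θ^N t`, and by subtraction `s`.
-/
theorem mem_dge_of_hcoef_tay {w : ℤ} {a : SP}
    (h : ∀ (I : List ℕ+) (K : List ℕ) (p : ℤ), 2 * p + I.length + K.length < w →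
      hcoef p (tay (I.map fun i => Pi.single i 1) (K.map fun j => Pi.single j 1) a) = 0) :
    a ∈ dge w := by
  obtain ⟨N, hN⟩ := exists_mem_thetaBelow a
  induction N generalizing a w with
  | zero =>
    obtain ⟨P, rfl⟩ := mem_thetaBelow_zero.mp hN
    exact tm_one_mem_dge P fun I p hp => h I [] p (by simpa using hp)
  | succ N ih =>
    obtain ⟨s, hs, t, ht, rfl⟩ := mem_thetaBelow_succ.mp hN
    have ht' : t ∈ dge (w - 1) := by
      refine ih (fun I K p hp => ?_) ht
      have := h I (N :: K) p (by rw [List.length_cons]; push_cast; linarith)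
      rwa [List.map_cons, tay_cons_right, map_add, oder_tv_mul, oder_single_eq_zero le_rfl hs,
        oder_single_eq_zero le_rfl ht, mul_zero, sub_zero, zero_add, Pi.single_eq_same, cst_one,
        one_smul] at this
    have ht'' := mul_mem_dge (tv_mem_dge N) ht'
    rw [add_sub_cancel] at ht''
    refine add_mem (ih (fun I K p hp => ?_) hs) ht''
    have h1 := h I K p hp
    rwa [map_add, map_add, hcoef_tay_of_mem_dge _ _ ht'' (by simpa using hp), add_zero] at h1

/-! ### Exponentials of locally nilpotent operators -/

/-- `c^r X^r / r!`. -/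
def expTerm (X : Module.End Hb SP) (c : ℂ) (r : ℕ) : Module.End Hb SP :=
  cst (c ^ r / (r.factorial : ℂ)) • X ^ r

theorem expTerm_succ (X : Module.End Hb SP) (r : ℕ) :
    cst (r + 1) • expTerm X 1 (r + 1) = X * expTerm X 1 r := by
  rw [expTerm, expTerm, smul_smul, ← cst_mul, mul_smul_comm, ← pow_succ']
  congr 2
  rw [Nat.factorial_succ]
  have : ((r : ℂ) + 1) ≠ 0 := Nat.cast_add_one_ne_zero r
  have h2 : ((r.factorial : ℕ) : ℂ) ≠ 0 := by exact_mod_cast r.factorial_ne_zero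
  push_cast
  rw [one_pow, one_pow]
  field_simp

theorem cst_smul_cancel {M : Type*} [AddCommGroup M] [Module Hb M] {c : ℂ} (hc : c ≠ 0) {a b : M}
    (h : cst c • a = cst c • b) : a = b := by
  have := congrArg (fun t => cst c⁻¹ • t) h
  simpa [smul_smul, ← cst_mul, inv_mul_cancel₀ hc] using this

/-- This is `e^X A = (A + B + C/2) e^X`, where `B` and `C` are the first and second iterated
commutators of `X` with `A` and the third vanishes, compared in each degree in `X`. -/
theorem expTerm_mul {X A B C : Module.End Hb SP} (hA : X * A = A * X + B)
    (hB : X * B = B * X + C) (hC : X * C = C * X) (r : ℕ) :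
    expTerm X 1 (r + 2) * A = A * expTerm X 1 (r + 2) + B * expTerm X 1 (r + 1) +
      cst (1 / 2) • (C * expTerm X 1 r) := by
  have e0 : expTerm X 1 0 = 1 := by simp [expTerm]
  have e1 : expTerm X 1 1 = X := by simp [expTerm]
  have h12 : cst (1 / 2) * cst 2 = 1 := by rw [← cst_mul]; norm_num
  induction r with
  | zero =>
    have e2 : cst 2 • expTerm X 1 2 = X * X := by
      have := expTerm_succ X 1
      rw [e1] at this
      rw [← this]; norm_num
    apply cst_smul_cancel (c := 2) two_ne_zero
    rw [← smul_mul_assoc, smul_add, smul_add, ← mul_smul_comm, e0, e1, smul_smul, mul_comm (cst 2),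
      h12, one_smul, e2, mul_one]
    rw [mul_assoc, hA, mul_add, ← mul_assoc, hA, add_mul, hB, mul_assoc,
      show cst 2 • (B * X) = B * X + B * X by
        rw [show (2 : ℂ) = 1 + 1 by norm_num, cst_add, cst_one, add_smul, one_smul]]
    abel
  | succ r ih =>
    have h3 : cst ((r : ℂ) + 3) • expTerm X 1 (r + 3) = X * expTerm X 1 (r + 2) := by
      rw [← expTerm_succ]; push_cast; congr 2; ring
    have h2 : cst ((r : ℂ) + 2) • expTerm X 1 (r + 2) = X * expTerm X 1 (r + 1) := by
      rw [← expTerm_succ]; push_cast; congr 2; ring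
    have h1 := expTerm_succ X r
    have hne : (r : ℂ) + 3 ≠ 0 := by exact_mod_cast Nat.succ_ne_zero (r + 2)
    -- Multiplying by `r + 3` turns the divided power into `X` times the previous one. The
    -- commutators created by moving `X` once are absorbed by `r + 3 = (r + 2) + 1` and `(r + 3)/2 =
    -- (r + 1)/2 + 1`.
    apply cst_smul_cancel hne
    rw [← smul_mul_assoc, h3, mul_assoc, ih, smul_add, smul_add, ← mul_smul_comm (cst (r + 3)) A, h3]
    rw [mul_add, mul_add, ← mul_assoc, hA, ← mul_assoc, hB, mul_smul_comm, ← mul_assoc, hC,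
      add_mul, add_mul, mul_assoc, mul_assoc, mul_assoc, ← h2, ← h1]
    simp only [mul_smul_comm, smul_smul, ← cst_mul]
    have a1 : cst ((r : ℂ) + 3) • (B * expTerm X 1 (r + 2)) =
        cst ((r : ℂ) + 2) • (B * expTerm X 1 (r + 2)) + B * expTerm X 1 (r + 2) := by
      rw [show (r : ℂ) + 3 = (r + 2) + 1 by ring, cst_add _ 1, cst_one, add_smul, one_smul]
    have a2 : cst (((r : ℂ) + 3) * (1 / 2)) • (C * expTerm X 1 (r + 1)) =
        cst ((1 / 2) * ((r : ℂ) + 1)) • (C * expTerm X 1 (r + 1)) + C * expTerm X 1 (r + 1) := by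
      rw [show ((r : ℂ) + 3) * (1 / 2) = (1 / 2) * (r + 1) + 1 by ring, cst_add _ 1, cst_one,
        add_smul, one_smul]
    rw [a1, a2]
    abel

/-- `E` is the exponential of `c X`, computed on each superpolynomial by a finite sum. -/
def IsLocExp (X : Module.End Hb SP) (c : ℂ) (E : SP → SP) : Prop :=
  ∀ f, ∀ᶠ M : ℕ in atTop, E f = ∑ r ∈ Finset.range M, expTerm X c r f

/-- Two nested commutators are enough for every mode conjugated by `Φ`; the second one is nonzero
only for fermions. -/
theorem IsLocExp.comm {X A B C : Module.End Hb SP} {E : SP → SP} (hE : IsLocExp X 1 E)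
    (hA : X * A = A * X + B) (hB : X * B = B * X + C) (hC : X * C = C * X) (f : SP) :
    E (A f) = A (E f) + B (E f) + cst (1 / 2) • C (E f) := by
  obtain ⟨M0, h0⟩ := eventually_atTop.mp (hE (A f))
  obtain ⟨M1, h1⟩ := eventually_atTop.mp (hE f)
  set M := max M0 M1
  have hM0 : M0 ≤ M := le_max_left _ _
  have hM1 : M1 ≤ M := le_max_right _ _
  have e0 : expTerm X 1 0 = 1 := by simp [expTerm]
  have e1 : expTerm X 1 1 = X := by simp [expTerm]
  rw [h0 (M + 2) (by omega), Finset.sum_range_succ', Finset.sum_range_succ']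
  have key (r : ℕ) : expTerm X 1 (r + 2) (A f) = A (expTerm X 1 (r + 2) f) +
      B (expTerm X 1 (r + 1) f) + cst (1 / 2) • C (expTerm X 1 r f) := by
    have := LinearMap.congr_fun (expTerm_mul hA hB hC r) f
    simpa only [Module.End.mul_apply, LinearMap.add_apply, LinearMap.smul_apply] using this
  -- The terms with `A`, `B` and `C` carry divided powers of index `r + 2`, `r + 1` and `r`, so the
  -- same exponential is cut at `M + 2`, `M + 1` and `M`.
  have kA := h1 (M + 2) (by omega)
  have kB := h1 (M + 1) (by omega)
  have kC := h1 M (by omega)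
  rw [Finset.sum_range_succ', Finset.sum_range_succ'] at kA
  rw [Finset.sum_range_succ'] at kB
  have hA' := LinearMap.congr_fun hA f
  simp only [Module.End.mul_apply, LinearMap.add_apply] at hA'
  simp only [key, Finset.sum_add_distrib, zero_add, e0, e1, Module.End.one_apply, hA',
    ← map_sum, ← Finset.smul_sum] at kA kB ⊢
  rw [← kC]
  rw [show A (E f) = _ from congrArg A kA, show B (E f) = _ from congrArg B kB]
  simp only [map_add]
  abel

/-- The power series identity `e^x e^{-x} = 1`, truncated modulo `x^M`. -/
theorem expPoly_mul (M : ℕ) : ∃ R : Polynomial ℂ,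
    (∑ r ∈ Finset.range M, Polynomial.monomial r ((1 : ℂ) ^ r / (r.factorial : ℂ))) *
      (∑ r ∈ Finset.range M, Polynomial.monomial r ((-1 : ℂ) ^ r / (r.factorial : ℂ))) =
      1 + R * Polynomial.X ^ M := by
  have h1 : ∀ c : ℂ, (∑ r ∈ Finset.range M, Polynomial.monomial r (c ^ r / (r.factorial : ℂ))) =
      PowerSeries.trunc M (PowerSeries.rescale c (PowerSeries.exp ℂ)) := by
    intro c
    ext n
    rw [Polynomial.finsetSum_coeff, PowerSeries.coeff_trunc, PowerSeries.coeff_rescale,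
      PowerSeries.coeff_exp]
    simp only [Polynomial.coeff_monomial, Finset.sum_ite_eq', Finset.mem_range]
    simp [div_eq_mul_inv]
  have hd : (Polynomial.X : Polynomial ℂ) ^ M ∣
      (∑ r ∈ Finset.range M, Polynomial.monomial r ((1 : ℂ) ^ r / (r.factorial : ℂ))) *
      (∑ r ∈ Finset.range M, Polynomial.monomial r ((-1 : ℂ) ^ r / (r.factorial : ℂ))) - 1 := by
    rw [Polynomial.X_pow_dvd_iff]
    intro d hd
    rw [h1, h1, Polynomial.coeff_sub, ← Polynomial.coeff_coe, Polynomial.coe_mul,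
      ← PowerSeries.coeff_mul_eq_coeff_trunc_mul_trunc _ _ hd, PowerSeries.rescale_one,
      RingHom.id_apply]
    have := PowerSeries.exp_mul_exp_neg_eq_one (A := ℂ)
    rw [PowerSeries.evalNegHom] at this
    rw [this, PowerSeries.coeff_one, Polynomial.coeff_one]
    simp
  obtain ⟨R, hR⟩ := hd
  exact ⟨R, by rw [mul_comm R, ← hR]; ring⟩

/-- Substitute `X` into the truncated polynomial identity; the remainder contains `X^M`, which kills
`f` once `M` is large. -/
theorem IsLocExp.mul_neg {X : Module.End Hb SP} {E E' : SP → SP} (hE : IsLocExp X 1 E)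
    (hE' : IsLocExp X (-1) E') (hX : ∀ f, ∀ᶠ r : ℕ in atTop, (X ^ r) f = 0) (f : SP) :
    E (E' f) = f := by
  obtain ⟨M0, h0⟩ := eventually_atTop.mp (hE (E' f))
  obtain ⟨M1, h1⟩ := eventually_atTop.mp (hE' f)
  obtain ⟨M2, h2⟩ := eventually_atTop.mp (hX f)
  set M := max M0 (max M1 M2) + 1 with hM
  rw [h0 M (by omega), h1 M (by omega)]
  obtain ⟨R, hR⟩ := expPoly_mul M
  let ev : Polynomial ℂ →+* Module.End Hb SP :=
    (Polynomial.aeval X : Polynomial Hb →ₐ[Hb] Module.End Hb SP).toRingHom.comp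
      (Polynomial.mapRingHom cstHom)
  have hev (r : ℕ) (c : ℂ) : ev (Polynomial.monomial r c) = cst c • X ^ r := by
    simp only [ev, RingHom.comp_apply, Polynomial.coe_mapRingHom, Polynomial.map_monomial,
      AlgHom.toRingHom_eq_coe, RingHom.coe_coe, Polynomial.aeval_monomial]
    rw [Algebra.smul_def]; rfl
  have hevX : ev (Polynomial.X ^ M) = X ^ M := by
    rw [← Polynomial.monomial_one_right_eq_X_pow, hev, cst_one, one_smul]
  have := LinearMap.congr_fun (congrArg ev hR) f
  rw [map_mul, map_sum, map_sum, map_add, map_one, map_mul, hevX] at this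
  simp only [hev, Module.End.mul_apply, LinearMap.add_apply, Module.End.one_apply,
    LinearMap.sum_apply] at this
  rw [h2 M (by omega), map_zero, add_zero] at this
  exact this

/-! ### Modes -/

theorem der_add (v v' : ℕ+ → ℂ) (f : SP) : der (v + v') f = der v f + der v' f := by
  induction f using sp_induction with
  | one => simp
  | add a b ha hb => simp only [map_add, ha, hb]; abel
  | smul h a ha => simp only [map_smul, ha, smul_add]
  | xmul i a ha => simp only [der_xv_mul, ha, Pi.add_apply, cst_add, add_smul, mul_add]; abel
  | thmul j a ha => simp only [der_tv_mul, ha, mul_add]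

theorem der_smul (c : ℂ) (v : ℕ+ → ℂ) (f : SP) : der (c • v) f = cst c • der v f := by
  induction f using sp_induction with
  | one => simp
  | add a b ha hb => simp only [map_add, ha, hb, smul_add]
  | smul h a ha => rw [map_smul, map_smul, ha, smul_comm]
  | xmul i a ha =>
    rw [der_xv_mul, der_xv_mul, ha, Pi.smul_apply, smul_eq_mul, cst_mul, mul_smul, smul_add,
      mul_smul_comm]
  | thmul j a ha => simp only [der_tv_mul, ha, mul_smul_comm]

theorem oder_add (v v' : ℕ → ℂ) (f : SP) : oder (v + v') f = oder v f + oder v' f := by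
  induction f using sp_induction with
  | one => simp
  | add a b ha hb => simp only [map_add, ha, hb]; abel
  | smul h a ha => simp only [map_smul, ha, smul_add]
  | xmul i a ha => simp only [oder_xv_mul, ha, mul_add]
  | thmul j a ha => simp only [oder_tv_mul, ha, mul_add, Pi.add_apply, cst_add, add_smul]; abel

theorem oder_smul (c : ℂ) (v : ℕ → ℂ) (f : SP) : oder (c • v) f = cst c • oder v f := by
  induction f using sp_induction with
  | one => simp
  | add a b ha hb => simp only [map_add, ha, hb, smul_add]
  | smul h a ha => rw [map_smul, map_smul, ha, smul_comm]
  | xmul i a ha => simp only [oder_xv_mul, ha, mul_smul_comm]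
  | thmul j a ha =>
    rw [oder_tv_mul, oder_tv_mul, ha, Pi.smul_apply, smul_eq_mul, cst_mul, mul_smul, smul_sub,
      mul_smul_comm]

theorem der_zero (f : SP) : der 0 f = 0 := by simpa using der_smul 0 0 f
theorem oder_zero (f : SP) : oder 0 f = 0 := by simpa using oder_smul 0 0 f

theorem der_sum {ι : Type*} (s : Finset ι) (v : ι → ℕ+ → ℂ) (f : SP) :
    der (∑ i ∈ s, v i) f = ∑ i ∈ s, der (v i) f := by
  classical
  induction s using Finset.induction_on with
  | empty => simp [der_zero]
  | insert i s hi ih => rw [Finset.sum_insert hi, Finset.sum_insert hi, der_add, ih]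

theorem oder_sum {ι : Type*} (s : Finset ι) (v : ι → ℕ → ℂ) (f : SP) :
    oder (∑ i ∈ s, v i) f = ∑ i ∈ s, oder (v i) f := by
  classical
  induction s using Finset.induction_on with
  | empty => simp [oder_zero]
  | insert i s hi ih => rw [Finset.sum_insert hi, Finset.sum_insert hi, oder_add, ih]

/-- `{1, …, M + 1}`. -/
def pnats (M : ℕ) : Finset ℕ+ := Finset.Icc 1 M.succPNat

theorem mem_pnats {M : ℕ} {i : ℕ+} : i ∈ pnats M ↔ (i : ℕ) ≤ M + 1 := by
  rw [pnats, Finset.mem_Icc, ← PNat.coe_le_coe i, Nat.succPNat_coe]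
  exact ⟨fun h => h.2, fun h => ⟨one_le, h⟩⟩

/-- Only finitely many variables occur in `f`. The threshold is uniform in the direction `v`, which
lets directions with infinitely many components be truncated. -/
theorem eventually_der_eq_zero (f : SP) :
    ∀ᶠ M in atTop, ∀ v : ℕ+ → ℂ, (∀ i ∈ pnats M, v i = 0) → der v f = 0 := by
  induction f using sp_induction with
  | one => simp
  | add a b ha hb =>
    filter_upwards [ha, hb] with M h1 h2 v hv
    rw [map_add, h1 v hv, h2 v hv, add_zero]
  | smul h a ha =>
    filter_upwards [ha] with M h1 v hv
    rw [map_smul, h1 v hv, smul_zero]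
  | xmul i a ha =>
    filter_upwards [ha, eventually_ge_atTop (i : ℕ)] with M h1 hM v hv
    rw [der_xv_mul, h1 v hv, hv i (mem_pnats.mpr (by omega)), cst_zero, zero_smul, mul_zero,
      add_zero]
  | thmul j a ha =>
    filter_upwards [ha] with M h1 v hv
    rw [der_tv_mul, h1 v hv, mul_zero]

theorem eventually_oder_eq_zero (f : SP) :
    ∀ᶠ M in atTop, ∀ v : ℕ → ℂ, (∀ i < M, v i = 0) → oder v f = 0 := by
  induction f using sp_induction with
  | one => simp
  | add a b ha hb =>
    filter_upwards [ha, hb] with M h1 h2 v hv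
    rw [map_add, h1 v hv, h2 v hv, add_zero]
  | smul h a ha =>
    filter_upwards [ha] with M h1 v hv
    rw [map_smul, h1 v hv, smul_zero]
  | xmul i a ha =>
    filter_upwards [ha] with M h1 v hv
    rw [oder_xv_mul, h1 v hv, mul_zero]
  | thmul j a ha =>
    filter_upwards [ha, eventually_gt_atTop j] with M h1 hM v hv
    rw [oder_tv_mul, h1 v hv, hv j hM, cst_zero, zero_smul, mul_zero, sub_zero]

theorem eventually_der_eq_sum (f : SP) : ∀ᶠ M in atTop, ∀ v : ℕ+ → ℂ,
    der v f = ∑ i ∈ pnats M, cst (v i) • der (Pi.single i 1) f := by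
  filter_upwards [eventually_der_eq_zero f] with M hM v
  have h := hM (v - ∑ i ∈ pnats M, v i • Pi.single i 1) (fun i hi => by
    simp [Finset.sum_apply, Pi.single_apply, hi])
  have h2 : v = (v - ∑ i ∈ pnats M, v i • Pi.single i 1) + ∑ i ∈ pnats M, v i • Pi.single i 1 := by
    simp
  conv_lhs => rw [h2]
  rw [der_add, h, zero_add, der_sum]
  simp only [der_smul]

theorem eventually_oder_eq_sum (f : SP) : ∀ᶠ M in atTop, ∀ v : ℕ → ℂ,
    oder v f = ∑ i ∈ Finset.range M, cst (v i) • oder (Pi.single i 1) f := by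
  filter_upwards [eventually_oder_eq_zero f] with M hM v
  have h := hM (v - ∑ i ∈ Finset.range M, v i • Pi.single i 1) (fun i hi => by
    simp [Finset.sum_apply, Pi.single_apply, hi])
  have h2 : v = (v - ∑ i ∈ Finset.range M, v i • Pi.single i 1) +
      ∑ i ∈ Finset.range M, v i • Pi.single i 1 := by simp
  conv_lhs => rw [h2]
  rw [oder_add, h, zero_add, oder_sum]
  simp only [oder_smul]

/-- `∑_k c_k Γ_k`, the sum over `k ≥ 0`. -/
def gop (c : ℕ → ℂ) : Module.End Hb SP :=
  hb 1 • oder c + cst (c 0 / 2) • LinearMap.mulLeft Hb (tv 0)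

theorem gop_apply (c : ℕ → ℂ) (f : SP) :
    gop c f = hb 1 • oder c f + cst (c 0 / 2) • (tv 0 * f) := rfl

theorem gop_add (c c' : ℕ → ℂ) (f : SP) : gop (c + c') f = gop c f + gop c' f := by
  rw [gop_apply, gop_apply, gop_apply, oder_add, Pi.add_apply, add_div, cst_add, add_smul, smul_add]
  abel

theorem gop_smul (a : ℂ) (c : ℕ → ℂ) (f : SP) : gop (a • c) f = cst a • gop c f := by
  rw [gop_apply, gop_apply, oder_smul, Pi.smul_apply, smul_eq_mul, mul_div_assoc, cst_mul, mul_smul,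
    smul_add, smul_comm (hb 1)]

theorem eventually_gop_eq_sum (f : SP) : ∀ᶠ M in atTop, ∀ c : ℕ → ℂ,
    gop c f = ∑ i ∈ Finset.range M, cst (c i) • gop (Pi.single i 1) f := by
  filter_upwards [eventually_oder_eq_sum f, eventually_gt_atTop 0] with M hM h0 c
  simp only [gop_apply, hM c, smul_add, Finset.sum_add_distrib, Finset.smul_sum]
  congr 1
  · exact Finset.sum_congr rfl fun i _ => smul_comm _ _ _
  · rw [Finset.sum_eq_single 0]
    · rw [smul_smul, ← cst_mul]
      congr 2
      simp [div_eq_mul_inv]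
    · intro i _ hi
      rw [Pi.single_eq_of_ne hi.symm]; simp
    · simp [h0]

/-- Among the nonnegative modes only `Γ_0` fails to anticommute with itself: `θ^0/2 + ħ∂/∂θ^0`
squares to `ħ/2`. -/
theorem gop_anticomm (c c' : ℕ → ℂ) (f : SP) :
    gop c (gop c' f) = cst (c 0 * c' 0) • hb 1 • f - gop c' (gop c f) := by
  have h0 (x : ℂ) : cst x = 2 * cst (x / 2) := by
    rw [show (2 : Hb) = cst 2 from (map_ofNat cstHom 2).symm, ← cst_mul]; congr 1; ring
  simp only [gop_apply, map_add, map_smul, oder_tv_mul, oder_anticomm c c' f, h0 (c 0), h0 (c' 0),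
    cst_mul (c 0)]
  rw [← mul_assoc, tv_mul_self, zero_mul]
  generalize oder c' (oder c f) = A, tv 0 * oder c' f = B, tv 0 * oder c f = D,
    cst (c 0 / 2) = x, cst (c' 0 / 2) = y, hb 1 = z
  module

theorem gop_tv_mul (c : ℕ → ℂ) (b : ℕ) (f : SP) :
    gop c (tv b * f) = cst (c b) • hb 1 • f - tv b * gop c f := by
  simp only [gop_apply, oder_tv_mul, mul_add, mul_smul_comm, smul_sub, smul_smul]
  rw [← mul_assoc, tv_mul_tv 0 b, neg_mul, mul_assoc, smul_neg, mul_comm (hb 1)]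
  abel

theorem gop_xv_mul (c : ℕ → ℂ) (b : ℕ+) (f : SP) : gop c (xv b * f) = xv b * gop c f := by
  simp only [gop_apply, oder_xv_mul, mul_add, mul_smul_comm]
  rw [← mul_assoc, xv_comm, mul_assoc]

theorem gop_der (c : ℕ → ℂ) (v : ℕ+ → ℂ) (f : SP) : der v (gop c f) = gop c (der v f) := by
  simp only [gop_apply, map_add, map_smul, der_tv_mul, der_oder]

/-- The bosonic modes. -/
def Jm (a : ℤ) : Module.End Hb SP := (J a : Module.End Hb SuperPoly)

/-- The fermionic modes. -/
def Gm (a : ℤ) : Module.End Hb SP := (Gam a : Module.End Hb SuperPoly)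

theorem Jm_pos (i : ℕ+) : Jm (i : ℤ) = hb 1 • der (Pi.single i 1) := by
  obtain ⟨n, rfl⟩ : ∃ n : ℕ, i = n.succPNat := ⟨i.natPred, by simp⟩
  have : ((n.succPNat : ℕ) : ℤ) = Int.ofNat (n + 1) := rfl
  rw [this, Jm, J, dx_eq_der]
  rfl

theorem Jm_zero : Jm 0 = 0 := rfl

theorem Jm_neg (i : ℕ+) : Jm (-(i : ℤ)) = cst (i : ℂ) • LinearMap.mulLeft Hb (xv i) := by
  obtain ⟨n, rfl⟩ : ∃ n : ℕ, i = n.succPNat := ⟨i.natPred, by simp⟩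
  have : -((n.succPNat : ℕ) : ℤ) = Int.negSucc n := rfl
  have h2 : ((n.succPNat : ℕ) : ℂ) = (n : ℂ) + 1 := by simp
  rw [this, Jm, J, h2]
  rfl

theorem Gm_nat (k : ℕ) : Gm (k : ℤ) = gop (Pi.single k 1) := by
  cases k with
  | zero =>
    have : ((0 : ℕ) : ℤ) = Int.ofNat 0 := rfl
    rw [this, Gm, Gam, dth_eq_oder, gop, Pi.single_eq_same, add_comm]
    rfl
  | succ n =>
    have : ((n + 1 : ℕ) : ℤ) = Int.ofNat (n + 1) := rfl
    rw [this, Gm, Gam, dth_eq_oder, gop, Pi.single_eq_of_ne (Nat.succ_ne_zero n).symm]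
    simp only [zero_div, cst_zero, zero_smul, add_zero]
    rfl

theorem Gm_neg (k : ℕ) : Gm (-((k : ℤ) + 1)) = LinearMap.mulLeft Hb (tv (k + 1)) := by
  have : -((k : ℤ) + 1) = Int.negSucc k := by omega
  rw [this, Gm, Gam]
  rfl

namespace LocalSuperSpectralCurve

variable (C : LocalSuperSpectralCurve)

/-! ### The exponent of `Φ` -/

/-- `(τ_l / l)_l`. -/
def tauV : ℕ+ → ℂ := fun l => C.τ l / l

/-- `(φ_{kl} / l)_l`. -/
def phiV (k : ℕ+) : ℕ+ → ℂ := fun l => C.φ k l / l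

/-- The exponent of `Φ` with the bosonic sum over `k ≤ M + 1` and the fermionic sum over `k < M`. -/
def phiTrunc (M : ℕ) : Module.End Hb SP :=
  der C.tauV +
    (cst (1 / 2) * hb 1) • ∑ k ∈ pnats M, cst (1 / (k : ℂ)) • (der (Pi.single k 1) * der (C.phiV k)) +
    (cst (1 / 2) * hb (-1)) • ∑ k ∈ Finset.range M, gop (Pi.single k 1) * gop (C.ψ k)

theorem finsum_tau (f : SP) {M : ℕ}
    (h0 : ∀ v : ℕ+ → ℂ, (∀ i ∈ pnats M, v i = 0) → der v f = 0)
    (h1 : ∀ v : ℕ+ → ℂ, der v f = ∑ i ∈ pnats M, cst (v i) • der (Pi.single i 1) f) :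
    (∑ᶠ l : ℕ+, cst (C.τ l / l) • Jm l f) = hb 1 • der C.tauV f := by
  rw [finsum_eq_sum_of_support_subset (s := pnats M), h1 C.tauV, Finset.smul_sum]
  · refine Finset.sum_congr rfl fun l _ => ?_
    rw [Jm_pos, LinearMap.smul_apply, smul_comm]; rfl
  · intro l hl
    by_contra hn
    apply hl
    dsimp only
    rw [Jm_pos, LinearMap.smul_apply, h0 (Pi.single l 1), smul_zero, smul_zero]
    intro i hi
    exact Pi.single_eq_of_ne (by rintro rfl; exact hn hi) _

theorem finsum_phi (f : SP) {M : ℕ}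
    (h0 : ∀ v : ℕ+ → ℂ, (∀ i ∈ pnats M, v i = 0) → der v f = 0)
    (h1 : ∀ v : ℕ+ → ℂ, der v f = ∑ i ∈ pnats M, cst (v i) • der (Pi.single i 1) f) :
    (∑ᶠ p : ℕ+ × ℕ+, cst (C.φ p.1 p.2 / (2 * p.1 * p.2)) • Jm p.1 (Jm p.2 f)) =
      (cst (1 / 2) * hb 2) •
        ∑ k ∈ pnats M, cst (1 / (k : ℂ)) • der (Pi.single k 1) (der (C.phiV k) f) := by
  have hJ (k l : ℕ+) : Jm k (Jm l f) = hb 2 • der (Pi.single k 1) (der (Pi.single l 1) f) := by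
    rw [Jm_pos, Jm_pos, show hb 2 = hb 1 * hb 1 from hb_add 1 1, mul_smul,
      ← map_smul (der (Pi.single k 1))]
    rfl
  have hz (l : ℕ+) (hl : l ∉ pnats M) : der (Pi.single l 1) f = 0 :=
    h0 _ fun i hi => Pi.single_eq_of_ne (by rintro rfl; exact hl hi) _
  simp only [hJ]
  rw [finsum_eq_sum_of_support_subset (s := pnats M ×ˢ pnats M), Finset.sum_product,
    Finset.smul_sum]
  · refine Finset.sum_congr rfl fun k _ => ?_
    rw [h1 (C.phiV k), map_sum, Finset.smul_sum, Finset.smul_sum]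
    refine Finset.sum_congr rfl fun l _ => ?_
    dsimp only
    rw [map_smul, smul_smul, smul_smul, smul_smul, phiV]
    congr 1
    rw [show C.φ k l / (2 * k * l) = (1 / 2) * ((1 / (k : ℂ)) * (C.φ k l / l)) by
      have := k.ne_zero; have := l.ne_zero; field_simp, cst_mul, cst_mul]
    ring
  · rintro ⟨k, l⟩ hl
    by_contra hn
    apply hl
    dsimp only
    rw [Finset.coe_product, Set.mem_prod, not_and_or] at hn
    rcases hn with hn | hn
    · rw [der_comm, hz k hn, map_zero, smul_zero, smul_zero]
    · rw [hz l hn, map_zero, smul_zero, smul_zero]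

theorem finsum_psi (f : SP) {M : ℕ} (hM : 0 < M)
    (h0 : ∀ v : ℕ → ℂ, (∀ i < M, v i = 0) → oder v f = 0)
    (h1 : ∀ v : ℕ → ℂ, gop v f = ∑ i ∈ Finset.range M, cst (v i) • gop (Pi.single i 1) f) :
    (∑ᶠ p : ℕ × ℕ, cst (C.ψ p.1 p.2 / 2) • Gm p.1 (Gm p.2 f)) =
      cst (1 / 2) • ∑ k ∈ Finset.range M, gop (Pi.single k 1) (gop (C.ψ k) f) := by
  have hG (k l : ℕ) : Gm k (Gm l f) = gop (Pi.single k 1) (gop (Pi.single l 1) f) := by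
    rw [Gm_nat, Gm_nat]
  have hz (l : ℕ) (hl : l ∉ Finset.range M) : gop (Pi.single l 1) f = 0 := by
    rw [Finset.mem_range, not_lt] at hl
    rw [gop_apply, h0 _ fun i hi => Pi.single_eq_of_ne (by omega) _,
      Pi.single_eq_of_ne (by omega)]
    simp
  simp only [hG]
  rw [finsum_eq_sum_of_support_subset (s := Finset.range M ×ˢ Finset.range M), Finset.sum_product,
    Finset.smul_sum]
  · refine Finset.sum_congr rfl fun k _ => ?_
    rw [h1 (C.ψ k), map_sum, Finset.smul_sum]
    refine Finset.sum_congr rfl fun l _ => ?_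
    dsimp only
    rw [map_smul, smul_smul, div_eq_inv_mul, cst_mul, one_div]
  · rintro ⟨k, l⟩ hl
    by_contra hn
    apply hl
    dsimp only
    rw [Finset.coe_product, Set.mem_prod, not_and_or] at hn
    rcases hn with hn | hn
    -- Here `k ≥ M > 0`, so `Γ_k` is not the zero mode and its anticommutator with `Γ_l` vanishes.
    · rw [gop_anticomm, hz k hn, map_zero, sub_zero, Pi.single_eq_of_ne]
      · simp
      · simp only [Finset.coe_range, Set.mem_Iio, not_lt] at hn; omega
    · rw [hz l hn, map_zero, smul_zero]

/-- On a fixed superpolynomial the three infinite sums become one truncated linear operator, so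
linearity and commutators can be computed with finite sums. -/
theorem eventually_PhiExponent (f : SP) :
    ∀ᶠ M in atTop, (C.PhiExponent f : SP) = C.phiTrunc M f := by
  filter_upwards [eventually_der_eq_zero f, eventually_der_eq_sum f, eventually_oder_eq_zero f,
    eventually_gop_eq_sum f, eventually_gt_atTop 0] with M h0 h1 g0 g1 hM
  have key : hb (-1) • ((∑ᶠ l : ℕ+, cst (C.τ l / l) • Jm l f) +
    (∑ᶠ p : ℕ+ × ℕ+, cst (C.φ p.1 p.2 / (2 * p.1 * p.2)) • Jm p.1 (Jm p.2 f)) +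
    (∑ᶠ p : ℕ × ℕ, cst (C.ψ p.1 p.2 / 2) • Gm p.1 (Gm p.2 f))) = C.phiTrunc M f := by
    rw [C.finsum_tau f h0 h1, C.finsum_phi f h0 h1, C.finsum_psi f hM g0 g1, phiTrunc]
    simp only [LinearMap.add_apply, LinearMap.smul_apply, LinearMap.sum_apply,
      Module.End.mul_apply, smul_add, smul_smul]
    rw [← hb_add, mul_left_comm, ← hb_add, mul_comm (hb (-1)) (cst _)]
    norm_num
  exact key

/-- The exponent of `Φ` as a linear map. -/
def phiX : Module.End Hb SP where
  toFun := C.PhiExponent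
  map_add' f g := by
    obtain ⟨M, h1, h2, h3⟩ := ((C.eventually_PhiExponent f).and
      ((C.eventually_PhiExponent g).and (C.eventually_PhiExponent (f + g)))).exists
    exact h3.trans (by rw [h1, h2, map_add])
  map_smul' c f := by
    obtain ⟨M, h1, h2⟩ := ((C.eventually_PhiExponent f).and
      (C.eventually_PhiExponent (c • f))).exists
    exact h2.trans (by rw [h1, map_smul]; rfl)

theorem eventually_phiX (f : SP) : ∀ᶠ M in atTop, C.phiX f = C.phiTrunc M f :=
  C.eventually_PhiExponent f

/-! ### Commutators with the exponent of `Φ` -/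

theorem phiTrunc_apply (M : ℕ) (f : SP) : C.phiTrunc M f = der C.tauV f +
    (cst (1 / 2) * hb 1) • ∑ k ∈ pnats M, cst (1 / (k : ℂ)) • der (Pi.single k 1) (der (C.phiV k) f) +
    (cst (1 / 2) * hb (-1)) • ∑ k ∈ Finset.range M, gop (Pi.single k 1) (gop (C.ψ k) f) := by
  simp [phiTrunc, LinearMap.sum_apply]

/-- In the `φ` term either derivative can hit `x^b`. By the symmetry of `φ` the two contributions
are equal and cancel the factor `1/2`. -/
theorem phiX_xv_mul (b : ℕ+) (f : SP) : C.phiX (xv b * f) =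
    xv b * C.phiX f + cst (C.τ b / b) • f + (cst (1 / (b : ℂ)) * hb 1) • der (C.phiV b) f := by
  obtain ⟨M, h1, h2, h3, hb'⟩ := ((C.eventually_phiX f).and ((C.eventually_phiX (xv b * f)).and
    ((eventually_der_eq_sum f).and (eventually_ge_atTop (b : ℕ))))).exists
  have hbM : b ∈ pnats M := mem_pnats.mpr (by omega)
  rw [h1, h2, phiTrunc_apply, phiTrunc_apply]
  have e2 : ∑ k ∈ pnats M, cst (1 / (k : ℂ)) • der (Pi.single k 1) (der (C.phiV k) (xv b * f)) =
      cst 2 • cst (1 / (b : ℂ)) • der (C.phiV b) f +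
      xv b * ∑ k ∈ pnats M, cst (1 / (k : ℂ)) • der (Pi.single k 1) (der (C.phiV k) f) := by
    have s1 : ∑ k ∈ pnats M, cst (1 / (k : ℂ)) •
        (cst (C.phiV k b) • der (Pi.single k 1) f) = cst (1 / (b : ℂ)) • der (C.phiV b) f := by
      rw [h3 (C.phiV b), Finset.smul_sum]
      refine Finset.sum_congr rfl fun k _ => ?_
      rw [smul_smul, smul_smul, ← cst_mul, ← cst_mul]
      congr 2
      simp only [phiV, C.φ_symm k b]
      ring
    have s2 : ∑ k ∈ pnats M, cst (1 / (k : ℂ)) •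
        (cst ((Pi.single k 1 : ℕ+ → ℂ) b) • der (C.phiV k) f) =
        cst (1 / (b : ℂ)) • der (C.phiV b) f := by
      rw [Finset.sum_eq_single b]
      · simp
      · intro k _ hk; rw [Pi.single_eq_of_ne hk.symm]; simp
      · exact fun h => absurd hbM h
    rw [show (2 : ℂ) = 1 + 1 by norm_num, cst_add, cst_one, add_smul, one_smul]
    nth_rewrite 1 [← s1]
    rw [← s2, Finset.mul_sum, ← Finset.sum_add_distrib, ← Finset.sum_add_distrib]
    refine Finset.sum_congr rfl fun k _ => ?_
    simp only [der_xv_mul, map_add, map_smul, smul_add, mul_smul_comm, add_assoc]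
  rw [e2, der_xv_mul]
  simp only [gop_xv_mul, mul_add, mul_smul_comm, smul_add, smul_smul, ← Finset.mul_sum, tauV]
  rw [show cst (1 / 2) * hb 1 * (cst 2 * cst (1 / (b : ℂ))) = cst (1 / (b : ℂ)) * hb 1 by
    rw [show cst (1 / 2) * hb 1 * (cst 2 * cst (1 / (b : ℂ))) =
      cst (1 / 2) * cst 2 * (cst (1 / (b : ℂ)) * hb 1) by ring, ← cst_mul]; norm_num]
  abel

theorem phiX_der (v : ℕ+ → ℂ) (f : SP) : C.phiX (der v f) = der v (C.phiX f) := by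
  obtain ⟨M, h1, h2⟩ := ((C.eventually_phiX f).and (C.eventually_phiX (der v f))).exists
  rw [h1, h2, phiTrunc_apply, phiTrunc_apply]
  simp only [map_add, map_smul, map_sum, gop_der, der_comm v]

/-- Moving `θ^b` past `Γ_k Γ_l` contracts it with either factor, with opposite signs; hence only the
antisymmetrization of `ψ` appears. -/
theorem phiX_tv_mul (b : ℕ) (f : SP) : C.phiX (tv b * f) =
    tv b * C.phiX f + gop (fun k => (C.ψ k b - C.ψ b k) / 2) f := by
  obtain ⟨M, h1, h2, h3, hbM⟩ := ((C.eventually_phiX f).and ((C.eventually_phiX (tv b * f)).and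
    ((eventually_gop_eq_sum f).and (eventually_gt_atTop b)))).exists
  rw [h1, h2, phiTrunc_apply, phiTrunc_apply]
  have e3 : ∑ k ∈ Finset.range M, gop (Pi.single k 1) (gop (C.ψ k) (tv b * f)) =
      hb 1 • gop (fun k => C.ψ k b) f - hb 1 • gop (C.ψ b) f +
      tv b * ∑ k ∈ Finset.range M, gop (Pi.single k 1) (gop (C.ψ k) f) := by
    have s2 : ∑ k ∈ Finset.range M, cst ((Pi.single k 1 : ℕ → ℂ) b) • hb 1 • gop (C.ψ k) f =
        hb 1 • gop (C.ψ b) f := by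
      rw [Finset.sum_eq_single b]
      · simp
      · intro k _ hk; rw [Pi.single_eq_of_ne hk.symm]; simp
      · exact fun h => absurd (Finset.mem_range.mpr hbM) h
    rw [← s2, h3 fun k => C.ψ k b, Finset.mul_sum, Finset.smul_sum, ← Finset.sum_sub_distrib,
      ← Finset.sum_add_distrib]
    refine Finset.sum_congr rfl fun k _ => ?_
    simp only [gop_tv_mul, map_sub, map_smul]
    rw [smul_comm (hb 1)]
    abel
  have hg : gop (fun k => (C.ψ k b - C.ψ b k) / 2) f =
      cst (1 / 2) • (gop (fun k => C.ψ k b) f - gop (C.ψ b) f) := by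
    have : (fun k => (C.ψ k b - C.ψ b k) / 2) =
        (1 / 2 : ℂ) • ((fun k => C.ψ k b) + (-1 : ℂ) • C.ψ b) := by
      funext k; simp only [Pi.smul_apply, Pi.add_apply, smul_eq_mul]; ring
    rw [this, gop_smul, gop_add, gop_smul, cst_neg, cst_one, neg_one_smul, sub_eq_add_neg]
  rw [e3, der_tv_mul, hg]
  simp only [der_tv_mul, mul_add, mul_smul_comm, smul_add, Finset.mul_sum]
  rw [← smul_sub, smul_smul, mul_assoc, ← hb_add, neg_add_cancel, hb_zero, mul_one, add_comm (cst (1 / 2) • _),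
    ← add_assoc]

/-- Only the zero mode in `c` meets a nontrivial anticommutator. Since `ψ_{0k} = -ψ_{k0}`, the
contractions in the two slots add up and cancel the factor `1/2`. -/
theorem phiX_gop (c : ℕ → ℂ) (f : SP) :
    C.phiX (gop c f) = gop c (C.phiX f) + cst (c 0) • gop (fun k => C.ψ k 0) f := by
  obtain ⟨M, h1, h2, h3, hM⟩ := ((C.eventually_phiX f).and ((C.eventually_phiX (gop c f)).and
    ((eventually_gop_eq_sum f).and (eventually_gt_atTop 0)))).exists
  rw [h1, h2, phiTrunc_apply, phiTrunc_apply]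
  have hneg : gop (C.ψ 0) f = -gop (fun k => C.ψ k 0) f := by
    have : C.ψ 0 = (-1 : ℂ) • fun k => C.ψ k 0 := by
      funext k
      have := C.ψ_rel k 0
      rw [C.ψ_zero, mul_zero, add_zero] at this
      simp only [Pi.smul_apply, smul_eq_mul]
      linear_combination this
    rw [this, gop_smul, cst_neg, cst_one, neg_one_smul]
  have e3 : ∑ k ∈ Finset.range M, gop (Pi.single k 1) (gop (C.ψ k) (gop c f)) =
      (cst (c 0) * cst 2 * hb 1) • gop (fun k => C.ψ k 0) f +
      gop c (∑ k ∈ Finset.range M, gop (Pi.single k 1) (gop (C.ψ k) f)) := by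
    have s2 : ∑ k ∈ Finset.range M, cst ((Pi.single k 1 : ℕ → ℂ) 0 * c 0) • hb 1 •
        gop (C.ψ k) f = -(cst (c 0) • hb 1 • gop (fun k => C.ψ k 0) f) := by
      rw [Finset.sum_eq_single 0, hneg]
      · simp
      · intro k _ hk; rw [Pi.single_eq_of_ne hk.symm]; simp
      · exact fun h => absurd (Finset.mem_range.mpr hM) h
    have s1 : ∑ k ∈ Finset.range M, cst (C.ψ k 0 * c 0) • hb 1 • gop (Pi.single k 1) f =
        cst (c 0) • hb 1 • gop (fun k => C.ψ k 0) f := by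
      rw [h3 fun k => C.ψ k 0, Finset.smul_sum, Finset.smul_sum]
      refine Finset.sum_congr rfl fun k _ => ?_
      rw [mul_comm, cst_mul, mul_smul, smul_comm (hb 1)]
    have e : (cst (c 0) * cst 2 * hb 1) • gop (fun k => C.ψ k 0) f =
        cst (c 0) • hb 1 • gop (fun k => C.ψ k 0) f -
          -(cst (c 0) • hb 1 • gop (fun k => C.ψ k 0) f) := by
      rw [show cst 2 = 2 from map_ofNat cstHom 2]
      module
    rw [e, ← s2, ← s1, map_sum, ← Finset.sum_sub_distrib, ← Finset.sum_add_distrib]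
    refine Finset.sum_congr rfl fun k _ => ?_
    rw [gop_anticomm (C.ψ k) c, map_sub, map_smul, map_smul, gop_anticomm (Pi.single k 1) c]
    abel
  rw [e3]
  simp only [gop_der, map_add, map_smul, map_sum, smul_add, smul_smul]
  rw [show cst (1 / 2) * hb (-1) * (cst (c 0) * cst 2 * hb 1) =
    cst (1 / 2) * cst 2 * cst (c 0) * (hb (-1) * hb 1) by ring, ← hb_add, ← cst_mul]
  rw [neg_add_cancel, hb_zero, mul_one, one_div_mul_cancel two_ne_zero, cst_one, one_mul]
  abel

end LocalSuperSpectralCurve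

/-! ### Local nilpotency -/

/-- `f` is killed by `m + 1` lowering operations `∂/∂x^i`, `∂/∂θ^j` with `i, j ≥ 1`. -/
def IsNil : ℕ → SP → Prop
  | 0, f => (∀ v, der v f = 0) ∧ ∀ w : ℕ → ℂ, w 0 = 0 → oder w f = 0
  | m + 1, f => (∀ v, IsNil m (der v f)) ∧ ∀ w : ℕ → ℂ, w 0 = 0 → IsNil m (oder w f)

theorem IsNil.zero (m : ℕ) : IsNil m 0 := by
  induction m with
  | zero => exact ⟨fun v => map_zero _, fun w _ => map_zero _⟩
  | succ m ih => exact ⟨fun v => by rwa [map_zero], fun w _ => by rwa [map_zero]⟩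

theorem IsNil.add {m : ℕ} {f g : SP} (hf : IsNil m f) (hg : IsNil m g) : IsNil m (f + g) := by
  induction m generalizing f g with
  | zero =>
    exact ⟨fun v => by rw [map_add, hf.1, hg.1, add_zero],
      fun w hw => by rw [map_add, hf.2 w hw, hg.2 w hw, add_zero]⟩
  | succ m ih =>
    exact ⟨fun v => by rw [map_add]; exact ih (hf.1 v) (hg.1 v),
      fun w hw => by rw [map_add]; exact ih (hf.2 w hw) (hg.2 w hw)⟩

theorem IsNil.smul {m : ℕ} {f : SP} (hf : IsNil m f) (h : Hb) : IsNil m (h • f) := by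
  induction m generalizing f with
  | zero =>
    exact ⟨fun v => by rw [map_smul, hf.1, smul_zero],
      fun w hw => by rw [map_smul, hf.2 w hw, smul_zero]⟩
  | succ m ih =>
    exact ⟨fun v => by rw [map_smul]; exact ih (hf.1 v),
      fun w hw => by rw [map_smul]; exact ih (hf.2 w hw)⟩

theorem IsNil.neg {m : ℕ} {f : SP} (hf : IsNil m f) : IsNil m (-f) := by
  simpa using hf.smul (-1)

theorem IsNil.sum {m : ℕ} {ι : Type*} (s : Finset ι) {f : ι → SP} (hf : ∀ i ∈ s, IsNil m (f i)) :
    IsNil m (∑ i ∈ s, f i) :=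
  Finset.sum_induction f (IsNil m) (fun _ _ => IsNil.add) (IsNil.zero m) hf

theorem IsNil.succ {m : ℕ} {f : SP} (hf : IsNil m f) : IsNil (m + 1) f := by
  induction m generalizing f with
  | zero =>
    exact ⟨fun v => by rw [hf.1]; exact IsNil.zero 0,
      fun w hw => by rw [hf.2 w hw]; exact IsNil.zero 0⟩
  | succ m ih => exact ⟨fun v => ih (hf.1 v), fun w hw => ih (hf.2 w hw)⟩

theorem IsNil.mono {m n : ℕ} (h : m ≤ n) {f : SP} (hf : IsNil m f) : IsNil n f := by
  induction n, h using Nat.le_induction with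
  | base => exact hf
  | succ n _ ih => exact ih.succ

theorem IsNil.der {m : ℕ} {f : SP} (hf : IsNil m f) (v : ℕ+ → ℂ) : IsNil m (der v f) := by
  cases m with
  | zero => rw [hf.1]; exact IsNil.zero 0
  | succ m => exact (hf.1 v).succ

theorem IsNil.oder {m : ℕ} {f : SP} (hf : IsNil m f) (w : ℕ → ℂ) : IsNil m (oder w f) := by
  induction m generalizing f with
  | zero =>
    exact ⟨fun v => by rw [der_oder, hf.1, map_zero],
      fun u hu => by rw [oder_anticomm, hf.2 u hu, map_zero, neg_zero]⟩
  | succ m ih =>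
    exact ⟨fun v => by rw [der_oder]; exact ih (hf.1 v),
      fun u hu => by rw [oder_anticomm]; exact (ih (hf.2 u hu)).neg⟩

/-- The counted lowering operations do not touch `θ^0`, so this multiplication leaves the count
unchanged. Consequently `Γ_0` does not raise it either. -/
theorem IsNil.tv_zero_mul {m : ℕ} {f : SP} (hf : IsNil m f) : IsNil m (tv 0 * f) := by
  induction m generalizing f with
  | zero =>
    exact ⟨fun v => by rw [der_tv_mul, hf.1, mul_zero],
      fun u hu => by rw [oder_tv_mul, hf.2 u hu, hu, cst_zero, zero_smul, mul_zero, sub_zero]⟩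
  | succ m ih =>
    refine ⟨fun v => by rw [der_tv_mul]; exact ih (hf.1 v), fun u hu => ?_⟩
    rw [oder_tv_mul, hu, cst_zero, zero_smul, zero_sub]
    exact (ih (hf.2 u hu)).neg

theorem IsNil.gop {m : ℕ} {f : SP} (hf : IsNil m f) (c : ℕ → ℂ) : IsNil m (gop c f) := by
  rw [gop_apply]
  exact ((hf.oder c).smul _).add (hf.tv_zero_mul.smul _)

theorem IsNil.xv_mul {m : ℕ} {f : SP} (hf : IsNil m f) (i : ℕ+) : IsNil (m + 1) (xv i * f) := by
  induction m generalizing f with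
  | zero =>
    refine ⟨fun v => ?_, fun u hu => ?_⟩
    · rw [der_xv_mul, hf.1, mul_zero, add_zero]; exact hf.smul _
    · rw [oder_xv_mul, hf.2 u hu, mul_zero]; exact IsNil.zero 0
  | succ m ih =>
    refine ⟨fun v => ?_, fun u hu => ?_⟩
    · rw [der_xv_mul]; exact (hf.smul _).add (ih (hf.1 v))
    · rw [oder_xv_mul]; exact ih (hf.2 u hu)

theorem IsNil.tv_mul {m : ℕ} {f : SP} (hf : IsNil m f) (j : ℕ) : IsNil (m + 1) (tv j * f) := by
  induction m generalizing f with
  | zero =>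
    refine ⟨fun v => ?_, fun u hu => ?_⟩
    · rw [der_tv_mul, hf.1, mul_zero]; exact IsNil.zero 0
    · rw [oder_tv_mul, hf.2 u hu, mul_zero, sub_zero]; exact hf.smul _
  | succ m ih =>
    refine ⟨fun v => ?_, fun u hu => ?_⟩
    · rw [der_tv_mul]; exact ih (hf.1 v)
    · rw [oder_tv_mul, sub_eq_add_neg]; exact (hf.smul _).add (ih (hf.2 u hu)).neg

theorem exists_isNil (f : SP) : ∃ m, IsNil m f := by
  induction f using sp_induction with
  | one => exact ⟨0, fun v => der_one v, fun w _ => oder_one w⟩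
  | add a b ha hb =>
    obtain ⟨m, hm⟩ := ha
    obtain ⟨n, hn⟩ := hb
    exact ⟨max m n, (hm.mono (le_max_left _ _)).add (hn.mono (le_max_right _ _))⟩
  | smul h a ha => obtain ⟨m, hm⟩ := ha; exact ⟨m, hm.smul h⟩
  | xmul i a ha => obtain ⟨m, hm⟩ := ha; exact ⟨_, hm.xv_mul i⟩
  | thmul i a ha => obtain ⟨m, hm⟩ := ha; exact ⟨_, hm.tv_mul i⟩

theorem gop_of_zero {c : ℕ → ℂ} (hc : c 0 = 0) (f : SP) : gop c f = hb 1 • oder c f := by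
  rw [gop_apply, hc]; simp

namespace LocalSuperSpectralCurve

variable (C : LocalSuperSpectralCurve)

/-- Every term of the exponent contains a genuine lowering operation. For `k ≥ 1` it is `Γ_k`; for
`k = 0` it is the inner factor, which has no zero mode because `ψ_{00} = 0`. -/
theorem phiX_isNil_zero {f : SP} (hf : IsNil 0 f) : C.phiX f = 0 := by
  obtain ⟨M, hM⟩ := (C.eventually_phiX f).exists
  rw [hM, phiTrunc_apply, hf.1, Finset.sum_eq_zero, Finset.sum_eq_zero]
  · simp
  · rintro (_ | k) _
    · rw [gop_of_zero C.ψ_zero, hf.2 _ C.ψ_zero, smul_zero, map_zero]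
    · rw [gop_of_zero (by simp), (hf.gop (C.ψ (k + 1))).2 _ (by simp), smul_zero]
  · intro k _
    rw [hf.1, map_zero, smul_zero]

/-- The same choice of a lowering factor as in degree zero; the remaining factors preserve the
count. -/
theorem phiX_isNil_succ {m : ℕ} {f : SP} (hf : IsNil (m + 1) f) : IsNil m (C.phiX f) := by
  obtain ⟨M, hM⟩ := (C.eventually_phiX f).exists
  rw [hM, phiTrunc_apply]
  refine ((hf.1 _).add ((IsNil.sum _ fun k _ => ?_).smul _)).add ((IsNil.sum _ fun k _ => ?_).smul _)
  · exact ((hf.1 _).der _).smul _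
  · rcases k with _ | k
    · rw [gop_of_zero C.ψ_zero]
      exact ((hf.2 _ C.ψ_zero).smul _).gop _
    · rw [gop_of_zero (c := Pi.single (k + 1) 1) (by simp)]
      exact ((hf.gop (C.ψ (k + 1))).2 _ (by simp)).smul _

theorem phiX_pow_eq_zero {m : ℕ} {f : SP} (hf : IsNil m f) {r : ℕ} (hr : m < r) :
    (C.phiX ^ r) f = 0 := by
  induction m generalizing f r with
  | zero =>
    obtain ⟨r, rfl⟩ : ∃ s, r = s + 1 := ⟨r - 1, by omega⟩
    rw [pow_succ, Module.End.mul_apply, C.phiX_isNil_zero hf, map_zero]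
  | succ m ih =>
    obtain ⟨r, rfl⟩ : ∃ s, r = s + 1 := ⟨r - 1, by omega⟩
    rw [pow_succ, Module.End.mul_apply]
    exact ih (C.phiX_isNil_succ hf) (by omega)

theorem eventually_phiX_pow (f : SP) : ∀ᶠ r : ℕ in atTop, (C.phiX ^ r) f = 0 := by
  obtain ⟨m, hm⟩ := exists_isNil f
  filter_upwards [eventually_gt_atTop m] with r hr
  exact C.phiX_pow_eq_zero hm hr

theorem isLocExp_expPhi (c : ℂ) : IsLocExp C.phiX c (C.expPhi c : SP → SP) := by
  intro f
  obtain ⟨m, hm⟩ := exists_isNil f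
  filter_upwards [eventually_gt_atTop m] with M hM
  have h : (∑ᶠ r : ℕ, expTerm C.phiX c r f) = ∑ r ∈ Finset.range M, expTerm C.phiX c r f := by
    apply finsum_eq_sum_of_support_subset
    intro r hr
    by_contra hn
    apply hr
    simp only [Finset.coe_range, Set.mem_Iio, not_lt] at hn
    change expTerm C.phiX c r f = 0
    rw [expTerm, LinearMap.smul_apply, C.phiX_pow_eq_zero hm (by omega), smul_zero]
  rw [← h]
  have h2 (r : ℕ) : expTerm C.phiX c r f =
      cst (c ^ r / (r.factorial : ℂ)) • ((C.phiX)^[r] f) := by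
    rw [expTerm, LinearMap.smul_apply, Module.End.pow_apply]
  simp only [h2]
  rfl

/-- `exp (c · X)` for the exponent `X` of `Φ`, as a linear map. -/
def phiE (c : ℂ) : Module.End Hb SP where
  toFun := C.expPhi c
  map_add' f g := by
    obtain ⟨M, h1, h2, h3⟩ := ((C.isLocExp_expPhi c f).and
      ((C.isLocExp_expPhi c g).and (C.isLocExp_expPhi c (f + g)))).exists
    exact h3.trans (by rw [h1, h2, ← Finset.sum_add_distrib]; simp only [map_add])
  map_smul' a f := by
    obtain ⟨M, h1, h2⟩ := ((C.isLocExp_expPhi c f).and (C.isLocExp_expPhi c (a • f))).exists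
    exact h2.trans (by rw [h1, RingHom.id_apply, Finset.smul_sum]; simp only [map_smul])

theorem phiE_phiE_neg (f : SP) : C.phiE 1 (C.phiE (-1) f) = f :=
  (C.isLocExp_expPhi 1).mul_neg (C.isLocExp_expPhi (-1)) C.eventually_phiX_pow f

/-! ### Conjugated modes -/

/-- The coefficient of `z^p` in `dξ_{-i}`. -/
def cB (p : ℤ) (i : ℕ+) : ℂ := (C.dxiNeg i).coeff p

/-- The coefficient of `z^p` in `η_{-j}`. -/
def cF (p : ℤ) (j : ℕ) : ℂ := (C.etaNeg j).coeff p

end LocalSuperSpectralCurve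

/-! ### Laurent coefficients of the bases. -/

theorem coeff_ofCoeffs_nat (c : ℕ → ℂ) (n : ℕ) : (ofCoeffs c).coeff (n : ℤ) = c n := by
  rw [ofCoeffs, LaurentSeries.coeff_coe_powerSeries, PowerSeries.coeff_mk]

theorem coeff_ofCoeffs_neg (c : ℕ → ℂ) {p : ℤ} (hp : p < 0) : (ofCoeffs c).coeff p = 0 := by
  rw [ofCoeffs, PowerSeries.coeff_coe, if_pos hp]

theorem coeff_single_neg_one_mul (f : LS) (p : ℤ) :
    (HahnSeries.single (-1 : ℤ) (1 : ℂ) * f).coeff p = f.coeff (p + 1) := by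
  have := HahnSeries.coeff_single_mul_add (r := (1 : ℂ)) (x := f) (a := p + 1) (b := (-1 : ℤ))
  rw [one_mul] at this
  rw [← this]
  congr 1
  ring

namespace LocalSuperSpectralCurve

variable (C : LocalSuperSpectralCurve)

theorem cB_nat (n : ℕ) (i : ℕ+) : C.cB n i = C.φ i n.succPNat / i := by
  have := i.pos
  rw [cB, dxiNeg, HahnSeries.coeff_add, coeff_ofCoeffs_nat,
    HahnSeries.coeff_single_of_ne (by omega), zero_add]

theorem cB_neg (n : ℕ) (i : ℕ+) : C.cB (-(n : ℤ) - 1) i = if (i : ℕ) = n then 1 else 0 := by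
  rw [cB, dxiNeg, HahnSeries.coeff_add, coeff_ofCoeffs_neg _ (by omega), add_zero,
    HahnSeries.coeff_single]
  congr 1
  simp only [eq_iff_iff]
  omega

theorem cF_nat (n j : ℕ) : C.cF n j = C.ψ j (n + 1) := by
  rw [cF, etaNeg, HahnSeries.coeff_add, coeff_single_neg_one_mul,
    HahnSeries.coeff_single_of_ne (by omega), zero_add]
  exact_mod_cast coeff_ofCoeffs_nat (fun k => C.ψ j k) (n + 1)

/-- The exponent `-1` mixes the zero mode with the others: besides `η_0`, every `η_{-j}` may
contribute through `ψ_{j0}`. -/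
theorem cF_neg_one (j : ℕ) : C.cF (-1) j = (if j = 0 then 1 else 0) + C.ψ j 0 := by
  rw [cF, etaNeg, HahnSeries.coeff_add, coeff_single_neg_one_mul, HahnSeries.coeff_single]
  congr 1
  · congr 1
    simp only [eq_iff_iff]
    omega
  · exact_mod_cast coeff_ofCoeffs_nat (fun k => C.ψ j k) 0

theorem cF_neg (n j : ℕ) : C.cF (-((n : ℤ) + 1) - 1) j = if j = n + 1 then 1 else 0 := by
  rw [cF, etaNeg, HahnSeries.coeff_add, coeff_single_neg_one_mul,
    coeff_ofCoeffs_neg _ (by omega), add_zero, HahnSeries.coeff_single]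
  congr 1
  simp only [eq_iff_iff]
  omega

/-- The coefficient of `z^p` in `ω_{0,1|0}(z) + ∑_l l x^l z^{l-1}`. -/
def mB : ℤ → SP
  | Int.ofNat n => algebraMap Hb SP (cst (C.τ n.succPNat)) + cst ((n : ℂ) + 1) • xv n.succPNat
  | Int.negSucc _ => 0

/-- The coefficient of `z^p` in `∑_{l ≥ 1} θ^l z^{l-1} + (θ^0 / 2) η_0(z)`. -/
def mF : ℤ → SP
  | Int.ofNat n => tv (n + 1) + cst (C.ψ 0 (n + 1) / 2) • tv 0
  | Int.negSucc 0 => cst (1 / 2) • tv 0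
  | Int.negSucc (_ + 1) => 0

/-- `Φ J_{-p-1} Φ⁻¹`. -/
def Jc (p : ℤ) : Module.End Hb SP := LinearMap.mulLeft Hb (C.mB p) + hb 1 • der (C.cB p)

/-- `Φ Γ_{-p-1} Φ⁻¹`. -/
def Gc (p : ℤ) : Module.End Hb SP := LinearMap.mulLeft Hb (C.mF p) + hb 1 • oder (C.cF p)

theorem Jc_apply (p : ℤ) (f : SP) : C.Jc p f = C.mB p * f + hb 1 • der (C.cB p) f := rfl

theorem Gc_apply (p : ℤ) (f : SP) : C.Gc p f = C.mF p * f + hb 1 • oder (C.cF p) f := rfl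

theorem phiE_comm {A B D : Module.End Hb SP} (hA : C.phiX * A = A * C.phiX + B)
    (hB : C.phiX * B = B * C.phiX + D) (hD : C.phiX * D = D * C.phiX) (f : SP) :
    C.phiE 1 (A f) = A (C.phiE 1 f) + B (C.phiE 1 f) + cst (1 / 2) • D (C.phiE 1 f) :=
  (C.isLocExp_expPhi 1).comm hA hB hD f

/-- The commutator of the exponent with `x^b` is a constant plus a derivative, which commutes with
the exponent, so one commutator suffices. Positive modes already commute with the exponent. -/
theorem phiE_Jm (p : ℤ) (f : SP) : C.phiE 1 (Jm (-p - 1) f) = C.Jc p (C.phiE 1 f) := by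
  cases p with
  | ofNat n =>
    set b := n.succPNat with hb'
    have hbne : (b : ℂ) ≠ 0 := by simp
    have h1 : -(Int.ofNat n) - 1 = -(b : ℤ) := by simp [hb']; ring
    have h2 := C.phiE_comm (A := Jm (-(b : ℤ))) (B := cst (C.τ b) • 1 + hb 1 • der (C.phiV b))
      (D := 0) ?_ ?_ ?_ f
    · have hv : C.cB (Int.ofNat n) = C.phiV b := by
        funext i
        exact (C.cB_nat n i).trans (by rw [phiV, C.φ_symm])
      rw [h1, h2, Jc_apply, hv, mB, Jm_neg, LinearMap.zero_apply, smul_zero, add_zero,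
        LinearMap.smul_apply, LinearMap.add_apply, LinearMap.smul_apply, LinearMap.smul_apply,
        LinearMap.mulLeft_apply, Module.End.one_apply, add_mul, smul_mul_assoc, ← Algebra.smul_def]
      rw [show ((b : ℕ) : ℂ) = (n : ℂ) + 1 by simp [hb']]
      abel
    · refine LinearMap.ext fun f => ?_
      simp only [Jm_neg, Module.End.mul_apply, LinearMap.add_apply, LinearMap.smul_apply,
        LinearMap.mulLeft_apply, map_smul, phiX_xv_mul, smul_add, smul_smul, Module.End.one_apply]
      rw [← cst_mul, ← mul_assoc, ← cst_mul, mul_div_cancel₀ _ hbne, mul_one_div_cancel hbne,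
        cst_one, one_mul, add_assoc]
    · refine LinearMap.ext fun f => ?_
      simp only [Module.End.mul_apply, LinearMap.add_apply, LinearMap.smul_apply, map_smul, map_add,
        phiX_der, Module.End.one_apply, add_zero]
    · simp
  | negSucc n =>
    have h1 : -(Int.negSucc n) - 1 = (n : ℤ) := by omega
    have h1' : Int.negSucc n = -(n : ℤ) - 1 := by omega
    rw [h1, Jc_apply, mB, zero_mul, zero_add, h1']
    -- The case `J_0 = 0` matches the absence of a `z^{-1}` term in the `dξ_{-i}`.
    rcases Nat.eq_zero_or_pos n with rfl | hn
    · have : C.cB (-((0 : ℕ) : ℤ) - 1) = 0 := by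
        funext i; rw [C.cB_neg, if_neg i.ne_zero]; rfl
      rw [this, der_zero, smul_zero, Nat.cast_zero, Jm_zero, LinearMap.zero_apply, map_zero]
    · lift n to ℕ+ using hn
      have : C.cB (-((n : ℕ) : ℤ) - 1) = Pi.single n 1 := by
        funext i; rw [C.cB_neg, Pi.single_apply]; congr 1; simp
      have h2 := C.phiE_comm (A := Jm (n : ℤ)) (B := 0) (D := 0) ?_ ?_ ?_ f
      · rw [this, h2, Jm_pos]; simp
      · refine LinearMap.ext fun f => ?_
        simp only [Jm_pos, Module.End.mul_apply, LinearMap.smul_apply, map_smul, phiX_der,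
          add_zero]
      · simp
      · simp

theorem phiX_mul_gop {c : ℕ → ℂ} : C.phiX * gop c = gop c * C.phiX +
    cst (c 0) • gop (fun k => C.ψ k 0) :=
  LinearMap.ext fun f => C.phiX_gop c f

theorem psi_zero_right (k : ℕ) : C.ψ k 0 = -C.ψ 0 k := by
  have := C.ψ_rel k 0
  rw [C.ψ_zero, mul_zero, add_zero] at this
  linear_combination this

/-- For a raising mode the first commutator may contain `Γ_0`, so a second commutator survives; it
has no zero mode, since `ψ_{00} = 0`, and the series stops there. For `Γ_0` one commutator is
enough, and the positive modes are unchanged. -/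
theorem phiE_Gm (p : ℤ) (f : SP) : C.phiE 1 (Gm (-p - 1) f) = C.Gc p (C.phiE 1 f) := by
  have hz : C.phiX * gop (fun k => C.ψ k 0) = gop (fun k => C.ψ k 0) * C.phiX := by
    rw [phiX_mul_gop, C.ψ_zero]; simp
  match p with
  | Int.ofNat n =>
    have h1 : -(Int.ofNat n) - 1 = -((n : ℤ) + 1) := by simp; ring
    have hc : (C.ψ 0 (n + 1) - C.ψ (n + 1) 0) / 2 = C.ψ 0 (n + 1) := by
      rw [C.psi_zero_right]; ring
    have h2 := C.phiE_comm (A := Gm (-((n : ℤ) + 1)))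
      (B := gop fun k => (C.ψ k (n + 1) - C.ψ (n + 1) k) / 2)
      (D := cst (C.ψ 0 (n + 1)) • gop fun k => C.ψ k 0) ?_ ?_ ?_ f
    · rw [h1, h2, Gc_apply, Gm_neg, LinearMap.mulLeft_apply, mF, add_mul, smul_mul_assoc,
        LinearMap.smul_apply, smul_smul, ← cst_mul, ← gop_smul, add_assoc, ← gop_add]
      -- The quadratic relation on `ψ` combines the antisymmetric part from the first commutator
      -- with half the product from the second into `ψ_{k,n+1}` itself.
      have hv : C.cF (Int.ofNat n) = (fun k => (C.ψ k (n + 1) - C.ψ (n + 1) k) / 2) +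
          (1 / 2 * C.ψ 0 (n + 1)) • fun k => C.ψ k 0 := by
        funext k
        refine (C.cF_nat n k).trans ?_
        simp only [Pi.add_apply, Pi.smul_apply, smul_eq_mul, C.psi_zero_right k]
        linear_combination (1 / 2) * C.ψ_rel k (n + 1)
      rw [← hv, gop_apply, show C.cF (Int.ofNat n) 0 = C.ψ 0 (n + 1) from C.cF_nat n 0]
      abel
    · refine LinearMap.ext fun f => ?_
      simp only [Gm_neg, Module.End.mul_apply, LinearMap.add_apply, LinearMap.mulLeft_apply,
        phiX_tv_mul]
    · rw [phiX_mul_gop, hc]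
    · rw [mul_smul_comm, hz, smul_mul_assoc]
  | Int.negSucc 0 =>
    have h1 : -(Int.negSucc 0) - 1 = ((0 : ℕ) : ℤ) := by omega
    have h2 := C.phiE_comm (A := Gm ((0 : ℕ) : ℤ)) (B := gop fun k => C.ψ k 0) (D := 0) ?_ ?_ ?_ f
    · rw [h1, h2, Gc_apply, Gm_nat, mF, LinearMap.zero_apply, smul_zero, add_zero, ← gop_add]
      have hv : C.cF (Int.negSucc 0) = Pi.single 0 1 + fun k => C.ψ k 0 := by
        funext k
        refine (C.cF_neg_one k).trans ?_
        rw [Pi.add_apply, Pi.single_apply]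
      rw [← hv, gop_apply, show C.cF (Int.negSucc 0) 0 = 1 from
        (C.cF_neg_one 0).trans (by simp [C.ψ_zero]), add_comm, smul_mul_assoc]
    · rw [Gm_nat, phiX_mul_gop]; simp
    · rw [hz, add_zero]
    · simp
  | Int.negSucc (n + 1) =>
    have h1 : -(Int.negSucc (n + 1)) - 1 = ((n + 1 : ℕ) : ℤ) := by omega
    have h2 := C.phiE_comm (A := Gm ((n + 1 : ℕ) : ℤ)) (B := 0) (D := 0) ?_ ?_ ?_ f
    · rw [h1, h2, Gc_apply, Gm_nat, mF]
      have hv : C.cF (Int.negSucc (n + 1)) = Pi.single (n + 1) 1 := by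
        funext k
        rw [show Int.negSucc (n + 1) = -((n : ℤ) + 1) - 1 by omega, cF_neg, Pi.single_apply]
      rw [hv, gop_of_zero (by simp)]
      simp
    · rw [Gm_nat, phiX_mul_gop]; simp
    · simp
    · simp

end LocalSuperSpectralCurve

/-! ### Conjugated Virasoro operators -/

/-- An operator on superpolynomials. -/
def opSP (T : SuperPoly → SuperPoly) : SP → SP := T

/-- `{-M, …, M}`. -/
def zrange (M : ℕ) : Finset ℤ := Finset.Icc (-(M : ℤ)) M

theorem mem_zrange {M : ℕ} {j : ℤ} : j ∈ zrange M ↔ -(M : ℤ) ≤ j ∧ j ≤ M := Finset.mem_Icc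

theorem eventually_Jm_eq_zero (f : SP) : ∀ᶠ M : ℕ in atTop, ∀ a : ℤ, (M : ℤ) < a → Jm a f = 0 := by
  obtain ⟨M0, h⟩ := (eventually_der_eq_zero f).exists
  filter_upwards [eventually_gt_atTop M0] with M hM a ha
  lift a to ℕ using by omega
  rcases Nat.eq_zero_or_pos a with rfl | hn
  · rfl
  lift a to ℕ+ using hn
  rw [Jm_pos, LinearMap.smul_apply, h, smul_zero]
  intro i hi
  have h2 := mem_pnats.mp hi
  refine Pi.single_eq_of_ne (fun h => ?_) _
  rw [h] at h2
  omega

theorem eventually_Gm_eq_zero (f : SP) : ∀ᶠ M : ℕ in atTop, ∀ a : ℤ, (M : ℤ) < a → Gm a f = 0 := by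
  filter_upwards [eventually_oder_eq_zero f] with M h a ha
  lift a to ℕ using by omega
  rw [Gm_nat, gop_of_zero (Pi.single_eq_of_ne (by omega) _), h, smul_zero]
  intro i hi
  exact Pi.single_eq_of_ne (by omega) _

theorem Jm_Gm_comm {a : ℤ} (ha : 0 < a) (b : ℤ) (f : SP) : Jm a (Gm b f) = Gm b (Jm a f) := by
  lift a to ℕ+ using ha
  rw [Jm_pos]
  rcases lt_or_ge b 0 with hb | hb
  · obtain ⟨k, rfl⟩ : ∃ k : ℕ, b = -((k : ℤ) + 1) := ⟨(-b - 1).toNat, by omega⟩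
    simp only [Gm_neg, LinearMap.smul_apply, LinearMap.mulLeft_apply, der_tv_mul, mul_smul_comm]
  · lift b to ℕ using hb
    simp only [Gm_nat, LinearMap.smul_apply, gop_der, map_smul]

/-- `:J_a J_b:` -/
def nJJ (a b : ℤ) : Module.End Hb SP := if a ≤ b then Jm a * Jm b else Jm b * Jm a

/-- `:Γ_a Γ_b:` -/
def nGG (a b : ℤ) : Module.End Hb SP := if a ≤ b then Gm a * Gm b else -(Gm b * Gm a)

theorem eventually_L (n : ℤ) (f : SP) : ∀ᶠ M : ℕ in atTop, opSP (L n) f =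
    cst (1 / 2) • (∑ j ∈ zrange M, cst ((-1) ^ (j - 1)) • nJJ (-j) (2 * n + j) f) +
    (if n = 0 then cst (1 / 4) * hb 1 else 0) • f +
    cst (1 / 2) • (∑ j ∈ zrange M, cst ((-1) ^ j * (n + j)) • nGG (-j) (j + 2 * n) f) := by
  obtain ⟨M0, hJ, hG⟩ := ((eventually_Jm_eq_zero f).and (eventually_Gm_eq_zero f)).exists
  -- The two mode indices add up to `2n`. For `|j| > M` the larger one exceeds `M0`; normal ordering
  -- puts it on the right, where it annihilates `f`.
  filter_upwards [eventually_ge_atTop (M0 + (2 * n).natAbs)] with M hM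
  have h1 : (∑ᶠ j : ℤ, cst ((-1) ^ (j - 1)) • nJJ (-j) (2 * n + j) f) =
      ∑ j ∈ zrange M, cst ((-1) ^ (j - 1)) • nJJ (-j) (2 * n + j) f := by
    apply finsum_eq_sum_of_support_subset
    intro j hj
    by_contra hn
    apply hj
    have hn' : ¬(-(M : ℤ) ≤ j ∧ j ≤ M) := fun h => hn (mem_zrange.mpr h)
    change cst _ • nJJ (-j) (2 * n + j) f = 0
    rw [nJJ]
    split_ifs with h
    · rw [Module.End.mul_apply, hJ (2 * n + j) (by omega), map_zero, smul_zero]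
    · rw [Module.End.mul_apply, hJ (-j) (by omega), map_zero, smul_zero]
  have h2 : (∑ᶠ j : ℤ, cst ((-1) ^ j * (n + j)) • nGG (-j) (j + 2 * n) f) =
      ∑ j ∈ zrange M, cst ((-1) ^ j * (n + j)) • nGG (-j) (j + 2 * n) f := by
    apply finsum_eq_sum_of_support_subset
    intro j hj
    by_contra hn
    apply hj
    have hn' : ¬(-(M : ℤ) ≤ j ∧ j ≤ M) := fun h => hn (mem_zrange.mpr h)
    change cst _ • nGG (-j) (j + 2 * n) f = 0
    rw [nGG]
    split_ifs with h
    · rw [Module.End.mul_apply, hG (j + 2 * n) (by omega), map_zero, smul_zero]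
    · rw [LinearMap.neg_apply, Module.End.mul_apply, hG (-j) (by omega), map_zero, neg_zero,
        smul_zero]
  rw [← h1, ← h2]
  rfl

theorem eventually_G (m : ℤ) (f : SP) : ∀ᶠ M : ℕ in atTop, opSP (G m) f =
    ∑ j ∈ zrange M, cst ((-1) ^ (j - 1)) • Jm (-j) (Gm (j + 2 * m + 1) f) := by
  obtain ⟨M0, hJ, hG⟩ := ((eventually_Jm_eq_zero f).and (eventually_Gm_eq_zero f)).exists
  filter_upwards [eventually_ge_atTop (M0 + (2 * m + 1).natAbs)] with M hM
  have h1 : (∑ᶠ j : ℤ, cst ((-1) ^ (j - 1)) • Jm (-j) (Gm (j + 2 * m + 1) f)) =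
      ∑ j ∈ zrange M, cst ((-1) ^ (j - 1)) • Jm (-j) (Gm (j + 2 * m + 1) f) := by
    apply finsum_eq_sum_of_support_subset
    intro j hj
    by_contra hn
    apply hj
    have hn' : ¬(-(M : ℤ) ≤ j ∧ j ≤ M) := fun h => hn (mem_zrange.mpr h)
    change cst _ • Jm (-j) (Gm (j + 2 * m + 1) f) = 0
    -- There is no normal ordering here: if `j` is very negative, the large index sits on the left
    -- mode, which first has to be commuted to the right.
    by_cases h : j ≤ M
    · rw [Jm_Gm_comm (by omega), hJ (-j) (by omega), map_zero, smul_zero]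
    · rw [hG (j + 2 * m + 1) (by omega), map_zero, smul_zero]
  rw [← h1]
  rfl

namespace LocalSuperSpectralCurve

variable (C : LocalSuperSpectralCurve)

/-- The conjugate of `:J_a J_b:`. -/
def nJc (a b : ℤ) : Module.End Hb SP :=
  if a ≤ b then C.Jc (-a - 1) * C.Jc (-b - 1) else C.Jc (-b - 1) * C.Jc (-a - 1)

/-- The conjugate of `:Γ_a Γ_b:`. -/
def nGc (a b : ℤ) : Module.End Hb SP :=
  if a ≤ b then C.Gc (-a - 1) * C.Gc (-b - 1) else -(C.Gc (-b - 1) * C.Gc (-a - 1))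

theorem phiE_Jm' (a : ℤ) (f : SP) : C.phiE 1 (Jm a f) = C.Jc (-a - 1) (C.phiE 1 f) := by
  rw [← phiE_Jm]; congr 3; ring

theorem phiE_Gm' (a : ℤ) (f : SP) : C.phiE 1 (Gm a f) = C.Gc (-a - 1) (C.phiE 1 f) := by
  rw [← phiE_Gm]; congr 3; ring

theorem phiE_nJJ (a b : ℤ) (f : SP) : C.phiE 1 (nJJ a b f) = C.nJc a b (C.phiE 1 f) := by
  rw [nJJ, nJc]
  split_ifs <;> simp only [Module.End.mul_apply, phiE_Jm']

theorem phiE_nGG (a b : ℤ) (f : SP) : C.phiE 1 (nGG a b f) = C.nGc a b (C.phiE 1 f) := by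
  rw [nGG, nGc]
  split_ifs <;> simp only [Module.End.mul_apply, LinearMap.neg_apply, map_neg, phiE_Gm']

theorem eventually_conj_L (n : ℤ) (f : SP) : ∀ᶠ M : ℕ in atTop, opSP (C.conj (L n)) f =
    cst (1 / 2) • (∑ j ∈ zrange M, cst ((-1) ^ (j - 1)) • C.nJc (-j) (2 * n + j) f) +
    (if n = 0 then cst (1 / 4) * hb 1 else 0) • f +
    cst (1 / 2) • (∑ j ∈ zrange M, cst ((-1) ^ j * (n + j)) • C.nGc (-j) (j + 2 * n) f) := by
  filter_upwards [eventually_L n (C.phiE (-1) f)] with M hM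
  have h := congrArg (C.phiE 1) hM
  refine Eq.trans h ?_
  simp only [map_add, map_smul, map_sum, phiE_nJJ, phiE_nGG, phiE_phiE_neg]

theorem eventually_conj_G (m : ℤ) (f : SP) : ∀ᶠ M : ℕ in atTop, opSP (C.conj (G m)) f =
    ∑ j ∈ zrange M, cst ((-1) ^ (j - 1)) • C.Jc (j - 1) (C.Gc (-(j + 2 * m + 1) - 1) f) := by
  filter_upwards [eventually_G m (C.phiE (-1) f)] with M hM
  have h := congrArg (C.phiE 1) hM
  refine Eq.trans h ?_
  simp only [map_smul, map_sum, phiE_Jm', phiE_Gm', phiE_phiE_neg, neg_neg]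

end LocalSuperSpectralCurve

/-! ### Truncated exponentials -/

/-- `∑_{r < W} f^r / r!`. -/
def expS (f : SP) (W : ℕ) : SP := ∑ r ∈ Finset.range W, cst (1 / (r.factorial : ℂ)) • f ^ r

theorem expS_succ (f : SP) (W : ℕ) :
    expS f (W + 1) = expS f W + cst (1 / (W.factorial : ℂ)) • f ^ W :=
  Finset.sum_range_succ _ _

theorem der_pow_succ (v : ℕ+ → ℂ) {f : SP} (hf : par f = f) (r : ℕ) :
    der v (f ^ (r + 1)) = cst ((r : ℂ) + 1) • (der v f * f ^ r) := by
  induction r with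
  | zero => simp
  | succ r ih =>
    rw [pow_succ', der_mul, ih, mul_smul_comm, ← mul_assoc, comm_of_par_eq hf, mul_assoc,
      ← pow_succ']
    push_cast
    rw [cst_add ((r : ℂ) + 1) 1, add_smul, cst_one, one_smul, add_comm]

theorem oder_pow_succ (v : ℕ → ℂ) {f : SP} (hf : par f = f) (r : ℕ) :
    oder v (f ^ (r + 1)) = cst ((r : ℂ) + 1) • (oder v f * f ^ r) := by
  induction r with
  | zero => simp
  | succ r ih =>
    rw [pow_succ', oder_mul, ih, mul_smul_comm, hf, ← mul_assoc, comm_of_par_eq hf, mul_assoc,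
      ← pow_succ']
    push_cast
    rw [cst_add ((r : ℂ) + 1) 1, add_smul, cst_one, one_smul, add_comm]

theorem one_div_factorial_succ (r : ℕ) :
    cst (1 / ((r + 1).factorial : ℂ)) * cst ((r : ℂ) + 1) = cst (1 / (r.factorial : ℂ)) := by
  rw [← cst_mul, Nat.factorial_succ]
  congr 1
  have : ((r : ℂ) + 1) ≠ 0 := Nat.cast_add_one_ne_zero r
  have h2 : ((r.factorial : ℕ) : ℂ) ≠ 0 := by exact_mod_cast r.factorial_ne_zero
  push_cast
  field_simp

/-- An even `f` is central, so the usual rule holds, except that the truncation order drops by one.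
That loss is the only defect in the symbol calculus below. -/
theorem der_expS (v : ℕ+ → ℂ) {f : SP} (hf : par f = f) (W : ℕ) :
    der v (expS f (W + 1)) = der v f * expS f W := by
  rw [expS, expS, Finset.sum_range_succ', map_add, map_sum, Finset.mul_sum]
  simp only [map_smul, der_pow_succ v hf, smul_smul, one_div_factorial_succ, mul_smul_comm,
    pow_zero, der_one, smul_zero, add_zero]

theorem oder_expS (v : ℕ → ℂ) {f : SP} (hf : par f = f) (W : ℕ) :
    oder v (expS f (W + 1)) = oder v f * expS f W := by
  rw [expS, expS, Finset.sum_range_succ', map_add, map_sum, Finset.mul_sum]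
  simp only [map_smul, oder_pow_succ v hf, smul_smul, one_div_factorial_succ, mul_smul_comm,
    pow_zero, oder_one, smul_zero, add_zero]

theorem expS_sub_one_mem {f : SP} (hf : f ∈ dge 1) (W : ℕ) : expS f (W + 1) - 1 ∈ dge 1 := by
  rw [expS, Finset.sum_range_succ']
  simp only [pow_zero, Nat.factorial_zero, Nat.cast_one, div_one, cst_one, one_smul,
    add_sub_cancel_right]
  refine sum_mem fun r _ => cst_smul_mem_dge (dge_anti ?_ (pow_mem_dge hf (r + 1))) _
  push_cast
  omega

theorem expS_mem {f : SP} (hf : f ∈ dge 1) (W : ℕ) : expS f W ∈ dge 0 :=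
  sum_mem fun r _ => cst_smul_mem_dge (dge_anti (by omega) (pow_mem_dge hf r)) _

theorem expS_tail_mem {f : SP} (hf : f ∈ dge 1) (W : ℕ) : expS f (W + 1) - expS f W ∈ dge W := by
  rw [expS_succ, add_sub_cancel_left]
  exact cst_smul_mem_dge (pow_mem_dge hf W) _

/-- Division by a series starting with `1`. In `a = a e - a (e - 1)` the last term has one degree
more than is already known for `a`, so the bound improves step by step until it reaches `w`. -/
theorem mem_dge_of_mul_mem {a e : SP} (he : e - 1 ∈ dge 1) {w : ℤ} (h : a * e ∈ dge w) :
    a ∈ dge w := by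
  obtain ⟨u, hu⟩ := exists_mem_dge a
  have key : ∀ n : ℕ, a ∈ dge (min w (u + n)) := by
    intro n
    induction n with
    | zero => exact dge_anti (by simp) hu
    | succ n ih =>
      have h1 := mul_mem_dge ih he
      have h2 : a = a * e - a * (e - 1) := by noncomm_ring
      rw [h2]
      refine sub_mem (dge_anti (min_le_left _ _) h) (dge_anti ?_ h1)
      push_cast
      omega
  refine dge_anti ?_ (key (w - u).toNat)
  omega

/-! ### Symbols -/

namespace LocalSuperSpectralCurve

variable (C : LocalSuperSpectralCurve)

/-- `e^{-f} Φ J_{-p-1} Φ⁻¹ e^f`. -/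
def sB (f : SP) (p : ℤ) : SP := C.mB p + hb 1 • der (C.cB p) f

/-- `e^{-f} Φ Γ_{-p-1} Φ⁻¹ e^f`. -/
def sF (f : SP) (p : ℤ) : SP := C.mF p + hb 1 • oder (C.cF p) f

/-- The symbol of `Φ J_{-p-1} J_{-q-1} Φ⁻¹`. -/
def sBB (f : SP) (p q : ℤ) : SP := C.sB f p * C.sB f q + hb 1 • der (C.cB p) (C.sB f q)

/-- The symbol of `Φ Γ_{-p-1} Γ_{-q-1} Φ⁻¹`. -/
def sFF (f : SP) (p q : ℤ) : SP := C.sF f p * C.sF f q + hb 1 • oder (C.cF p) (C.sF f q)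

/-- The symbol of `Φ J_{-p-1} Γ_{-q-1} Φ⁻¹`. -/
def sBF (f : SP) (p q : ℤ) : SP := C.sB f p * C.sF f q + hb 1 • der (C.cB p) (C.sF f q)

theorem mB_mem (p : ℤ) : C.mB p ∈ dge 0 := by
  cases p with
  | ofNat n =>
    refine add_mem ?_ (cst_smul_mem_dge (dge_anti (by norm_num) (xv_mem_dge _)) _)
    simpa using algebraMap_mem_dge (C.τ n.succPNat) 0
  | negSucc n => exact zero_mem _

theorem mF_mem (p : ℤ) : C.mF p ∈ dge 1 := by
  match p with
  | Int.ofNat n => exact add_mem (tv_mem_dge _) (cst_smul_mem_dge (tv_mem_dge _) _)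
  | Int.negSucc 0 => exact cst_smul_mem_dge (tv_mem_dge _) _
  | Int.negSucc (n + 1) => exact zero_mem _

theorem par_mB (p : ℤ) : par (C.mB p) = C.mB p := by
  cases p with
  | ofNat n => simp [mB]
  | negSucc n => simp [mB]

theorem par_mF (p : ℤ) : par (C.mF p) = -C.mF p := by
  match p with
  | Int.ofNat n => simp [mF]; abel
  | Int.negSucc 0 => simp [mF]
  | Int.negSucc (n + 1) => simp [mF]

theorem hb_der_mem (v : ℕ+ → ℂ) {w : ℤ} {f : SP} (hf : f ∈ dge w) :
    hb 1 • der v f ∈ dge (w + 1) :=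
  dge_anti (by omega) (hb_smul_mem_dge (der_mem_dge v hf) 1)

theorem hb_oder_mem (v : ℕ → ℂ) {w : ℤ} {f : SP} (hf : f ∈ dge w) :
    hb 1 • oder v f ∈ dge (w + 1) :=
  dge_anti (by omega) (hb_smul_mem_dge (oder_mem_dge v hf) 1)

theorem sB_mem {f : SP} (hf : f ∈ dge 1) (p : ℤ) : C.sB f p ∈ dge 0 :=
  add_mem (C.mB_mem p) (dge_anti (by norm_num) (hb_der_mem _ hf))

theorem sF_mem {f : SP} (hf : f ∈ dge 1) (p : ℤ) : C.sF f p ∈ dge 1 :=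
  add_mem (C.mF_mem p) (dge_anti (by norm_num) (hb_oder_mem _ hf))

theorem par_sB {f : SP} (hf : par f = f) (p : ℤ) : par (C.sB f p) = C.sB f p := by
  rw [sB, map_add, par_mB, map_smul, ← der_par, hf]

theorem par_oder {f : SP} (hf : par f = f) (w : ℕ → ℂ) : par (oder w f) = -oder w f := by
  have := oder_par w f
  rw [hf] at this
  exact (neg_eq_iff_eq_neg.mpr this).symm

theorem par_sF {f : SP} (hf : par f = f) (p : ℤ) : par (C.sF f p) = -C.sF f p := by
  rw [sF, map_add, par_mF, map_smul, par_oder hf, smul_neg, neg_add]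

theorem Jc_mem (p : ℤ) {w : ℤ} {f : SP} (hf : f ∈ dge w) : C.Jc p f ∈ dge w := by
  rw [Jc_apply]
  exact add_mem (dge_anti (by omega) (mul_mem_dge (C.mB_mem p) hf))
    (dge_anti (by omega) (hb_der_mem _ hf))

theorem Gc_mem (p : ℤ) {w : ℤ} {f : SP} (hf : f ∈ dge w) : C.Gc p f ∈ dge w := by
  rw [Gc_apply]
  exact add_mem (dge_anti (by omega) (mul_mem_dge (C.mF_mem p) hf))
    (dge_anti (by omega) (hb_oder_mem _ hf))

/-- The exact Leibniz computation leaves only the term of order `W` of the exponential as error,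
because differentiation lowered the truncation order. -/
theorem Jc_mul_expS {f : SP} (hp : par f = f) (hf : f ∈ dge 1)
    (a : SP) (ha : a ∈ dge 0) (p : ℤ) (W : ℕ) :
    C.Jc p (a * expS f (W + 1)) -
      (C.sB f p * a + hb 1 • der (C.cB p) a) * expS f (W + 1) ∈ dge W := by
  have h1 : a * der (C.cB p) f = der (C.cB p) f * a :=
    (comm_of_par_eq (by rw [← der_par, hp]) a).symm
  have : C.Jc p (a * expS f (W + 1)) -
      (C.sB f p * a + hb 1 • der (C.cB p) a) * expS f (W + 1) =
      -((hb 1 • der (C.cB p) f) * a * (expS f (W + 1) - expS f W)) := by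
    rw [Jc_apply, der_mul, der_expS _ hp, sB, ← mul_assoc, ← mul_assoc, h1]
    simp only [add_mul, smul_add, smul_mul_assoc, mul_sub]
    abel
  rw [this]
  exact neg_mem (dge_anti (by omega)
    (mul_mem_dge (mul_mem_dge (hb_der_mem _ hf) ha) (expS_tail_mem hf W)))

/-- The two admitted shapes of `a` are those needed for one and for two fermionic modes. In both
cases the sign from the odd Leibniz rule cancels the one from moving `∂f` to the left of `a`. -/
theorem Gc_mul_expS {f : SP} (hp : par f = f) (hf : f ∈ dge 1)
    (a : SP) (ha : a ∈ dge 0) (hpa : par a = -a ∨ a = 1) (p : ℤ) (W : ℕ) :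
    C.Gc p (a * expS f (W + 1)) -
      (C.sF f p * a + hb 1 • oder (C.cF p) a) * expS f (W + 1) ∈ dge W := by
  have h1 : par a * oder (C.cF p) f = oder (C.cF p) f * a := by
    rcases hpa with h | rfl
    · rw [h, neg_mul, anticomm_of_par_eq_neg h (par_oder hp _), neg_neg]
    · simp
  have : C.Gc p (a * expS f (W + 1)) -
      (C.sF f p * a + hb 1 • oder (C.cF p) a) * expS f (W + 1) =
      -((hb 1 • oder (C.cF p) f) * a * (expS f (W + 1) - expS f W)) := by
    rw [Gc_apply, oder_mul, oder_expS _ hp, sF, ← mul_assoc, ← mul_assoc, h1]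
    simp only [add_mul, smul_add, smul_mul_assoc, mul_sub]
    abel
  rw [this]
  exact neg_mem (dge_anti (by omega)
    (mul_mem_dge (mul_mem_dge (hb_oder_mem _ hf) ha) (expS_tail_mem hf W)))

theorem Jc_expS {f : SP} (hp : par f = f) (hf : f ∈ dge 1)
    (p : ℤ) (W : ℕ) :
    C.Jc p (expS f (W + 1)) - C.sB f p * expS f (W + 1) ∈ dge W := by
  simpa using C.Jc_mul_expS hp hf 1 one_mem_dge p W

theorem Gc_expS {f : SP} (hp : par f = f) (hf : f ∈ dge 1)
    (p : ℤ) (W : ℕ) :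
    C.Gc p (expS f (W + 1)) - C.sF f p * expS f (W + 1) ∈ dge W := by
  simpa using C.Gc_mul_expS hp hf 1 one_mem_dge (Or.inr rfl) p W

/-- The inner mode is replaced by its symbol at the price of an error of order `W`, which the outer
mode does not lower; then the outer mode is applied to symbol times exponential. -/
theorem Jc_Jc_expS {f : SP} (hp : par f = f) (hf : f ∈ dge 1)
    (p q : ℤ) (W : ℕ) :
    C.Jc p (C.Jc q (expS f (W + 1))) - C.sBB f p q * expS f (W + 1) ∈ dge W := by
  have h := add_mem (C.Jc_mem p (C.Jc_expS hp hf q W))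
    (C.Jc_mul_expS hp hf (C.sB f q) (C.sB_mem hf q) p W)
  rwa [map_sub, sub_add_sub_cancel] at h

theorem Gc_Gc_expS {f : SP} (hp : par f = f) (hf : f ∈ dge 1)
    (p q : ℤ) (W : ℕ) :
    C.Gc p (C.Gc q (expS f (W + 1))) - C.sFF f p q * expS f (W + 1) ∈ dge W := by
  have h := add_mem (C.Gc_mem p (C.Gc_expS hp hf q W))
    (C.Gc_mul_expS hp hf (C.sF f q) (dge_anti (by norm_num) (C.sF_mem hf q))
      (Or.inl (C.par_sF hp q)) p W)
  rwa [map_sub, sub_add_sub_cancel] at h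

theorem Jc_Gc_expS {f : SP} (hp : par f = f) (hf : f ∈ dge 1)
    (p q : ℤ) (W : ℕ) :
    C.Jc p (C.Gc q (expS f (W + 1))) - C.sBF f p q * expS f (W + 1) ∈ dge W := by
  have h := add_mem (C.Jc_mem p (C.Gc_expS hp hf q W))
    (C.Jc_mul_expS hp hf (C.sF f q) (dge_anti (by norm_num) (C.sF_mem hf q)) p W)
  rwa [map_sub, sub_add_sub_cancel] at h

/-- The symbol of the conjugate of `:J_a J_b:`. -/
def nBB (f : SP) (a b : ℤ) : SP :=
  if a ≤ b then C.sBB f (-a - 1) (-b - 1) else C.sBB f (-b - 1) (-a - 1)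

/-- The symbol of the conjugate of `:Γ_a Γ_b:`. -/
def nFF (f : SP) (a b : ℤ) : SP :=
  if a ≤ b then C.sFF f (-a - 1) (-b - 1) else -C.sFF f (-b - 1) (-a - 1)

/-- The symbol of the conjugate of `L_{2n}`, with the sums over `|j| ≤ M`. -/
def symL (n : ℤ) (f : SP) (M : ℕ) : SP :=
  cst (1 / 2) • (∑ j ∈ zrange M, cst ((-1) ^ (j - 1)) • C.nBB f (-j) (2 * n + j)) +
    (if n = 0 then cst (1 / 4) * hb 1 else 0) • 1 +
    cst (1 / 2) • (∑ j ∈ zrange M, cst ((-1) ^ j * (n + j)) • C.nFF f (-j) (j + 2 * n))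

/-- The symbol of the conjugate of `G_{2m+1}`, with the sum over `|j| ≤ M`. -/
def symG (m : ℤ) (f : SP) (M : ℕ) : SP :=
  ∑ j ∈ zrange M, cst ((-1) ^ (j - 1)) • C.sBF f (j - 1) (-(j + 2 * m + 1) - 1)

theorem eventually_conj_L_expS {f : SP} (hp : par f = f) (hf : f ∈ dge 1)
    (n : ℤ) (W : ℕ) : ∀ᶠ M : ℕ in atTop,
    opSP (C.conj (L n)) (expS f (W + 1)) - C.symL n f M * expS f (W + 1) ∈ dge W := by
  filter_upwards [C.eventually_conj_L n (expS f (W + 1))] with M hM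
  have hB (a b : ℤ) : C.nJc a b (expS f (W + 1)) - C.nBB f a b * expS f (W + 1) ∈ dge W := by
    rw [nJc, nBB]
    split_ifs <;> exact C.Jc_Jc_expS hp hf _ _ W
  have hF (a b : ℤ) : C.nGc a b (expS f (W + 1)) - C.nFF f a b * expS f (W + 1) ∈ dge W := by
    rw [nGc, nFF]
    split_ifs
    · exact C.Gc_Gc_expS hp hf _ _ W
    · have := neg_mem (C.Gc_Gc_expS hp hf (-b - 1) (-a - 1) W)
      rw [neg_sub'] at this
      rwa [neg_mul]
  have h1 := cst_smul_mem_dge (sum_mem fun j (_ : j ∈ zrange M) =>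
    cst_smul_mem_dge (hB (-j) (2 * n + j)) ((-1) ^ (j - 1))) (1 / 2)
  have h2 := cst_smul_mem_dge (sum_mem fun j (_ : j ∈ zrange M) =>
    cst_smul_mem_dge (hF (-j) (j + 2 * n)) ((-1) ^ j * (n + j))) (1 / 2)
  convert add_mem h1 h2 using 1
  rw [hM, symL]
  simp only [add_mul, smul_mul_assoc, one_mul, Finset.sum_mul, smul_sub, Finset.sum_sub_distrib]
  abel

theorem eventually_conj_G_expS {f : SP} (hp : par f = f) (hf : f ∈ dge 1)
    (m : ℤ) (W : ℕ) : ∀ᶠ M : ℕ in atTop,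
    opSP (C.conj (G m)) (expS f (W + 1)) - C.symG m f M * expS f (W + 1) ∈ dge W := by
  filter_upwards [C.eventually_conj_G m (expS f (W + 1))] with M hM
  rw [hM, symG, Finset.sum_mul, ← Finset.sum_sub_distrib]
  refine sum_mem fun j _ => ?_
  rw [smul_mul_assoc, ← smul_sub]
  exact cst_smul_mem_dge (C.Jc_Gc_expS hp hf _ _ W) _

end LocalSuperSpectralCurve

/-! ### Annihilation in terms of symbols -/

/-- The partial sums of the free energy. -/
def fT (F : FreeCoeffs) (W : ℕ) : SP := freeTrunc F W

/-- The homogeneous component `F_{g,n|k}` of the free energy. -/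
def fTerm (F : FreeCoeffs) (g n k : ℕ) : SP := freeTerm F g n k

theorem fT_eq (F : FreeCoeffs) (W : ℕ) : fT F W =
    ∑ g ∈ Finset.range W, ∑ n ∈ Finset.range W, ∑ k ∈ Finset.range W, fTerm F g n k := rfl

theorem fTerm_eq (F : FreeCoeffs) (g n k : ℕ) : fTerm F g n k =
    (cst (1 / ((n.factorial : ℂ) * (k.factorial : ℂ))) * hb ((g : ℤ) - 1)) •
    (F g n k).sum fun p c => cst c •
      ((List.ofFn fun a => xv (p.1 a)).prod * (List.ofFn fun b => tv (p.2 b)).prod) := rfl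

theorem fTerm_eq' (F : FreeCoeffs) (g n k : ℕ) : fTerm F g n k =
    (cst (1 / ((n.factorial : ℂ) * (k.factorial : ℂ))) * hb ((g : ℤ) - 1)) •
    (F g n k).sum fun p c => cst c •
      (((List.ofFn p.1).map xv).prod * ((List.ofFn p.2).map tv).prod) := by
  simp only [fTerm_eq, List.map_ofFn, Function.comp_def]

theorem fTerm_mem (F : FreeCoeffs) (g n k : ℕ) : fTerm F g n k ∈ dge (2 * g - 2 + n + k) := by
  rw [fTerm_eq']
  refine dge_anti (w' := n + k + 2 * ((g : ℤ) - 1)) (by omega)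
    (cst_mul_hb_smul_mem_dge (sum_mem fun p _ => cst_smul_mem_dge ?_ _) _ _)
  simpa using mul_mem_dge (xprod_mem_dge (List.ofFn p.1)) (tprod_mem_dge (List.ofFn p.2))


/-- The stability and parity conditions on the coefficients of a free energy. -/
structure IsStableEven (F : FreeCoeffs) : Prop where
  stable : ∀ g n k, 2 * g + n + k ≤ 2 → F g n k = 0
  even : ∀ g n k, Odd k → F g n k = 0

theorem par_tprod (K : List ℕ) :
    par (K.map tv).prod = (-1) ^ K.length * (K.map tv).prod := by
  induction K with
  | nil => simp
  | cons j K ih =>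
    rw [List.map_cons, List.prod_cons, map_mul, par_tv, ih, List.length_cons, pow_succ]
    rcases Nat.even_or_odd K.length with h | h
    · simp [h.neg_one_pow]
    · simp [h.neg_one_pow]

theorem fTerm_of_eq_zero {F : FreeCoeffs} {g n k : ℕ} (h : F g n k = 0) : fTerm F g n k = 0 := by
  rw [fTerm_eq, h, Finsupp.sum_zero_index, smul_zero]

variable {F : FreeCoeffs}

theorem par_fTerm (hF : IsStableEven F) (g n k : ℕ) : par (fTerm F g n k) = fTerm F g n k := by
  rcases Nat.even_or_odd k with hk | hk
  · rw [fTerm_eq', map_smul, Finsupp.sum, map_sum]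
    congr 1
    refine Finset.sum_congr rfl fun p _ => ?_
    rw [map_smul, map_mul, par_xprod, par_tprod, List.length_ofFn, hk.neg_one_pow, one_mul]
  · rw [fTerm_of_eq_zero (hF.even g n k hk), map_zero]

theorem par_fT (hF : IsStableEven F) (W : ℕ) : par (fT F W) = fT F W := by
  simp only [fT_eq, map_sum, par_fTerm hF]

theorem fT_mem (hF : IsStableEven F) (W : ℕ) : fT F W ∈ dge 1 := by
  rw [fT_eq]
  refine sum_mem fun g _ => sum_mem fun n _ => sum_mem fun k _ => ?_
  by_cases h : 2 * g + n + k ≤ 2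
  · rw [fTerm_of_eq_zero (hF.stable g n k h)]
    exact zero_mem _
  · exact dge_anti (by omega) (fTerm_mem F g n k)

/-- Up to an error whose degree grows with the truncation, the operator acts on the truncated
exponential as multiplication by its symbol. Since the exponential is `1` plus higher degree, it can
be divided out. -/
theorem annihilates_iff_of_symbol (hF : IsStableEven F) {T : SuperPoly → SuperPoly}
    {Q : SP → ℕ → SP}
    (hQ : ∀ f : SP, par f = f → f ∈ dge 1 → ∀ W : ℕ, ∀ᶠ M : ℕ in atTop,
      opSP T (expS f (W + 1)) - Q f M * expS f (W + 1) ∈ dge W) :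
    Annihilates T F ↔ ∀ w : ℤ, ∃ W₀ : ℕ, ∀ W ≥ W₀, ∀ᶠ M : ℕ in atTop, Q (fT F W) M ∈ dge w := by
  constructor
  · intro h w
    obtain ⟨W₀, h0⟩ := h w
    -- The summand `w.toNat + 1` pushes the truncation error, of degree one less than the truncation
    -- order, beyond `w`. The mode cutoff `M` is chosen afterwards, depending on that order.
    refine ⟨W₀ + w.toNat + 1, fun W hW => ?_⟩
    obtain ⟨W, rfl⟩ : ∃ V, W = V + 1 := ⟨W - 1, by omega⟩
    filter_upwards [hQ _ (par_fT hF (W + 1)) (fT_mem hF (W + 1)) W] with M hM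
    have h1 : opSP T (expS (fT F (W + 1)) (W + 1)) ∈ dge w := h0 (W + 1) (by omega)
    have h2 := sub_mem h1 (dge_anti (w := w) (by omega) hM)
    rw [sub_sub_cancel] at h2
    exact mem_dge_of_mul_mem (expS_sub_one_mem (fT_mem hF _) _) h2
  · intro h w
    obtain ⟨W₀, h0⟩ := h w
    refine ⟨W₀ + w.toNat + 1, fun W hW => ?_⟩
    obtain ⟨W, rfl⟩ : ∃ V, W = V + 1 := ⟨W - 1, by omega⟩
    obtain ⟨M, hM, hM'⟩ := ((hQ _ (par_fT hF (W + 1)) (fT_mem hF (W + 1)) W).and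
      (h0 (W + 1) (by omega))).exists
    have h2 := add_mem (dge_anti (w := w) (by omega) hM)
      (dge_anti (w := w) (by omega) (mul_mem_dge hM' (expS_mem (fT_mem hF (W + 1)) (W + 1))))
    rw [sub_add_cancel] at h2
    exact h2

namespace LocalSuperSpectralCurve

variable (C : LocalSuperSpectralCurve)

theorem cB_neg_eq_single (i : ℕ+) : C.cB (-(i : ℤ) - 1) = Pi.single i 1 := by
  funext j
  have := C.cB_neg i j
  rw [Pi.single_apply, this]
  simp

theorem opSP_J (i : ℤ) : opSP (J i) = Jm i := rfl

theorem opSP_Gam (i : ℤ) : opSP (Gam i) = Gm i := rfl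

theorem mB_neg {p : ℤ} (hp : p < 0) : C.mB p = 0 := by
  obtain ⟨n, rfl⟩ := Int.eq_negSucc_of_lt_zero hp
  rfl

theorem mF_neg {p : ℤ} (hp : p < -1) : C.mF p = 0 := by
  obtain ⟨n, rfl⟩ := Int.eq_negSucc_of_lt_zero (by omega : p < 0)
  match n with
  | 0 => simp at hp
  | n + 1 => rfl

theorem cF_neg_eq_single {j : ℕ} (hj : 0 < j) : C.cF (-(j : ℤ) - 1) = Pi.single j 1 := by
  obtain ⟨n, rfl⟩ : ∃ n, j = n + 1 := ⟨j - 1, by omega⟩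
  funext i
  have := C.cF_neg n i
  rw [Pi.single_apply]
  exact_mod_cast this

/-- At exponents below `-1` the only basis contribution is a single pole and there is no
multiplication part, so positive modes coincide with their conjugates. The linear operators of `𝒮_𝒜`
then fit the same symbol calculus. -/
theorem Jm_eq_Jc {a : ℤ} (ha : 0 < a) (f : SP) : Jm a f = C.Jc (-a - 1) f := by
  lift a to ℕ+ using ha
  rw [Jm_pos, Jc_apply, mB_neg _ (by omega), zero_mul, zero_add, cB_neg_eq_single]
  rfl

theorem Gm_eq_Gc {a : ℤ} (ha : 0 < a) (f : SP) : Gm a f = C.Gc (-a - 1) f := by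
  lift a to ℕ using ha.le
  rw [Gc_apply, mF_neg _ (by omega), zero_mul, zero_add, cF_neg_eq_single _ (by omega), Gm_nat,
    gop_of_zero (Pi.single_eq_of_ne (by omega) _)]

theorem annihilates_J_iff (hF : IsStableEven F) {a : ℤ} (ha : 0 < a) :
    Annihilates (J a) F ↔ ∀ w : ℤ, ∃ W₀ : ℕ, ∀ W ≥ W₀, C.sB (fT F W) (-a - 1) ∈ dge w := by
  rw [annihilates_iff_of_symbol (Q := fun f _ => C.sB f (-a - 1)) hF]
  · simp only [eventually_const]
  · intro f hp hf W
    refine Eventually.of_forall fun _ => ?_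
    rw [opSP_J, C.Jm_eq_Jc ha]
    exact C.Jc_expS hp hf _ W

theorem annihilates_Gam_iff (hF : IsStableEven F) {a : ℤ} (ha : 0 < a) :
    Annihilates (Gam a) F ↔ ∀ w : ℤ, ∃ W₀ : ℕ, ∀ W ≥ W₀, C.sF (fT F W) (-a - 1) ∈ dge w := by
  rw [annihilates_iff_of_symbol (Q := fun f _ => C.sF f (-a - 1)) hF]
  · simp only [eventually_const]
  · intro f hp hf W
    refine Eventually.of_forall fun _ => ?_
    rw [opSP_Gam, C.Gm_eq_Gc ha]
    exact C.Gc_expS hp hf _ W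

theorem annihilates_L_iff (hF : IsStableEven F) (n : ℤ) :
    Annihilates (C.conj (L n)) F ↔
      ∀ w : ℤ, ∃ W₀ : ℕ, ∀ W ≥ W₀, ∀ᶠ M : ℕ in atTop, C.symL n (fT F W) M ∈ dge w :=
  annihilates_iff_of_symbol hF fun _ hp hf W => C.eventually_conj_L_expS hp hf n W

theorem annihilates_G_iff (hF : IsStableEven F) (m : ℤ) :
    Annihilates (C.conj (G m)) F ↔
      ∀ w : ℤ, ∃ W₀ : ℕ, ∀ W ≥ W₀, ∀ᶠ M : ℕ in atTop, C.symG m (fT F W) M ∈ dge w :=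
  annihilates_iff_of_symbol hF fun _ hp hf W => C.eventually_conj_G_expS hp hf m W

end LocalSuperSpectralCurve

/-! ### The product rule for Taylor coefficients -/

theorem tay_par (l : List (ℕ+ → ℂ)) (m : List (ℕ → ℂ)) (a : SP) :
    tay l m (par a) = (-1) ^ m.length * tay l m a := by
  induction l generalizing a with
  | cons v l ih => rw [tay_cons_left, tay_cons_left, der_par, ih]
  | nil =>
    induction m generalizing a with
    | nil => simp [tay_apply]
    | cons w m ih =>
      rw [tay_cons_right, tay_cons_right, oder_par, map_neg, ih, List.length_cons, pow_succ]
      ring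

theorem sum_finset_fin_succ {M : Type*} [AddCommMonoid M] {n : ℕ} (f : Finset (Fin (n + 1)) → M) :
    ∑ S, f S = ∑ S : Finset (Fin n), f (S.map (Fin.succEmb n)) +
      ∑ S : Finset (Fin n), f (insert 0 (S.map (Fin.succEmb n))) := by
  have hu : (Finset.univ : Finset (Finset (Fin (n + 1)))) =
      (insert 0 ((Finset.univ : Finset (Fin n)).map (Fin.succEmb n))).powerset := by
    rw [← Finset.powerset_univ, Fin.univ_succ, Finset.cons_eq_insert]
    rfl
  have hp : ((Finset.univ : Finset (Fin n)).map (Fin.succEmb n)).powerset =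
      Finset.univ.image fun S : Finset (Fin n) => S.map (Fin.succEmb n) := by
    ext S
    simp only [Finset.mem_powerset, Finset.subset_map_iff, Finset.mem_image, Finset.mem_univ,
      true_and, Finset.subset_univ, eq_comm]
  rw [hu, Finset.sum_powerset_insert (by simp), hp, Finset.sum_image, Finset.sum_image]
  all_goals exact fun _ _ _ _ h => Finset.map_injective _ h

theorem compl_map_succ {n : ℕ} (S : Finset (Fin n)) :
    (S.map (Fin.succEmb n))ᶜ = insert 0 (Sᶜ.map (Fin.succEmb n)) := by
  ext x
  refine Fin.cases ?_ (fun i => ?_) x <;> simp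

theorem compl_insert_map_succ {n : ℕ} (S : Finset (Fin n)) :
    (insert 0 (S.map (Fin.succEmb n)))ᶜ = Sᶜ.map (Fin.succEmb n) := by
  ext x
  refine Fin.cases ?_ (fun i => ?_) x <;> simp

/-- The entries of `v` at the positions in `S`, in increasing order. -/
def sublist {α : Type*} {n : ℕ} (v : Fin n → α) (S : Finset (Fin n)) : List α :=
  (S.sort (· ≤ ·)).map v

theorem sublist_eq_ofFn {α : Type*} {n : ℕ} (v : Fin n → α) (S : Finset (Fin n)) :
    sublist v S = List.ofFn fun i => v (S.orderEmbOfFin rfl i) := by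
  apply List.ext_getElem
  · simp [sublist]
  · intro i h1 h2
    simp [sublist, Finset.orderEmbOfFin_apply]

theorem length_sublist {α : Type*} {n : ℕ} (v : Fin n → α) (S : Finset (Fin n)) :
    (sublist v S).length = S.card := by simp [sublist]

theorem sort_map_succ {n : ℕ} (S : Finset (Fin n)) :
    (S.map (Fin.succEmb n)).sort (· ≤ ·) = (S.sort (· ≤ ·)).map Fin.succ := by
  apply List.Perm.eq_of_pairwise (le := (· ≤ ·)) 
  · intro a b _ _ h1 h2; exact le_antisymm h1 h2
  · exact Finset.pairwise_sort _ _
  · rw [List.pairwise_map]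
    exact (Finset.pairwise_sort S (· ≤ ·)).imp fun h => Fin.succ_le_succ_iff.mpr h
  · rw [← Multiset.coe_eq_coe, Finset.sort_eq, Finset.map_val, ← Finset.sort_eq S (· ≤ ·)]
    rfl

theorem sublist_map_succ {α : Type*} {n : ℕ} (v : Fin (n + 1) → α) (S : Finset (Fin n)) :
    sublist v (S.map (Fin.succEmb n)) = sublist (fun i => v i.succ) S := by
  rw [sublist, sort_map_succ, List.map_map]
  rfl

theorem sublist_insert_map_succ {α : Type*} {n : ℕ} (v : Fin (n + 1) → α) (S : Finset (Fin n)) :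
    sublist v (insert 0 (S.map (Fin.succEmb n))) = v 0 :: sublist (fun i => v i.succ) S := by
  rw [← sublist_map_succ, sublist, Finset.sort_insert, List.map_cons]
  · rfl
  · simp
  · simp

theorem shuffleSign_eq {k : ℕ} (R : Finset (Fin k)) :
    shuffleSign R = (-1) ^ (∑ r ∈ R, ∑ c ∈ Rᶜ, if c < r then 1 else 0) := by
  rw [shuffleSign, Finset.card_filter, Finset.sum_product]

/-- The new first position lies in the complement and precedes every element of the shifted set,
which adds one inversion for each element of `R`. -/
theorem shuffleSign_map_succ {k : ℕ} (R : Finset (Fin k)) :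
    shuffleSign (R.map (Fin.succEmb k)) = (-1) ^ R.card * shuffleSign R := by
  rw [shuffleSign_eq, shuffleSign_eq, compl_map_succ, ← pow_add]
  congr 1
  rw [Finset.sum_map]
  simp [Finset.sum_add_distrib, Finset.sum_map, Finset.sum_insert, -Finset.sum_boole]

/-- The new first position is listed first, so it creates no inversion. -/
theorem shuffleSign_insert_map_succ {k : ℕ} (R : Finset (Fin k)) :
    shuffleSign (insert 0 (R.map (Fin.succEmb k))) = shuffleSign R := by
  rw [shuffleSign_eq, shuffleSign_eq, compl_insert_map_succ]
  congr 1
  rw [Finset.sum_insert (by simp), Finset.sum_map]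
  simp [Finset.sum_map, -Finset.sum_boole]

/-- Iterated Leibniz rule: each derivative chooses one of the factors. An odd derivative that hits
the second factor puts the parity involution on the first, and the later odd derivatives of that
factor turn it into the sign counted by the shuffle. -/
theorem tay_mul {n k : ℕ} (v : Fin n → ℕ+ → ℂ) (w : Fin k → ℕ → ℂ) (a b : SP) :
    tay (List.ofFn v) (List.ofFn w) (a * b) = ∑ S : Finset (Fin n), ∑ R : Finset (Fin k),
      shuffleSign R • (tay (sublist v S) (sublist w R) a * tay (sublist v Sᶜ) (sublist w Rᶜ) b) := by
  induction n generalizing a b with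
  | succ n ih =>
    rw [List.ofFn_succ, tay_cons_left, der_mul, map_add, ih, ih, sum_finset_fin_succ, add_comm]
    simp only [compl_map_succ, compl_insert_map_succ, sublist_map_succ, sublist_insert_map_succ,
      tay_cons_left]
  | zero =>
    rw [Fintype.sum_unique]
    have h0 : ∀ S : Finset (Fin 0), sublist v S = [] := fun S => by
      rw [← List.length_eq_zero_iff, length_sublist]
      simpa using Finset.card_le_univ S
    simp only [h0, List.ofFn_zero]
    induction k generalizing a b with
    | zero =>
      rw [Fintype.sum_unique]
      have h1 : ∀ S : Finset (Fin 0), sublist w S = [] := fun S => by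
        rw [← List.length_eq_zero_iff, length_sublist]
        simpa using Finset.card_le_univ S
      simp only [h1, List.ofFn_zero, tay_apply]
      have h2 : shuffleSign (default : Finset (Fin 0)) = 1 := rfl
      simp [h2]
    | succ k ih =>
      rw [List.ofFn_succ, tay_cons_right, oder_mul, map_add, ih, ih, sum_finset_fin_succ, add_comm]
      simp only [compl_map_succ, compl_insert_map_succ, sublist_map_succ, sublist_insert_map_succ,
        tay_cons_right, shuffleSign_map_succ, shuffleSign_insert_map_succ, tay_par,
        length_sublist]
      congr 1
      refine Finset.sum_congr rfl fun R _ => ?_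
      simp only [zsmul_eq_mul]
      push_cast
      ring

/-! ### Taylor coefficients of monomials -/

/-- `x^{i_1} ⋯ x^{i_n}`. -/
def xmon {n : ℕ} (I : Fin n → ℕ+) : SP := ((List.ofFn I).map xv).prod

/-- `θ^{j_1} ⋯ θ^{j_k}`. -/
def tmon {k : ℕ} (K : Fin k → ℕ) : SP := ((List.ofFn K).map tv).prod

theorem xmon_succ {n : ℕ} (I : Fin (n + 1) → ℕ+) :
    xmon I = xv (I 0) * xmon fun a => I a.succ := by
  rw [xmon, List.ofFn_succ, List.map_cons, List.prod_cons, xmon]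

theorem tmon_succ {k : ℕ} (K : Fin (k + 1) → ℕ) :
    tmon K = tv (K 0) * tmon fun b => K b.succ := by
  rw [tmon, List.ofFn_succ, List.map_cons, List.prod_cons, tmon]

theorem xmon_zero (I : Fin 0 → ℕ+) : xmon I = 1 := by simp [xmon]

theorem tmon_zero (K : Fin 0 → ℕ) : tmon K = 1 := by simp [tmon]

theorem der_xmon (v : ℕ+ → ℂ) {n : ℕ} (I : Fin (n + 1) → ℕ+) :
    der v (xmon I) = ∑ a, cst (v (I a)) • xmon fun b => I (a.succAbove b) := by
  induction n with
  | zero => simp [xmon_succ, xmon_zero, Algebra.algebraMap_eq_smul_one]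
  | succ n ih =>
    rw [xmon_succ, der_xv_mul, ih, Finset.mul_sum]
    conv_rhs => rw [Fin.sum_univ_succ]
    congr 1
    refine Finset.sum_congr rfl fun a _ => ?_
    rw [xmon_succ, mul_smul_comm]
    simp only [Fin.succ_succAbove_zero, Fin.succ_succAbove_succ]

theorem oder_tmon (w : ℕ → ℂ) {k : ℕ} (K : Fin (k + 1) → ℕ) :
    oder w (tmon K) =
      ∑ b : Fin (k + 1), cst ((-1) ^ (b : ℕ) * w (K b)) • tmon fun c => K (b.succAbove c) := by
  induction k with
  | zero => simp [tmon_succ, tmon_zero, Algebra.algebraMap_eq_smul_one]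
  | succ k ih =>
    rw [tmon_succ, oder_tv_mul, ih, Finset.mul_sum, sub_eq_add_neg, ← Finset.sum_neg_distrib]
    conv_rhs => rw [Fin.sum_univ_succ]
    congr 1
    · simp
    refine Finset.sum_congr rfl fun a _ => ?_
    rw [tmon_succ, mul_smul_comm, Fin.val_succ, pow_succ, mul_neg_one, neg_mul, cst_neg, neg_smul]
    simp only [Fin.succ_succAbove_zero, Fin.succ_succAbove_succ]

theorem der_tmon (v : ℕ+ → ℂ) {k : ℕ} (K : Fin k → ℕ) : der v (tmon K) = 0 := der_tprod v _

theorem tay_xmon_mul_tmon_succ (v : ℕ+ → ℂ) (l : List (ℕ+ → ℂ)) (m : List (ℕ → ℂ)) {n k : ℕ}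
    (I : Fin (n + 1) → ℕ+) (K : Fin k → ℕ) :
    tay (v :: l) m (xmon I * tmon K) =
      ∑ a, cst (v (I a)) * tay l m ((xmon fun b => I (a.succAbove b)) * tmon K) := by
  rw [tay_cons_left, der_mul, der_tmon, mul_zero, add_zero, der_xmon, Finset.sum_mul, map_sum]
  simp only [smul_mul_assoc, map_smul, smul_eq_mul]

theorem aug_oders_xv_mul (m : List (ℕ → ℂ)) (i : ℕ+) (a : SP) : aug (oders m (xv i * a)) = 0 := by
  induction m generalizing a with
  | nil => simp
  | cons w m ih => rw [oders_cons, oder_xv_mul, ih]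

theorem tay_xmon_mul_tmon_of_ne (l : List (ℕ+ → ℂ)) (m : List (ℕ → ℂ)) {n k : ℕ}
    (I : Fin n → ℕ+) (K : Fin k → ℕ) (h : l.length ≠ n) : tay l m (xmon I * tmon K) = 0 := by
  induction l generalizing n with
  | nil =>
    match n with
    | 0 => simp at h
    | n + 1 => rw [xmon_succ, mul_assoc, tay_apply, ders_nil, aug_oders_xv_mul]
  | cons v l ih =>
    match n with
    | 0 => rw [xmon_zero, one_mul, tay_cons_left, der_tmon, map_zero]
    | n + 1 =>
      rw [tay_xmon_mul_tmon_succ]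
      refine Finset.sum_eq_zero fun a _ => ?_
      rw [ih _ (by simpa using h), mul_zero]

/-- A permutation is the image of `0` together with a permutation of the remaining positions. This
matches the expansion of an iterated derivative along its first slot. -/
theorem sum_perm_fin_succ {M : Type*} [AddCommMonoid M] {n : ℕ}
    (f : Fin (n + 1) → (Fin n → Fin (n + 1)) → M) :
    ∑ π : Equiv.Perm (Fin (n + 1)), f (π 0) (fun i => π i.succ) =
      ∑ a, ∑ π : Equiv.Perm (Fin n), f a fun i => a.succAbove (π i) := by
  rw [← Fintype.sum_prod_type']
  symm
  -- First permute the successors and fix `0`; then move `0` to the chosen value, which sends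
  -- successors to the complement in increasing order.
  let e : Fin (n + 1) × Equiv.Perm (Fin n) → Equiv.Perm (Fin (n + 1)) := fun p =>
    p.1.cycleRange.symm * Equiv.Perm.decomposeFin.symm (0, p.2)
  have h0 (p) : e p 0 = p.1 := by simp [e]
  have hs (p) (i : Fin n) : e p i.succ = p.1.succAbove (p.2 i) := by simp [e]
  have he : Function.Bijective e := by
    rw [Fintype.bijective_iff_injective_and_card]
    constructor
    · rintro ⟨a, π⟩ ⟨b, ρ⟩ h
      have h1 : a = b := by simpa [h0] using congrArg (fun s => s 0) h
      subst h1
      congr 1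
      ext i
      have h2 := congrArg (fun s => s i.succ) h
      simp only [hs] at h2
      rw [Fin.succAbove_right_injective h2]
    · simp [Fintype.card_perm, Nat.factorial_succ]
  refine Fintype.sum_bijective e he _ _ fun p => ?_
  simp only [h0, hs]

/-- Bosonic derivatives of a monomial give a permanent, expanded along its first row. -/
theorem tay_xmon_mul_tmon {n k : ℕ} (v : Fin n → ℕ+ → ℂ) (m : List (ℕ → ℂ)) (I : Fin n → ℕ+)
    (K : Fin k → ℕ) : tay (List.ofFn v) m (xmon I * tmon K) =
      cst (∑ π : Equiv.Perm (Fin n), ∏ i, v i (I (π i))) * tay [] m (tmon K) := by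
  induction n with
  | zero => simp [xmon_zero]
  | succ n ih =>
    rw [List.ofFn_succ, tay_xmon_mul_tmon_succ]
    simp only [ih, Fin.prod_univ_succ]
    rw [sum_perm_fin_succ (fun a s => v 0 (I a) * ∏ i, v i.succ (I (s i))), cst_sum, Finset.sum_mul]
    refine Finset.sum_congr rfl fun a _ => ?_
    rw [← Finset.mul_sum, cst_mul, mul_assoc]

theorem tay_tmon_of_ne (m : List (ℕ → ℂ)) {k : ℕ} (K : Fin k → ℕ) (h : m.length ≠ k) :
    tay [] m (tmon K) = 0 := by
  induction m generalizing k with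
  | nil =>
    match k with
    | 0 => simp at h
    | k + 1 =>
      rw [tmon_succ, tay_apply]
      simp [oders]
  | cons w m ih =>
    match k with
    | 0 => rw [tmon_zero, tay_cons_right, oder_one, map_zero]
    | k + 1 =>
      rw [tay_cons_right, oder_tmon, map_sum]
      refine Finset.sum_eq_zero fun a _ => ?_
      rw [map_smul, ih _ (by simpa using h), smul_zero]

/-- The signs of the odd derivation are those of the Laplace expansion along the first row. -/
theorem tay_tmon {k : ℕ} (w : Fin k → ℕ → ℂ) (K : Fin k → ℕ) :
    tay [] (List.ofFn w) (tmon K) = cst (Matrix.det (Matrix.of fun i j => w i (K j))) := by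
  induction k with
  | zero => simp [tmon_zero, tay_apply]
  | succ k ih =>
    rw [List.ofFn_succ, tay_cons_right, oder_tmon, map_sum, Matrix.det_succ_row_zero, cst_sum]
    refine Finset.sum_congr rfl fun a _ => ?_
    rw [map_smul, ih, smul_eq_mul, ← cst_mul]
    rfl

/-! ### Taylor coefficients of the free energy -/

/-- The pairing of a coefficient family with vectors. -/
def pairing {n k : ℕ} (c : Coeffs n k) (v : Fin n → ℕ+ → ℂ) (w : Fin k → ℕ → ℂ) : ℂ :=
  c.sum fun p z => z * ((∏ i, v i (p.1 i)) * ∏ j, w j (p.2 j))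

/-- Symmetry in the bosonic and antisymmetry in the fermionic indices. -/
structure IsSuperSymm {n k : ℕ} (c : Coeffs n k) : Prop where
  symm : ∀ (π : Equiv.Perm (Fin n)) (i : Fin n → ℕ+) (j : Fin k → ℕ), c (i ∘ π, j) = c (i, j)
  antisymm : ∀ (π : Equiv.Perm (Fin k)) (i : Fin n → ℕ+) (j : Fin k → ℕ),
    c (i, j ∘ π) = (Equiv.Perm.sign π : ℤ) * c (i, j)

/-- Reindexing the summation transfers the permutations to the coefficients; the fermionic sign then
appears twice and cancels. -/
theorem IsSuperSymm.pairing_perm {n k : ℕ} {c : Coeffs n k} (hc : IsSuperSymm c)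
    (v : Fin n → ℕ+ → ℂ) (w : Fin k → ℕ → ℂ) (π : Equiv.Perm (Fin n)) (ρ : Equiv.Perm (Fin k)) :
    (c.sum fun p z => z * ((∏ i, v i (p.1 (π i))) *
      ((Equiv.Perm.sign ρ : ℤ) * ∏ j, w (ρ j) (p.2 j)))) = pairing c v w := by
  classical
  have hs : ((Equiv.Perm.sign ρ : ℤ) : ℂ) * (Equiv.Perm.sign ρ : ℤ) = 1 := by
    norm_cast
    simp
  have hval (p : (Fin n → ℕ+) × (Fin k → ℕ)) :
      c (p.1 ∘ π, p.2 ∘ ρ.symm) = (Equiv.Perm.sign ρ : ℤ) * c p := by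
    rw [hc.symm, hc.antisymm, Equiv.Perm.sign_symm]
  let e : ((Fin n → ℕ+) × (Fin k → ℕ)) ≃ ((Fin n → ℕ+) × (Fin k → ℕ)) :=
    { toFun := fun p => (p.1 ∘ π, p.2 ∘ ρ.symm)
      invFun := fun p => (p.1 ∘ π.symm, p.2 ∘ ρ)
      left_inv := fun p => by ext <;> simp
      right_inv := fun p => by ext <;> simp }
  refine Finset.sum_equiv e (fun p => ?_) (fun p _ => ?_)
  · rw [Finsupp.mem_support_iff, Finsupp.mem_support_iff]
    change _ ↔ c (p.1 ∘ π, p.2 ∘ ρ.symm) ≠ 0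
    rw [hval, mul_ne_zero_iff]
    exact ⟨fun h => ⟨left_ne_zero_of_mul_eq_one hs, h⟩, fun h => h.2⟩
  · change _ = c (p.1 ∘ π, p.2 ∘ ρ.symm) * _
    rw [hval]
    have : ∏ j, w j ((e p).2 j) = ∏ j, w (ρ j) (p.2 j) := by
      rw [← Equiv.prod_comp ρ]
      simp [e]
    rw [this]
    change _ = _ * ((∏ i, v i (p.1 (π i))) * _)
    ring

/-- Permanent times determinant gives `n! k!` terms, all equal to the same pairing by
(anti)symmetry. They cancel the factorials in the definition of the free energy. -/
theorem tay_fTerm {F : FreeCoeffs} {g n k : ℕ} (hF : IsSuperSymm (F g n k)) (v : Fin n → ℕ+ → ℂ)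
    (w : Fin k → ℕ → ℂ) : tay (List.ofFn v) (List.ofFn w) (fTerm F g n k) =
      cst (pairing (F g n k) v w) * hb ((g : ℤ) - 1) := by
  have h1 : tay (List.ofFn v) (List.ofFn w) (fTerm F g n k) =
      cst (1 / ((n.factorial : ℂ) * (k.factorial : ℂ))) * hb ((g : ℤ) - 1) *
      cst ((F g n k).sum fun p z => z * ((∑ π : Equiv.Perm (Fin n), ∏ i, v i (p.1 (π i))) *
        ∑ ρ : Equiv.Perm (Fin k), (Equiv.Perm.sign ρ : ℤ) * ∏ j, w (ρ j) (p.2 j))) := by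
    rw [fTerm_eq', map_smul, smul_eq_mul, Finsupp.sum, Finsupp.sum, map_sum, cst_sum]
    congr 1
    refine Finset.sum_congr rfl fun p _ => ?_
    rw [map_smul, smul_eq_mul]
    have := tay_xmon_mul_tmon v (List.ofFn w) p.1 p.2
    rw [tay_tmon, Matrix.det_apply', ← cst_mul] at this
    rw [cst_mul]
    congr 1
  rw [h1]
  have h2 : ((F g n k).sum fun p z => z * ((∑ π : Equiv.Perm (Fin n), ∏ i, v i (p.1 (π i))) *
        ∑ ρ : Equiv.Perm (Fin k), (Equiv.Perm.sign ρ : ℤ) * ∏ j, w (ρ j) (p.2 j))) =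
      (n.factorial : ℂ) * (k.factorial : ℂ) * pairing (F g n k) v w := by
    simp only [Finset.sum_mul_sum]
    simp only [Finset.mul_sum, Finsupp.sum]
    rw [Finset.sum_comm]
    have (π : Equiv.Perm (Fin n)) := Finset.sum_comm (s := (F g n k).support)
      (t := (Finset.univ : Finset (Equiv.Perm (Fin k))))
      (f := fun p ρ => F g n k p * ((∏ i, v i (p.1 (π i))) *
        ((Equiv.Perm.sign ρ : ℤ) * ∏ j, w (ρ j) (p.2 j))))
    simp only [this]
    have h3 := hF.pairing_perm v w
    simp only [Finsupp.sum] at h3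
    simp only [h3, Finset.sum_const, Finset.card_univ, Fintype.card_perm, Fintype.card_fin,
      nsmul_eq_mul, mul_assoc]
  rw [h2, mul_right_comm, ← cst_mul]
  congr 2
  have h4 : ((n.factorial : ℕ) : ℂ) ≠ 0 := by exact_mod_cast n.factorial_ne_zero
  have h5 : ((k.factorial : ℕ) : ℂ) ≠ 0 := by exact_mod_cast k.factorial_ne_zero
  field_simp

theorem tay_fTerm_of_ne (F : FreeCoeffs) {g n k : ℕ} (l : List (ℕ+ → ℂ)) (m : List (ℕ → ℂ))
    (h : l.length ≠ n ∨ m.length ≠ k) : tay l m (fTerm F g n k) = 0 := by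
  rw [fTerm_eq', map_smul, Finsupp.sum, map_sum]
  refine smul_eq_zero_of_right _ (Finset.sum_eq_zero fun p _ => ?_)
  rw [map_smul]
  refine smul_eq_zero_of_right _ ?_
  change tay l m (xmon p.1 * tmon p.2) = 0
  by_cases h1 : l.length = n
  · subst h1
    have := tay_xmon_mul_tmon l.get m p.1 p.2
    rw [List.ofFn_get] at this
    rw [this, tay_tmon_of_ne _ _ (by simpa using h), mul_zero]
  · exact tay_xmon_mul_tmon_of_ne _ _ _ _ h1

theorem tay_fT {F : FreeCoeffs} (hF : ∀ g n k, IsSuperSymm (F g n k)) {W n k : ℕ} (hn : n < W)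
    (hk : k < W) (v : Fin n → ℕ+ → ℂ) (w : Fin k → ℕ → ℂ) :
    tay (List.ofFn v) (List.ofFn w) (fT F W) =
      ∑ g ∈ Finset.range W, cst (pairing (F g n k) v w) * hb ((g : ℤ) - 1) := by
  rw [fT_eq, map_sum]
  refine Finset.sum_congr rfl fun g _ => ?_
  rw [map_sum, Finset.sum_eq_single n, map_sum, Finset.sum_eq_single k, tay_fTerm (hF g n k)]
  · exact fun k' _ h => tay_fTerm_of_ne _ _ _ (Or.inr (by simpa using h.symm))
  · exact fun h => absurd (Finset.mem_range.mpr hk) h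
  · intro n' _ h
    rw [map_sum]
    exact Finset.sum_eq_zero fun k' _ =>
      tay_fTerm_of_ne _ _ _ (Or.inl (by simpa using h.symm))
  · exact fun h => absurd (Finset.mem_range.mpr hn) h

theorem hcoef_tay_fT {F : FreeCoeffs} (hF : ∀ g n k, IsSuperSymm (F g n k)) {W g n k : ℕ}
    (hg : g < W) (hn : n < W) (hk : k < W) (v : Fin n → ℕ+ → ℂ) (w : Fin k → ℕ → ℂ) :
    hcoef ((g : ℤ) - 1) (tay (List.ofFn v) (List.ofFn w) (fT F W)) = pairing (F g n k) v w := by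
  rw [tay_fT hF hn hk, map_sum, Finset.sum_eq_single g]
  · rw [hcoef_cst_mul_hb, if_pos rfl]
  · intro h _ hne
    rw [hcoef_cst_mul_hb, if_neg (by omega)]
  · exact fun h => absurd (Finset.mem_range.mpr hg) h

/-- The free energy starts at `ħ^{-1}`. Hence the symbols have no negative powers of `ħ`, as needed
for genus splittings over natural numbers. -/
theorem hcoef_tay_fT_of_lt {F : FreeCoeffs} (hF : ∀ g n k, IsSuperSymm (F g n k)) (W : ℕ)
    {p : ℤ} (hp : p < -1) (l : List (ℕ+ → ℂ)) (m : List (ℕ → ℂ)) :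
    hcoef p (tay l m (fT F W)) = 0 := by
  rw [fT_eq]
  simp only [map_sum]
  refine Finset.sum_eq_zero fun g _ => Finset.sum_eq_zero fun n _ => Finset.sum_eq_zero fun k _ => ?_
  by_cases h : l.length = n ∧ m.length = k
  · obtain ⟨rfl, rfl⟩ := h
    have := tay_fTerm (hF g l.length m.length) l.get m.get
    rw [List.ofFn_get, List.ofFn_get] at this
    rw [this, hcoef_cst_mul_hb, if_neg (by omega)]
  · rw [tay_fTerm_of_ne _ _ _ (by tauto), map_zero]

namespace LocalSuperSpectralCurve

variable (C : LocalSuperSpectralCurve)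

/-! ### Expansions in the tensor bases -/

theorem linearIndependent_dxiNeg : LinearIndependent ℂ C.dxiNeg := by
  rw [linearIndependent_iff']
  intro s c h i hi
  have h1 := congrArg (HahnSeries.coeff.linearMap (R := ℂ) (-(i : ℤ) - 1)) h
  rw [map_sum, map_zero] at h1
  have h2 : ∀ j ∈ s, HahnSeries.coeff.linearMap (R := ℂ) (-(i : ℤ) - 1) (c j • C.dxiNeg j) =
      if j = i then c j else 0 := by
    intro j _
    rw [map_smul, smul_eq_mul]
    change c j * C.cB (-((i : ℕ) : ℤ) - 1) j = _
    rw [cB_neg]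
    simp
  rw [Finset.sum_congr rfl h2, Finset.sum_ite_eq' s i, if_pos hi] at h1
  exact h1

/-- The elements with `l ≥ 1` are separated by their leading poles. The zero mode is read off at
`z^{-1}` only after that, because the others may contribute `ψ_{l0}` there. -/
theorem linearIndependent_etaNeg : LinearIndependent ℂ C.etaNeg := by
  rw [linearIndependent_iff']
  intro s c h
  have key (a : ℤ) : ∑ j ∈ s, c j * C.cF a j = 0 := by
    have h1 := congrArg (HahnSeries.coeff.linearMap (R := ℂ) a) h
    rw [map_sum, map_zero] at h1
    simp only [map_smul, smul_eq_mul] at h1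
    exact h1
  have hpos : ∀ n : ℕ, n + 1 ∈ s → c (n + 1) = 0 := by
    intro n hn
    have h1 := key (-((n : ℤ) + 1) - 1)
    simp only [cF_neg, mul_ite, mul_one, mul_zero] at h1
    rwa [Finset.sum_ite_eq' s (n + 1), if_pos hn] at h1
  intro i hi
  match i with
  | n + 1 => exact hpos n hi
  | 0 =>
    have h1 := key (-1)
    rw [Finset.sum_eq_single 0] at h1
    · simpa [cF_neg_one, C.ψ_zero] using h1
    · intro j hj hj0
      obtain ⟨n, rfl⟩ := Nat.exists_eq_succ_of_ne_zero hj0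
      rw [hpos n hj, zero_mul]
    · exact fun h => absurd hi h

/-- The basis `dξ_{-l}` of `V^{B-}`. -/
def basisB : Module.Basis ℕ+ ℂ C.VBminus := Module.Basis.span C.linearIndependent_dxiNeg

/-- The basis `η_{-l}` of `V^{F 0,-}`. -/
def basisF : Module.Basis ℕ ℂ C.VFzeroMinus := Module.Basis.span C.linearIndependent_etaNeg

theorem basisB_apply (i : ℕ+) : C.basisB i = C.dxiBasis i := Module.Basis.span_apply _ i

theorem basisF_apply (i : ℕ) : C.basisF i = C.etaBasis i := Module.Basis.span_apply _ i

/-- The tensor product basis. -/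
def basisT (n k : ℕ) : Module.Basis ((Fin n → ℕ+) × (Fin k → ℕ)) ℂ (C.Tens n k) :=
  (Basis.piTensorProduct fun _ => C.basisB).tensorProduct (Basis.piTensorProduct fun _ => C.basisF)

theorem basisT_apply (n k : ℕ) (p : (Fin n → ℕ+) × (Fin k → ℕ)) : C.basisT n k p =
    (⨂ₜ[ℂ] a, C.dxiBasis (p.1 a)) ⊗ₜ[ℂ] (⨂ₜ[ℂ] b, C.etaBasis (p.2 b)) := by
  rw [basisT, Module.Basis.tensorProduct_apply', Basis.piTensorProduct_apply,
    Basis.piTensorProduct_apply]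
  simp only [basisB_apply, basisF_apply]

theorem isExpansion_iff {n k : ℕ} (w : C.Tens n k) (F : Coeffs n k) :
    IsExpansion C w F ↔ F = (C.basisT n k).repr w := by
  have h : (F.sum fun p c => c • ((⨂ₜ[ℂ] a, C.dxiBasis (p.1 a)) ⊗ₜ[ℂ]
      (⨂ₜ[ℂ] b, C.etaBasis (p.2 b)))) = (C.basisT n k).repr.symm F := by
    rw [Module.Basis.repr_symm_apply, Finsupp.linearCombination_apply]
    simp only [basisT_apply]
  rw [IsExpansion, h, LinearEquiv.eq_symm_apply, eq_comm]

theorem repr_reindex_left {n k : ℕ} (w : C.Tens n k) (π : Equiv.Perm (Fin n))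
    (i : Fin n → ℕ+) (j : Fin k → ℕ) :
    (C.basisT n k).repr (TensorProduct.map
      (PiTensorProduct.reindex ℂ (fun _ => C.VBminus) π).toLinearMap LinearMap.id w) (i, j) =
    (C.basisT n k).repr w (i ∘ π, j) := by
  classical
  have : (C.basisT n k).coord (i, j) ∘ₗ TensorProduct.map
      (PiTensorProduct.reindex ℂ (fun _ => C.VBminus) π).toLinearMap LinearMap.id =
      (C.basisT n k).coord (i ∘ π, j) := by
    refine (C.basisT n k).ext fun p => ?_
    rw [LinearMap.comp_apply, basisT_apply, TensorProduct.map_tmul, LinearEquiv.coe_coe,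
      PiTensorProduct.reindex_tprod]
    have h1 := C.basisT_apply n k (p.1 ∘ π.symm, p.2)
    have h2 := C.basisT_apply n k p
    simp only [Function.comp_apply] at h1
    rw [LinearMap.id_apply, ← h1, ← h2, Module.Basis.coord_apply, Module.Basis.coord_apply,
      Module.Basis.repr_self, Module.Basis.repr_self, Finsupp.single_apply, Finsupp.single_apply]
    congr 1
    rw [Prod.ext_iff, Prod.ext_iff]
    simp only [eq_iff_iff, and_congr_left_iff]
    intro _
    rw [Equiv.comp_symm_eq]
  exact LinearMap.congr_fun this w

theorem repr_reindex_right {n k : ℕ} (w : C.Tens n k) (π : Equiv.Perm (Fin k))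
    (i : Fin n → ℕ+) (j : Fin k → ℕ) :
    (C.basisT n k).repr (TensorProduct.map LinearMap.id
      (PiTensorProduct.reindex ℂ (fun _ => C.VFzeroMinus) π).toLinearMap w) (i, j) =
    (C.basisT n k).repr w (i, j ∘ π) := by
  classical
  have : (C.basisT n k).coord (i, j) ∘ₗ TensorProduct.map LinearMap.id
      (PiTensorProduct.reindex ℂ (fun _ => C.VFzeroMinus) π).toLinearMap =
      (C.basisT n k).coord (i, j ∘ π) := by
    refine (C.basisT n k).ext fun p => ?_
    rw [LinearMap.comp_apply, basisT_apply, TensorProduct.map_tmul, LinearEquiv.coe_coe,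
      PiTensorProduct.reindex_tprod]
    have h1 := C.basisT_apply n k (p.1, p.2 ∘ π.symm)
    have h2 := C.basisT_apply n k p
    simp only [Function.comp_apply] at h1
    rw [LinearMap.id_apply, ← h1, ← h2, Module.Basis.coord_apply, Module.Basis.coord_apply,
      Module.Basis.repr_self, Module.Basis.repr_self, Finsupp.single_apply, Finsupp.single_apply]
    congr 1
    rw [Prod.ext_iff, Prod.ext_iff]
    simp only [eq_iff_iff, and_congr_right_iff]
    intro _
    rw [Equiv.comp_symm_eq]
  exact LinearMap.congr_fun this w

/-- The coefficients of the expansions of the stable correlators. -/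
def coeffsOf (ω : C.Correlators) : FreeCoeffs := fun g n k =>
  if 2 < 2 * g + n + k then (C.basisT n k).repr (ω g n k) else 0

variable {C} {ω : C.Correlators}

theorem coeffsOf_stable {g n k : ℕ} (h : 2 < 2 * g + n + k) :
    C.coeffsOf ω g n k = (C.basisT n k).repr (ω g n k) := if_pos h

theorem coeffsOf_unstable {g n k : ℕ} (h : 2 * g + n + k ≤ 2) : C.coeffsOf ω g n k = 0 :=
  if_neg (by omega)

theorem isStableEven_coeffsOf (hs : C.IsSuperSymmetric ω) : IsStableEven (C.coeffsOf ω) where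
  stable g n k h := coeffsOf_unstable h
  even g n k hk := by
    by_cases h : 2 < 2 * g + n + k
    · rw [coeffsOf_stable h, hs.even g n k h hk, map_zero]
    · exact coeffsOf_unstable (by omega)

theorem isSuperSymm_coeffsOf (hs : C.IsSuperSymmetric ω) (g n k : ℕ) :
    IsSuperSymm (C.coeffsOf ω g n k) where
  symm π i j := by
    by_cases h : 2 < 2 * g + n + k
    · rw [coeffsOf_stable h, ← repr_reindex_left, hs.symm g n k h]
    · rw [coeffsOf_unstable (by omega)]; rfl
  antisymm π i j := by
    by_cases h : 2 < 2 * g + n + k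
    · rw [coeffsOf_stable h, ← repr_reindex_right, hs.antisymm g n k h]
      rcases Int.units_eq_one_or (Equiv.Perm.sign π) with hπ | hπ
      · rw [hπ, Units.val_one, one_smul, Int.cast_one, one_mul]
      -- The sign acts as an integer scalar on the tensor; an additive relation carries it through
      -- the coordinate map.
      · have h1 : (-1 : ℤ) • ω g n k + (1 : ℤ) • ω g n k = 0 := by rw [← add_smul]; simp
        have h2 := congrArg (fun x => (C.basisT n k).repr x (i, j)) h1
        simp only [map_add, Finsupp.add_apply, one_smul, map_zero, Finsupp.zero_apply] at h2
        rw [hπ, Units.val_neg, Units.val_one, Int.cast_neg, Int.cast_one, neg_one_mul]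
        exact eq_neg_of_add_eq_zero_left h2
    · rw [coeffsOf_unstable (by omega)]; simp

theorem evalT_basisT {n k : ℕ} (u : Fin n → LS →ₗ[ℂ] LS) (v : Fin k → LS →ₗ[ℂ] LS)
    (p : (Fin n → ℕ+) × (Fin k → ℕ)) : C.evalT u v (C.basisT n k p) =
      (∏ i, u i (C.dxiNeg (p.1 i))) * ∏ j, v j (C.etaNeg (p.2 j)) := by
  rw [basisT_apply, evalT, TensorProduct.lift.tmul, LinearMap.compl₁₂_apply,
    PiTensorProduct.lift.tprod, PiTensorProduct.lift.tprod]
  rfl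

theorem evalT_eq {n k : ℕ} (u : Fin n → LS →ₗ[ℂ] LS) (v : Fin k → LS →ₗ[ℂ] LS) (w : C.Tens n k) :
    C.evalT u v w = ((C.basisT n k).repr w).sum fun p c =>
      c • ((∏ i, u i (C.dxiNeg (p.1 i))) * ∏ j, v j (C.etaNeg (p.2 j))) := by
  conv_lhs => rw [← (C.basisT n k).linearCombination_repr w]
  rw [Finsupp.linearCombination_apply, Finsupp.sum, map_sum]
  simp only [map_smul, evalT_basisT]
  rfl

theorem coeff_finsuppSum {ι : Type*} (c : ι →₀ ℂ) (f : ι → ℂ → LS) (p : ℤ) :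
    (c.sum f).coeff p = c.sum fun i z => (f i z).coeff p := by
  change HahnSeries.coeff.linearMap (R := ℂ) p _ = _
  rw [Finsupp.sum, map_sum]
  rfl

theorem prod_coeffAt_B {n : ℕ} (α : Fin n → ℤ) (i : Fin n → ℕ+) :
    ∏ a, coeffAt (α a) (C.dxiNeg (i a)) = algebraMap ℂ LS (∏ a, C.cB (α a) (i a)) := by
  rw [map_prod]
  rfl

theorem prod_coeffAt_F {n : ℕ} (α : Fin n → ℤ) (i : Fin n → ℕ) :
    ∏ a, coeffAt (α a) (C.etaNeg (i a)) = algebraMap ℂ LS (∏ a, C.cF (α a) (i a)) := by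
  rw [map_prod]
  rfl

theorem coeff_mul_algebraMap (f : LS) (c : ℂ) (p : ℤ) :
    (f * algebraMap ℂ LS c).coeff p = f.coeff p * c := by
  rw [mul_comm, ← Algebra.smul_def, HahnSeries.coeff_smul, smul_eq_mul, mul_comm]

/-- Substitution of functionals into a stable correlator, with one bosonic slot kept. -/
theorem coeff_evalT_B {g n k : ℕ} (h : 2 < 2 * g + (n + 1) + k) (u : LS →ₗ[ℂ] LS) (α : Fin n → ℤ)
    (β : Fin k → ℤ) (p : ℤ) :
    (C.evalT (Matrix.vecCons u fun i => coeffAt (α i)) (fun j => coeffAt (β j))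
      (ω g (n + 1) k)).coeff p =
    pairing (C.coeffsOf ω g (n + 1) k)
      (Fin.cons (fun i => (u (C.dxiNeg i)).coeff p) fun i => C.cB (α i)) fun j => C.cF (β j) := by
  rw [evalT_eq, coeff_finsuppSum, pairing, coeffsOf_stable h]
  refine Finset.sum_congr rfl fun q _ => ?_
  simp only [Fin.prod_univ_succ, Matrix.cons_val_zero, Matrix.cons_val_succ, prod_coeffAt_B,
    prod_coeffAt_F, HahnSeries.coeff_smul, coeff_mul_algebraMap, smul_eq_mul, Fin.cons_zero,
    Fin.cons_succ]

theorem coeff_evalT_F {g n k : ℕ} (h : 2 < 2 * g + n + (k + 1)) (u : LS →ₗ[ℂ] LS) (α : Fin n → ℤ)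
    (β : Fin k → ℤ) (p : ℤ) :
    (C.evalT (fun i => coeffAt (α i)) (Matrix.vecCons u fun j => coeffAt (β j))
      (ω g n (k + 1))).coeff p =
    pairing (C.coeffsOf ω g n (k + 1)) (fun i => C.cB (α i))
      (Fin.cons (fun i => (u (C.etaNeg i)).coeff p) fun j => C.cF (β j)) := by
  rw [evalT_eq, coeff_finsuppSum, pairing, coeffsOf_stable h]
  refine Finset.sum_congr rfl fun q _ => ?_
  simp only [Fin.prod_univ_succ, Matrix.cons_val_zero, Matrix.cons_val_succ, prod_coeffAt_B,
    prod_coeffAt_F, HahnSeries.coeff_smul, smul_eq_mul, Fin.cons_zero, Fin.cons_succ]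
  rw [mul_comm (algebraMap ℂ LS _), coeff_mul_algebraMap, coeff_mul_algebraMap]
  ring

end LocalSuperSpectralCurve

theorem tay_algebraMap_cons_left (v : ℕ+ → ℂ) (l : List (ℕ+ → ℂ)) (m : List (ℕ → ℂ)) (h : Hb) :
    tay (v :: l) m (algebraMap Hb SP h) = 0 := by
  rw [Algebra.algebraMap_eq_smul_one, map_smul, tay_cons_left, der_one, map_zero, smul_zero]

theorem tay_algebraMap_cons_right (w : ℕ → ℂ) (l : List (ℕ+ → ℂ)) (m : List (ℕ → ℂ)) (h : Hb) :
    tay l (w :: m) (algebraMap Hb SP h) = 0 := by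
  rw [Algebra.algebraMap_eq_smul_one, map_smul, tay_cons_right, oder_one, map_zero, smul_zero]

theorem tay_nil_nil (a : SP) : tay [] [] a = aug a := rfl

namespace LocalSuperSpectralCurve

variable (C : LocalSuperSpectralCurve)

/-! ### Taylor coefficients of the linear symbols -/

theorem exists_eq_natCast_or_neg (p : ℤ) : (∃ N : ℕ, p = N) ∨ p < 0 := by
  rcases lt_or_ge p 0 with h | h
  · exact Or.inr h
  · exact Or.inl ⟨p.toNat, by omega⟩

theorem mB_nat (N : ℕ) : C.mB N =
    algebraMap Hb SP (cst (C.τ N.succPNat)) + cst ((N : ℂ) + 1) • xv N.succPNat := rfl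

theorem mF_nat (N : ℕ) : C.mF N = tv (N + 1) + cst (C.ψ 0 (N + 1) / 2) • tv 0 := rfl

theorem mF_neg_one : C.mF (-1) = cst (1 / 2) • tv 0 := rfl

theorem der_algebraMap (v : ℕ+ → ℂ) (h : Hb) : der v (algebraMap Hb SP h) = 0 := by
  rw [Algebra.algebraMap_eq_smul_one, map_smul, der_one, smul_zero]

theorem oder_algebraMap (v : ℕ → ℂ) (h : Hb) : oder v (algebraMap Hb SP h) = 0 := by
  rw [Algebra.algebraMap_eq_smul_one, map_smul, oder_one, smul_zero]

theorem oder_mB (w : ℕ → ℂ) (p : ℤ) : oder w (C.mB p) = 0 := by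
  obtain ⟨N, rfl⟩ | hp := exists_eq_natCast_or_neg p
  · rw [mB_nat, map_add, oder_algebraMap, map_smul, oder_xv, smul_zero, add_zero]
  · rw [C.mB_neg hp, map_zero]

theorem der_mB_nat (v : ℕ+ → ℂ) (N : ℕ) :
    der v (C.mB N) = algebraMap Hb SP (cst (((N : ℂ) + 1) * v N.succPNat)) := by
  rw [mB_nat, map_add, der_algebraMap, map_smul, der_xv, zero_add, cst_mul, map_mul,
    Algebra.smul_def]

theorem der_mF (v : ℕ+ → ℂ) (p : ℤ) : der v (C.mF p) = 0 := by
  rcases lt_trichotomy p (-1) with h | rfl | h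
  · rw [C.mF_neg h, map_zero]
  · rw [mF_neg_one, map_smul, der_tv, smul_zero]
  · obtain ⟨N, rfl⟩ : ∃ N : ℕ, p = N := ⟨p.toNat, by omega⟩
    rw [mF_nat, map_add, der_tv, map_smul, der_tv, smul_zero, add_zero]

theorem oder_mF_nat (w : ℕ → ℂ) (N : ℕ) :
    oder w (C.mF N) = algebraMap Hb SP (cst (w (N + 1) + C.ψ 0 (N + 1) / 2 * w 0)) := by
  rw [mF_nat, map_add, oder_tv, map_smul, oder_tv, cst_add, cst_mul, map_add, map_mul,
    Algebra.smul_def]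

theorem oder_mF_neg_one (w : ℕ → ℂ) :
    oder w (C.mF (-1)) = algebraMap Hb SP (cst (1 / 2 * w 0)) := by
  rw [mF_neg_one, map_smul, oder_tv, cst_mul, map_mul, Algebra.smul_def]

theorem exists_der_mB (v : ℕ+ → ℂ) (p : ℤ) : ∃ c, der v (C.mB p) = algebraMap Hb SP (cst c) := by
  obtain ⟨N, rfl⟩ | hp := exists_eq_natCast_or_neg p
  · exact ⟨_, C.der_mB_nat v N⟩
  · exact ⟨0, by rw [C.mB_neg hp, map_zero, cst_zero, map_zero]⟩

theorem exists_aug_mB (p : ℤ) : ∃ c, aug (C.mB p) = cst c := by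
  obtain ⟨N, rfl⟩ | hp := exists_eq_natCast_or_neg p
  · refine ⟨C.τ N.succPNat, ?_⟩
    rw [mB_nat, map_add, map_smul, aug_xv, smul_zero, add_zero, AlgHom.commutes]
    rfl
  · exact ⟨0, by rw [C.mB_neg hp, map_zero, cst_zero]⟩

theorem exists_oder_mF (w : ℕ → ℂ) (p : ℤ) : ∃ c, oder w (C.mF p) = algebraMap Hb SP (cst c) := by
  rcases lt_trichotomy p (-1) with h | rfl | h
  · exact ⟨0, by rw [C.mF_neg h, map_zero, cst_zero, map_zero]⟩
  · exact ⟨_, C.oder_mF_neg_one w⟩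
  · obtain ⟨N, rfl⟩ : ∃ N : ℕ, p = N := ⟨p.toNat, by omega⟩
    exact ⟨_, C.oder_mF_nat w N⟩

theorem aug_mF (p : ℤ) : aug (C.mF p) = 0 := by
  rcases lt_trichotomy p (-1) with h | rfl | h
  · rw [C.mF_neg h, map_zero]
  · rw [mF_neg_one, map_smul, aug_tv, smul_zero]
  · obtain ⟨N, rfl⟩ : ∃ N : ℕ, p = N := ⟨p.toNat, by omega⟩
    rw [mF_nat, map_add, aug_tv, map_smul, aug_tv, smul_zero, add_zero]

/-- The multiplication part is affine in `x` and free of `θ` and `ħ`. Counting fermionic slots twice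
makes the bound also cover a single odd derivative. -/
theorem exists_tay_mB (l : List (ℕ+ → ℂ)) (m : List (ℕ → ℂ)) (p : ℤ) :
    ∃ c, tay l m (C.mB p) = cst c ∧ (2 ≤ l.length + m.length + m.length → c = 0) := by
  match l, m with
  | [], [] =>
    obtain ⟨c, hc⟩ := C.exists_aug_mB p
    exact ⟨c, hc, by simp⟩
  | l, w :: m => exact ⟨0, by rw [tay_cons_right, oder_mB, map_zero, cst_zero], fun _ => rfl⟩
  | [v], [] =>
    obtain ⟨c, hc⟩ := C.exists_der_mB v p
    refine ⟨c, ?_, by simp⟩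
    rw [tay_cons_left, hc, tay_nil_nil, AlgHom.commutes]
    rfl
  | v :: v' :: l, [] =>
    obtain ⟨c, hc⟩ := C.exists_der_mB v p
    exact ⟨0, by rw [tay_cons_left, hc, tay_algebraMap_cons_left, cst_zero], fun _ => rfl⟩

theorem exists_tay_mF (l : List (ℕ+ → ℂ)) (m : List (ℕ → ℂ)) (p : ℤ) :
    ∃ c, tay l m (C.mF p) = cst c ∧ (l.length ≠ 0 ∨ m.length ≠ 1 → c = 0) := by
  match l, m with
  | [], [] => exact ⟨0, by rw [tay_nil_nil, aug_mF, cst_zero], fun _ => rfl⟩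
  | v :: l, m => exact ⟨0, by rw [tay_cons_left, der_mF, map_zero, cst_zero], fun _ => rfl⟩
  | [], [w] =>
    obtain ⟨c, hc⟩ := C.exists_oder_mF w p
    refine ⟨c, ?_, by simp⟩
    rw [tay_cons_right, hc, tay_nil_nil, AlgHom.commutes]
    rfl
  | [], w :: w' :: m =>
    obtain ⟨c, hc⟩ := C.exists_oder_mF w p
    exact ⟨0, by rw [tay_cons_right, hc, tay_algebraMap_cons_right, cst_zero], fun _ => rfl⟩

/-- The Taylor coefficient in the directions given by the exponents `α` and `β`. -/
def jet {n k : ℕ} (α : Fin n → ℤ) (β : Fin k → ℤ) : SP →ₗ[Hb] Hb :=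
  tay (List.ofFn fun i => C.cB (α i)) (List.ofFn fun j => C.cF (β j))

theorem hcoef_jet_hb_der {n k : ℕ} (α : Fin n → ℤ) (β : Fin k → ℤ) (v : ℕ+ → ℂ) (f : SP) (q : ℤ) :
    hcoef q (C.jet α β (hb 1 • der v f)) = hcoef (q - 1)
      (tay (List.ofFn (Fin.cons v fun i => C.cB (α i))) (List.ofFn fun j => C.cF (β j)) f) := by
  rw [map_smul, smul_eq_mul, hcoef_hb_mul, jet, List.ofFn_cons, tay_cons_left]

theorem hcoef_jet_hb_oder {n k : ℕ} (α : Fin n → ℤ) (β : Fin k → ℤ) (v : ℕ → ℂ) (f : SP) (q : ℤ) :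
    hcoef q (C.jet α β (hb 1 • oder v f)) = hcoef (q - 1)
      (tay (List.ofFn fun i => C.cB (α i)) (List.ofFn (Fin.cons v fun j => C.cF (β j))) f) := by
  rw [map_smul, smul_eq_mul, hcoef_hb_mul, jet, List.ofFn_cons, tay_cons_right]

variable {C} {ω : C.Correlators}

theorem corrB_stable {g n k : ℕ} (h : 2 < 2 * g + (n + 1) + k) (α : Fin n → ℤ) (β : Fin k → ℤ) :
    C.corrB ω g n k α β = C.evalT (Matrix.vecCons LinearMap.id fun i => coeffAt (α i))
      (fun j => coeffAt (β j)) (ω g (n + 1) k) := by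
  unfold corrB
  split
  · omega
  · omega
  · omega
  · rfl

theorem corrF_stable {g n k : ℕ} (h : 2 < 2 * g + n + (k + 1)) (α : Fin n → ℤ) (β : Fin k → ℤ) :
    C.corrF ω g n k α β = C.evalT (fun i => coeffAt (α i))
      (Matrix.vecCons LinearMap.id fun j => coeffAt (β j)) (ω g n (k + 1)) := by
  unfold corrF
  split
  · omega
  · omega
  · omega
  · rfl

/-- The unstable two-point function is the derivative of `∑ l x^l z^{l-1}` in the direction of the
`b`-th basis coefficients: the double pole gives the singular parts of the `dξ_{-l}`, and `φ` their
regular parts. -/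
theorem coeff_omega02 (b : ℤ) (N : ℕ) :
    (C.omega02 b).coeff N = ((N : ℂ) + 1) * C.cB b N.succPNat := by
  have hN : ((N : ℂ) + 1) ≠ 0 := Nat.cast_add_one_ne_zero N
  rw [omega02, coeff_ofCoeffs_nat]
  obtain ⟨b, rfl⟩ | hb := exists_eq_natCast_or_neg b
  · rw [cB_nat, if_neg (by omega), if_pos (by omega), zero_add, Int.toNat_natCast, C.φ_symm]
    rw [C.φ_symm]
    simp only [Nat.succPNat_coe, Nat.cast_succ]
    field_simp
  · obtain ⟨b, rfl⟩ : ∃ n : ℕ, b = -(n : ℤ) - 1 := ⟨(-b - 1).toNat, by omega⟩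
    rw [cB_neg, if_neg (by omega : ¬ (0 : ℤ) ≤ -(b : ℤ) - 1), add_zero]
    by_cases h : N.succ = b
    · rw [if_pos (by omega), if_pos (by simpa using h), mul_one]
    · rw [if_neg (by omega), if_neg (by simpa using h), mul_zero]

theorem coeff_omega002_neg {b p : ℤ} (hp : p < -1) : (C.omega002 b).coeff p = 0 := by
  rw [omega002, coeff_single_neg_one_mul, coeff_ofCoeffs_neg _ (by omega)]

theorem psi_eq (k l : ℕ) : C.ψ k l = -C.ψ l k - C.ψ 0 k * C.ψ 0 l := by
  linear_combination C.ψ_rel k l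

/-- Fermionic counterpart, for the multiplication part with its zero-mode tail `(θ^0/2) η_0`. The
halved weights of `ω_{0,0|2}` at `kl = 0` and the relation on `ψ` are what make the formula uniform
in `b`. -/
theorem coeff_omega002 (b : ℤ) (l : ℕ) : (C.omega002 b).coeff ((l : ℤ) - 1) =
    if l = 0 then 1 / 2 * C.cF b 0 else C.cF b l + C.ψ 0 l / 2 * C.cF b 0 := by
  rw [omega002, coeff_single_neg_one_mul, sub_add_cancel, coeff_ofCoeffs_nat]
  have h0 (j : ℕ) : C.ψ j 0 = -C.ψ 0 j := by rw [psi_eq, C.ψ_zero]; ring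
  rcases lt_trichotomy b (-1) with hb | rfl | hb
  · obtain ⟨b, rfl⟩ : ∃ n : ℕ, b = -((n : ℤ) + 1) - 1 := ⟨(-b - 2).toNat, by omega⟩
    rw [cF_neg, cF_neg, if_neg (by omega : ¬ (-1 : ℤ) ≤ -((b : ℤ) + 1) - 1), add_zero,
      if_neg (by omega : ¬ 0 = b + 1), mul_zero, mul_zero, add_zero]
    by_cases h : l = b + 1
    · rw [if_pos (by omega), if_neg (by omega), if_neg (by omega), if_pos h]
    · rw [if_neg (by omega), if_neg h]
      split_ifs <;> rfl
  · rw [if_pos le_rfl, cF_neg_one, cF_neg_one, if_pos rfl, C.ψ_zero, omega002Reg]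
    by_cases h : l = 0
    · subst h
      simp [C.ψ_zero]
    · rw [if_neg (by omega), if_neg h, if_neg h]
      simp [h0]
      ring
  · obtain ⟨b, rfl⟩ : ∃ n : ℕ, b = n := ⟨b.toNat, by omega⟩
    rw [if_neg (by omega), if_pos (by omega), cF_nat, cF_nat, omega002Reg]
    have hb1 : ((b : ℤ) + 1).toNat = b + 1 := by omega
    rw [hb1]
    by_cases h : l = 0
    · subst h
      simp [h0]
      ring
    · rw [if_neg h, if_neg (by simp [h]), psi_eq (b + 1) l]
      ring

/-- Stable and unstable data come from disjoint parts of the symbol. In the stable range the affine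
multiplication part contributes nothing at `ħ^g`; in the unstable range the coefficients of `F`
vanish, and the affine part reproduces `ω_{0,1|0}` and `ω_{0,2|0}`. -/
theorem hcoef_jet_sB (hs : C.IsSuperSymmetric ω) {W g n k : ℕ} (hg : g < W) (hn : n + 1 < W)
    (hk : k < W) (α : Fin n → ℤ) (β : Fin k → ℤ) (p : ℤ) :
    hcoef g (C.jet α β (C.sB (fT (C.coeffsOf ω) W) p)) = (C.corrB ω g n k α β).coeff p := by
  rw [sB, map_add, map_add, hcoef_jet_hb_der, hcoef_tay_fT (isSuperSymm_coeffsOf hs) hg hn hk, jet]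
  by_cases h : 2 < 2 * g + (n + 1) + k
  · rw [corrB_stable h, coeff_evalT_B h]
    obtain ⟨c, hc, hc0⟩ := C.exists_tay_mB (List.ofFn fun i => C.cB (α i))
      (List.ofFn fun j => C.cF (β j)) p
    rw [hc, hcoef_cst]
    have : (if (g : ℤ) = 0 then c else 0) = 0 := by
      split_ifs with h'
      · exact hc0 (by simp only [List.length_ofFn]; omega)
      · rfl
    rw [this, zero_add]
    rfl
  · rw [coeffsOf_unstable (by omega)]
    rw [pairing, Finsupp.sum_zero_index, add_zero]
    obtain rfl : g = 0 := by omega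
    match n, k with
    | 0, 0 =>
      rw [List.ofFn_zero, List.ofFn_zero, tay_nil_nil, corrB, omega01]
      obtain ⟨N, rfl⟩ | hp := exists_eq_natCast_or_neg p
      · rw [mB_nat, map_add, map_smul, aug_xv, smul_zero, add_zero, AlgHom.commutes,
          coeff_ofCoeffs_nat]
        exact (hcoef_cst 0 _).trans (if_pos rfl)
      · rw [C.mB_neg hp, map_zero, map_zero, coeff_ofCoeffs_neg _ hp]
    | 1, 0 =>
      rw [List.ofFn_zero, List.ofFn_succ, List.ofFn_zero, tay_cons_left, tay_nil_nil, corrB]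
      obtain ⟨N, rfl⟩ | hp := exists_eq_natCast_or_neg p
      · rw [der_mB_nat, AlgHom.commutes, coeff_omega02]
        exact (hcoef_cst 0 _).trans (if_pos rfl)
      · rw [C.mB_neg hp, map_zero, map_zero, map_zero, omega02, coeff_ofCoeffs_neg _ hp]
    | 0, 1 =>
      rw [List.ofFn_succ, tay_cons_right, oder_mB, map_zero, map_zero, corrB]
      rfl
    | n + 2, k => omega
    | n, k + 2 => omega
    | 1, 1 => omega

/-- The same separation; the only nonzero unstable value is `ω_{0,0|2}`, the first odd derivative of
the multiplication part. -/
theorem hcoef_jet_sF (hs : C.IsSuperSymmetric ω) {W g n k : ℕ} (hg : g < W) (hn : n < W)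
    (hk : k + 1 < W) (α : Fin n → ℤ) (β : Fin k → ℤ) (p : ℤ) :
    hcoef g (C.jet α β (C.sF (fT (C.coeffsOf ω) W) p)) = (C.corrF ω g n k α β).coeff p := by
  rw [sF, map_add, map_add, hcoef_jet_hb_oder, hcoef_tay_fT (isSuperSymm_coeffsOf hs) hg hn hk, jet]
  by_cases h : 2 < 2 * g + n + (k + 1)
  · rw [corrF_stable h, coeff_evalT_F h]
    obtain ⟨c, hc, hc0⟩ := C.exists_tay_mF (List.ofFn fun i => C.cB (α i))
      (List.ofFn fun j => C.cF (β j)) p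
    rw [hc, hcoef_cst]
    have : (if (g : ℤ) = 0 then c else 0) = 0 := by
      split_ifs with h'
      · exact hc0 (by simp only [List.length_ofFn]; omega)
      · rfl
    rw [this, zero_add]
    rfl
  · rw [coeffsOf_unstable (by omega)]
    rw [pairing, Finsupp.sum_zero_index, add_zero]
    obtain rfl : g = 0 := by omega
    match n, k with
    | 0, 0 =>
      rw [List.ofFn_zero, List.ofFn_zero, tay_nil_nil, corrF, aug_mF, map_zero]
      rfl
    | 1, 0 =>
      rw [List.ofFn_succ, tay_cons_left, der_mF, map_zero, map_zero, corrF]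
      rfl
    | 0, 1 =>
      rw [List.ofFn_zero, List.ofFn_succ, List.ofFn_zero, tay_cons_right, tay_nil_nil, corrF]
      rcases lt_trichotomy p (-1) with hp | rfl | hp
      · rw [C.mF_neg hp, map_zero, map_zero, map_zero, coeff_omega002_neg hp]
      · have := coeff_omega002 (C := C) (β 0) 0
        rw [oder_mF_neg_one, AlgHom.commutes]
        refine ((hcoef_cst 0 _).trans (if_pos rfl)).trans ?_
        simpa using this.symm
      · obtain ⟨N, rfl⟩ : ∃ N : ℕ, p = N := ⟨p.toNat, by omega⟩
        have := coeff_omega002 (C := C) (β 0) (N + 1)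
        rw [oder_mF_nat, AlgHom.commutes]
        refine ((hcoef_cst 0 _).trans (if_pos rfl)).trans ?_
        simpa using this.symm
    | n + 2, k => omega
    | n, k + 2 => omega
    | 1, 1 => omega

theorem hcoef_jet_sB_of_neg (hs : C.IsSuperSymmetric ω) (W : ℕ) {n k : ℕ} (α : Fin n → ℤ) (β : Fin k → ℤ) (p : ℤ) {q : ℤ} (hq : q < 0) :
    hcoef q (C.jet α β (C.sB (fT (C.coeffsOf ω) W) p)) = 0 := by
  rw [sB, map_add, map_add, hcoef_jet_hb_der,
    hcoef_tay_fT_of_lt (isSuperSymm_coeffsOf hs) W (by omega), jet, add_zero]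
  obtain ⟨c, hc, -⟩ := C.exists_tay_mB (List.ofFn fun i => C.cB (α i))
      (List.ofFn fun j => C.cF (β j)) p
  rw [hc, hcoef_cst, if_neg (by omega)]

theorem hcoef_jet_sF_of_neg (hs : C.IsSuperSymmetric ω) (W : ℕ) {n k : ℕ} (α : Fin n → ℤ) (β : Fin k → ℤ) (p : ℤ) {q : ℤ} (hq : q < 0) :
    hcoef q (C.jet α β (C.sF (fT (C.coeffsOf ω) W) p)) = 0 := by
  rw [sF, map_add, map_add, hcoef_jet_hb_oder,
    hcoef_tay_fT_of_lt (isSuperSymm_coeffsOf hs) W (by omega), jet, add_zero]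
  obtain ⟨c, hc, -⟩ := C.exists_tay_mF (List.ofFn fun i => C.cB (α i))
      (List.ofFn fun j => C.cF (β j)) p
  rw [hc, hcoef_cst, if_neg (by omega)]

end LocalSuperSpectralCurve

/-! ### Finite sums over the integers -/

/-- `c` has finite support and sum `x`. -/
def HasFinSum {A : Type*} [AddCommMonoid A] (c : ℤ → A) (x : A) : Prop :=
  c.support.Finite ∧ ∑ᶠ j, c j = x

namespace HasFinSum

variable {A B : Type*} [AddCommMonoid A] [AddCommMonoid B] {c d : ℤ → A} {x y : A}

theorem unique (h : HasFinSum c x) (h' : HasFinSum c y) : x = y := h.2.symm.trans h'.2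

theorem eventually (h : HasFinSum c x) : ∀ᶠ M : ℕ in atTop, ∑ j ∈ zrange M, c j = x := by
  obtain ⟨M0, hM0⟩ : ∃ M0 : ℕ, ∀ j ∈ c.support, j.natAbs ≤ M0 := by
    obtain ⟨M0, h0⟩ := (h.1.image Int.natAbs).bddAbove
    exact ⟨M0, fun j hj => h0 ⟨j, hj, rfl⟩⟩
  filter_upwards [eventually_ge_atTop M0] with M hM
  rw [← h.2, finsum_eq_sum_of_support_subset]
  intro j hj
  have := hM0 j hj
  rw [Finset.mem_coe, mem_zrange]
  omega

theorem of_support {s : Finset ℤ} (h : ∀ j ∉ s, c j = 0) : HasFinSum c (∑ j ∈ s, c j) := by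
  have hs : c.support ⊆ s := fun j hj => by
    by_contra hjs
    exact hj (h j hjs)
  exact ⟨s.finite_toSet.subset hs, finsum_eq_sum_of_support_subset c hs⟩

theorem comp_equiv (h : HasFinSum c x) (e : ℤ ≃ ℤ) : HasFinSum (fun j => c (e j)) x := by
  refine ⟨?_, (finsum_comp_equiv e).trans h.2⟩
  have : Function.support (fun j => c (e j)) = e ⁻¹' c.support := rfl
  rw [this]
  exact h.1.preimage e.injective.injOn

theorem add (h : HasFinSum c x) (h' : HasFinSum d y) : HasFinSum (fun j => c j + d j) (x + y) :=
  ⟨(h.1.union h'.1).subset (Function.support_add c d), by rw [finsum_add_distrib h.1 h'.1, h.2, h'.2]⟩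

theorem map (h : HasFinSum c x) (f : A →+ B) : HasFinSum (fun j => f (c j)) (f x) := by
  refine ⟨h.1.subset fun j hj hc => hj ?_, ?_⟩
  · simp only [hc, map_zero]
  · rw [← h.2, AddMonoidHom.map_finsum f h.1]

theorem zero : HasFinSum (fun _ => (0 : A)) 0 := by simp [HasFinSum]

theorem sum {ι : Type*} {s : Finset ι} {c : ι → ℤ → A} {x : ι → A}
    (h : ∀ i ∈ s, HasFinSum (c i) (x i)) : HasFinSum (fun j => ∑ i ∈ s, c i j) (∑ i ∈ s, x i) := by
  classical
  induction s using Finset.induction_on with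
  | empty => simpa using zero
  | insert i s hi ih =>
    simp only [Finset.sum_insert hi]
    exact (h i (Finset.mem_insert_self i s)).add (ih fun k hk => h k (Finset.mem_insert_of_mem hk))

theorem congr (h : HasFinSum c x) (hc : ∀ j, d j = c j) (hx : y = x) : HasFinSum d y := by
  obtain rfl : d = c := funext hc
  rwa [hx]

theorem const_mul {c : ℤ → ℂ} {x : ℂ} (h : HasFinSum c x) (z : ℂ) :
    HasFinSum (fun j => z * c j) (z * x) := h.map (AddMonoidHom.mulLeft z)

end HasFinSum

theorem hasFinSum_coeff_mul (x y : LS) (N : ℤ) :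
    HasFinSum (fun p => x.coeff p * y.coeff (N - p)) ((x * y).coeff N) := by
  classical
  let T := Finset.antidiagonal x.isPWO_support y.isPWO_support N
  have h : ∀ p ∉ T.image Prod.fst, x.coeff p * y.coeff (N - p) = 0 := by
    intro p hp
    by_contra h0
    refine hp (Finset.mem_image.mpr ⟨(p, N - p), ?_, rfl⟩)
    exact Finset.mem_antidiagonal.mpr ⟨left_ne_zero_of_mul h0, right_ne_zero_of_mul h0, by simp⟩
  refine (HasFinSum.of_support h).congr (fun _ => rfl) ?_
  rw [HahnSeries.coeff_mul, Finset.sum_image]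
  · refine Finset.sum_congr rfl fun p hp => ?_
    rw [← (Finset.mem_antidiagonal.mp hp).2.2, add_sub_cancel_left]
  · intro p hp q hq hpq
    refine Prod.ext hpq ?_
    have h1 := (Finset.mem_antidiagonal.mp hp).2.2
    have h2 := (Finset.mem_antidiagonal.mp hq).2.2
    omega

theorem coeff_zsmul (z : ℤ) (f : LS) (p : ℤ) : (z • f).coeff p = z * f.coeff p := by
  have := map_zsmul (HahnSeries.coeff.linearMap (R := ℂ) (V := ℂ) p) z f
  exact this.trans (zsmul_eq_mul _ _)

/-! ### Products of elements without negative powers of `ħ` -/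

theorem hcoef_eq_sum (x : Hb) : ∃ s : Finset ℤ, (∀ p ∉ s, hcoef p x = 0) ∧
    x = ∑ p ∈ s, cst (hcoef p x) * hb p := by
  obtain ⟨s, hs⟩ := hb_eq_sum x
  refine ⟨s, fun p hp => ?_, hs⟩
  rw [hs, map_sum]
  refine Finset.sum_eq_zero fun q hq => ?_
  rw [hcoef_cst_mul_hb, if_neg]
  rintro rfl
  exact hp hq

/-- Without negative powers the Cauchy product in `ħ` runs over `g₁ + g₂ = g` in the natural
numbers, which is the genus splitting. -/
theorem hcoef_mul {x y : Hb} (hx : ∀ q < 0, hcoef q x = 0) (hy : ∀ q < 0, hcoef q y = 0) (g : ℕ) :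
    hcoef g (x * y) =
      ∑ h ∈ Finset.HasAntidiagonal.antidiagonal g, hcoef (h.1 : ℤ) x * hcoef (h.2 : ℤ) y := by
  obtain ⟨s, hs, hsum⟩ := hcoef_eq_sum x
  have h1 : hcoef g (x * y) = ∑ p ∈ s, hcoef p x * hcoef (g - p) y := by
    conv_lhs => rw [hsum]
    rw [Finset.sum_mul, map_sum]
    refine Finset.sum_congr rfl fun p _ => ?_
    rw [mul_assoc, hcoef_cst_mul, hcoef_hb_mul]
  have h2 : HasFinSum (fun p : ℤ => hcoef p x * hcoef (g - p) y)
      (∑ p ∈ s, hcoef p x * hcoef (g - p) y) :=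
    HasFinSum.of_support fun p hp => by rw [hs p hp, zero_mul]
  have h3 : HasFinSum (fun p : ℤ => hcoef p x * hcoef (g - p) y)
      (∑ p ∈ (Finset.range (g + 1)).map Nat.castEmbedding, hcoef p x * hcoef (g - p) y) := by
    refine HasFinSum.of_support fun p hp => ?_
    rcases lt_or_ge p 0 with h | h
    · rw [hx p h, zero_mul]
    · rw [hy, mul_zero]
      by_contra hlt
      refine hp (Finset.mem_map.mpr ⟨p.toNat, Finset.mem_range.mpr (by omega), ?_⟩)
      change ((p.toNat : ℕ) : ℤ) = p
      omega
  rw [h1, h2.unique h3, Finset.sum_map, Finset.Nat.sum_antidiagonal_eq_sum_range_succ_mk]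
  refine Finset.sum_congr rfl fun p hp => ?_
  rw [Finset.mem_range] at hp
  change hcoef (p : ℤ) x * hcoef (g - (p : ℤ)) y = hcoef (p : ℤ) x * hcoef ((g - p : ℕ) : ℤ) y
  rw [Nat.cast_sub (by omega)]

theorem hcoef_mul_of_neg {x y : Hb} (hx : ∀ q < 0, hcoef q x = 0) (hy : ∀ q < 0, hcoef q y = 0)
    {q : ℤ} (hq : q < 0) : hcoef q (x * y) = 0 := by
  obtain ⟨s, hs, hsum⟩ := hcoef_eq_sum x
  rw [hsum, Finset.sum_mul, map_sum]
  refine Finset.sum_eq_zero fun p _ => ?_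
  rw [mul_assoc, hcoef_cst_mul, hcoef_hb_mul]
  rcases lt_or_ge p 0 with h | h
  · rw [hx p h, zero_mul]
  · rw [hy _ (by omega), mul_zero]

namespace LocalSuperSpectralCurve

variable (C : LocalSuperSpectralCurve)

/-! ### Splitting sums as Taylor coefficients of products -/

/-- The coefficients of the series `A g n k α β` are Taylor coefficients of the elements `a p`, as
far as the truncation order `W` permits. -/
structure Represents (W : ℕ) (A : (g n k : ℕ) → (Fin n → ℤ) → (Fin k → ℤ) → LS)
    (a : ℤ → SP) : Prop where
  coeff_eq : ∀ {g n k : ℕ}, g < W → n + 1 < W → k + 1 < W → ∀ (α : Fin n → ℤ) (β : Fin k → ℤ) (p : ℤ),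
    hcoef g (C.jet α β (a p)) = (A g n k α β).coeff p
  neg_eq : ∀ {n k : ℕ} (α : Fin n → ℤ) (β : Fin k → ℤ) (p q : ℤ), q < 0 →
    hcoef q (C.jet α β (a p)) = 0

theorem jet_mul {n k : ℕ} (α : Fin n → ℤ) (β : Fin k → ℤ) (a b : SP) :
    C.jet α β (a * b) = ∑ S : Finset (Fin n), ∑ R : Finset (Fin k),
      shuffleSign R • (C.jet (restr α S) (restr β R) a * C.jet (restr α Sᶜ) (restr β Rᶜ) b) := by
  rw [jet, tay_mul]
  simp only [sublist_eq_ofFn]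
  rfl

variable {C} {W : ℕ} {A B : (g n k : ℕ) → (Fin n → ℤ) → (Fin k → ℤ) → LS} {a b : ℤ → SP}

theorem card_fin_lt {n m : ℕ} (h : n + 1 < m) (S : Finset (Fin n)) : S.card + 1 < m := by
  have := S.card_le_univ
  rw [Fintype.card_fin] at this
  omega

/-- The splitting sum combines three Cauchy products: in `ħ` over the genus, in the Taylor variables
over subsets with shuffle sign, and in `z` over `p + (N - p)`. -/
theorem Represents.hasFinSum (hA : C.Represents W A a) (hB : C.Represents W B b) {g n k : ℕ}
    (hg : g < W) (hn : n + 1 < W) (hk : k + 1 < W) (α : Fin n → ℤ) (β : Fin k → ℤ) (N : ℤ) :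
    HasFinSum (fun p => hcoef g (C.jet α β (a p * b (N - p))))
      ((splitSum A B g n k α β).coeff N) := by
  have h1 (p : ℤ) : hcoef g (C.jet α β (a p * b (N - p))) =
      ∑ h ∈ Finset.HasAntidiagonal.antidiagonal g, ∑ S : Finset (Fin n), ∑ R : Finset (Fin k),
        (shuffleSign R : ℂ) * ((A h.1 S.card R.card (restr α S) (restr β R)).coeff p *
          (B h.2 Sᶜ.card Rᶜ.card (restr α Sᶜ) (restr β Rᶜ)).coeff (N - p)) := by
    rw [jet_mul, map_sum, Finset.sum_comm]
    refine Finset.sum_congr rfl fun S _ => ?_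
    rw [map_sum, Finset.sum_comm]
    refine Finset.sum_congr rfl fun R _ => ?_
    rw [map_zsmul, hcoef_mul (fun q hq => hA.neg_eq _ _ _ _ hq)
      (fun q hq => hB.neg_eq _ _ _ _ hq), zsmul_eq_mul,
      Finset.mul_sum]
    refine Finset.sum_congr rfl fun h hh => ?_
    have hh' := Finset.HasAntidiagonal.mem_antidiagonal.mp hh
    rw [hA.coeff_eq (by omega) (card_fin_lt hn S) (card_fin_lt hk R),
      hB.coeff_eq (by omega) (card_fin_lt hn Sᶜ) (card_fin_lt hk Rᶜ)]
  have h2 : (splitSum A B g n k α β).coeff N =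
      ∑ h ∈ Finset.HasAntidiagonal.antidiagonal g, ∑ S : Finset (Fin n), ∑ R : Finset (Fin k),
        (shuffleSign R : ℂ) * ((A h.1 S.card R.card (restr α S) (restr β R)) *
          (B h.2 Sᶜ.card Rᶜ.card (restr α Sᶜ) (restr β Rᶜ))).coeff N := by
    rw [splitSum]
    simp only [HahnSeries.coeff_sum, coeff_zsmul]
  refine HasFinSum.congr (HasFinSum.sum fun h _ => HasFinSum.sum fun S _ => HasFinSum.sum fun R _ =>
    (hasFinSum_coeff_mul _ _ N).const_mul _) h1 h2

theorem Represents.mul_neg (hA : C.Represents W A a) (hB : C.Represents W B b) {n k : ℕ}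
    (α : Fin n → ℤ) (β : Fin k → ℤ) (p p' : ℤ) {q : ℤ}
    (hq : q < 0) : hcoef q (C.jet α β (a p * b p')) = 0 := by
  rw [jet_mul, map_sum]
  refine Finset.sum_eq_zero fun S _ => ?_
  rw [map_sum]
  refine Finset.sum_eq_zero fun R _ => ?_
  rw [map_zsmul, hcoef_mul_of_neg
    (fun q hq => hA.neg_eq _ _ _ _ hq)
    (fun q hq => hB.neg_eq _ _ _ _ hq) hq, smul_zero]

/-- Reweighting and shifting of a representation. -/
theorem Represents.smul_shift (hA : C.Represents W A a) (T : LS → LS) (c : ℤ → ℂ) (s : ℤ)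
    (hT : ∀ f p, (T f).coeff p = c p * f.coeff (p + s)) :
    C.Represents W (fun g n k α β => T (A g n k α β)) fun p => cst (c p) • a (p + s) where
  coeff_eq hg hn hk α β p := by
    rw [map_smul, smul_eq_mul, hcoef_cst_mul, hA.coeff_eq hg hn hk, hT]
  neg_eq α β p q hq := by
    rw [map_smul, smul_eq_mul, hcoef_cst_mul, hA.neg_eq _ _ _ _ hq, mul_zero]

theorem coeff_sigmaF (f : LS) (p : ℤ) : (sigmaF f).coeff p = (-1) ^ p * f.coeff p := rfl

theorem coeff_sigmaB (f : LS) (p : ℤ) : (sigmaB f).coeff p = -(-1) ^ p * f.coeff p := by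
  rw [neg_mul]
  rfl

theorem coeff_deriv (f : LS) (p : ℤ) : (deriv f).coeff p = ((p : ℂ) + 1) * f.coeff (p + 1) := by
  have := LaurentSeries.derivative_iterate_coeff (R := ℂ) 1 f p
  rw [Function.iterate_one] at this
  rw [deriv, this]
  simp [descPochhammer_one]

variable {ω : C.Correlators}

theorem represents_corrB (hs : C.IsSuperSymmetric ω) (W : ℕ) :
    C.Represents W (C.corrB ω) (C.sB (fT (C.coeffsOf ω) W)) where
  coeff_eq hg hn hk α β p := hcoef_jet_sB hs hg hn (by omega) α β p
  neg_eq α β p _ hq := hcoef_jet_sB_of_neg hs W α β p hq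

theorem represents_corrF (hs : C.IsSuperSymmetric ω) (W : ℕ) :
    C.Represents W (C.corrF ω) (C.sF (fT (C.coeffsOf ω) W)) where
  coeff_eq hg hn hk α β p := hcoef_jet_sF hs hg (by omega) hk α β p
  neg_eq α β p _ hq := hcoef_jet_sF_of_neg hs W α β p hq

end LocalSuperSpectralCurve

namespace LocalSuperSpectralCurve

variable (C : LocalSuperSpectralCurve)

/-! ### Quadratic symbols without contractions -/

/-- The symbol of `:J_{-p-1} J_{-q-1}:`, conjugated by `Φ`, up to a constant. -/
def qBB (f : SP) (p q : ℤ) : SP := C.sB f p * C.sB f q + hb 2 • der (C.cB p) (der (C.cB q) f)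

/-- The symbol of `:Γ_{-p-1} Γ_{-q-1}:`, conjugated by `Φ`, up to a constant. -/
def qFF (f : SP) (p q : ℤ) : SP := C.sF f p * C.sF f q + hb 2 • oder (C.cF p) (oder (C.cF q) f)

theorem hb_one_smul_hb_one_smul (a : SP) : hb 1 • hb 1 • a = hb 2 • a := by
  rw [smul_smul, ← hb_add]
  norm_num

/-- Moving a derivative past the multiplication part of the second mode gives a scalar contraction.
The remainder is symmetric in the two modes, so normal ordering affects only scalars. -/
theorem sBB_eq (f : SP) (p q : ℤ) :
    C.sBB f p q = C.qBB f p q + hb 1 • der (C.cB p) (C.mB q) := by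
  rw [sBB, qBB]
  conv_lhs => rw [sB.eq_def C f q, map_add, map_smul, smul_add, hb_one_smul_hb_one_smul]
  rw [← sB]
  abel

theorem sFF_eq (f : SP) (p q : ℤ) :
    C.sFF f p q = C.qFF f p q + hb 1 • oder (C.cF p) (C.mF q) := by
  rw [sFF, qFF]
  conv_lhs => rw [sF.eq_def C f q, map_add, map_smul, smul_add, hb_one_smul_hb_one_smul]
  rw [← sF]
  abel

theorem sBF_eq (f : SP) (p q : ℤ) :
    C.sBF f p q = C.sB f p * C.sF f q + hb 2 • der (C.cB p) (oder (C.cF q) f) := by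
  rw [sBF]
  conv_lhs => rw [sF.eq_def C f q, map_add, map_smul, smul_add, hb_one_smul_hb_one_smul, der_mF,
    smul_zero, zero_add]
  rw [← sF]

variable {f : SP}

theorem qBB_comm (hf : par f = f) (p q : ℤ) : C.qBB f p q = C.qBB f q p := by
  rw [qBB, qBB, comm_of_par_eq (C.par_sB hf p), der_comm]

theorem qFF_anticomm (hf : par f = f) (p q : ℤ) : C.qFF f p q = -C.qFF f q p := by
  rw [qFF, qFF, anticomm_of_par_eq_neg (C.par_sF hf p) (C.par_sF hf q), oder_anticomm, smul_neg,
    neg_add]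

theorem exists_sB_eq_zero (f : SP) :
    ∃ P : ℕ, ∀ q : ℤ, q < -P → C.sB f q = 0 ∧ der (C.cB q) f = 0 := by
  obtain ⟨M, hM⟩ := (eventually_der_eq_zero f).exists
  refine ⟨M + 3, fun q hq => ?_⟩
  have h : der (C.cB q) f = 0 := by
    refine hM _ fun i hi => ?_
    obtain ⟨n, rfl⟩ : ∃ n : ℕ, q = -(n : ℤ) - 1 := ⟨(-q - 1).toNat, by omega⟩
    rw [mem_pnats] at hi
    rw [cB_neg, if_neg (by omega)]
  exact ⟨by rw [sB, h, C.mB_neg (by omega), smul_zero, add_zero], h⟩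

theorem exists_sF_eq_zero (f : SP) :
    ∃ P : ℕ, ∀ q : ℤ, q < -P → C.sF f q = 0 ∧ oder (C.cF q) f = 0 := by
  obtain ⟨M, hM⟩ := (eventually_oder_eq_zero f).exists
  -- Exponents this negative select a pole belonging to a Grassmann variable beyond those in `f`,
  -- and lie below the zero-mode exponent `-1`.
  refine ⟨M + 3, fun q hq => ?_⟩
  have h : oder (C.cF q) f = 0 := by
    refine hM _ fun i hi => ?_
    obtain ⟨n, rfl⟩ : ∃ n : ℕ, q = -((n : ℤ) + 1) - 1 := ⟨(-q - 2).toNat, by omega⟩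
    rw [cF_neg, if_neg (by omega)]
  exact ⟨by rw [sF, h, C.mF_neg (by omega), smul_zero, add_zero], h⟩

theorem finite_support_of_lt {A : Type*} [Zero A] {c : ℤ → ℤ → A} {P : ℕ}
    (h1 : ∀ p q, p < -(P : ℤ) → c p q = 0) (h2 : ∀ p q, q < -(P : ℤ) → c p q = 0) (N : ℤ) :
    (Function.support fun p => c p (N - p)).Finite := by
  refine (Set.finite_Icc (-(P : ℤ)) (N + P)).subset fun p hp => ?_
  by_contra h
  rw [Set.mem_Icc, not_and_or] at h
  rcases h with h | h
  · exact hp (h1 _ _ (by omega))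
  · exact hp (h2 _ _ (by omega))

theorem finite_support_qBB (hf : par f = f) (N : ℤ) :
    (Function.support fun p => C.qBB f p (N - p)).Finite := by
  obtain ⟨P, hP⟩ := C.exists_sB_eq_zero f
  have h2 (p q : ℤ) (hq : q < -(P : ℤ)) : C.qBB f p q = 0 := by
    rw [qBB, (hP q hq).1, (hP q hq).2, mul_zero, map_zero, smul_zero, add_zero]
  exact finite_support_of_lt (c := C.qBB f) (fun p q hp => by rw [C.qBB_comm hf, h2 q p hp]) h2 N

theorem finite_support_qFF (hf : par f = f) (N : ℤ) :
    (Function.support fun p => C.qFF f p (N - p)).Finite := by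
  obtain ⟨P, hP⟩ := C.exists_sF_eq_zero f
  have h2 (p q : ℤ) (hq : q < -(P : ℤ)) : C.qFF f p q = 0 := by
    rw [qFF, (hP q hq).1, (hP q hq).2, mul_zero, map_zero, smul_zero, add_zero]
  exact finite_support_of_lt (c := C.qFF f)
    (fun p q hp => by rw [C.qFF_anticomm hf, h2 q p hp, neg_zero]) h2 N

/-- The mixed second derivatives commute, so the bound for either mode kills its whole summand; no
symmetry between the modes is needed. -/
theorem finite_support_sBF (f : SP) (N : ℤ) :
    (Function.support fun p => C.sBF f p (N - p)).Finite := by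
  obtain ⟨P, hP⟩ := C.exists_sB_eq_zero f
  obtain ⟨P', hP'⟩ := C.exists_sF_eq_zero f
  refine finite_support_of_lt (c := C.sBF f) (P := P + P') (fun p q h => ?_) (fun p q h => ?_) N
  · rw [sBF_eq, (hP p (by omega)).1, der_oder, (hP p (by omega)).2, zero_mul, map_zero, smul_zero,
      add_zero]
  · rw [sBF_eq, (hP' q (by omega)).1, (hP' q (by omega)).2, mul_zero, map_zero, smul_zero, add_zero]

theorem nBB_eq (hf : par f = f) (a b : ℤ) : C.nBB f a b = C.qBB f (-a - 1) (-b - 1) +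
    hb 1 • (if a ≤ b then der (C.cB (-a - 1)) (C.mB (-b - 1)) else
      der (C.cB (-b - 1)) (C.mB (-a - 1))) := by
  rw [nBB]
  split_ifs
  · rw [sBB_eq]
  · rw [sBB_eq, C.qBB_comm hf]

theorem nFF_eq (hf : par f = f) (a b : ℤ) : C.nFF f a b = C.qFF f (-a - 1) (-b - 1) +
    hb 1 • (if a ≤ b then oder (C.cF (-a - 1)) (C.mF (-b - 1)) else
      -oder (C.cF (-b - 1)) (C.mF (-a - 1))) := by
  rw [nFF]
  split_ifs
  · rw [sFF_eq]
  · rw [sFF_eq, C.qFF_anticomm hf, neg_add, neg_neg, smul_neg]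

/-- In normal order a contraction needs both modes to be raising. For total index at least `-2` this
leaves only `J_{-1} J_{-1}` in `L_{-2}`. -/
theorem contraction_BB {n : ℤ} (hn : -1 ≤ n) (j : ℤ) :
    (if -j ≤ 2 * n + j then der (C.cB (-(-j) - 1)) (C.mB (-(2 * n + j) - 1)) else
      der (C.cB (-(2 * n + j) - 1)) (C.mB (-(-j) - 1))) =
    if j = 1 then (if n = -1 then algebraMap Hb SP (cst (C.φ 1 1)) else 0) else 0 := by
  split_ifs with h1 h2 h3 h3 h4
  · subst h2 h3
    have := C.der_mB_nat (C.cB 0) 0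
    rw [← Nat.cast_zero (R := ℤ), cB_nat] at this
    have h0 : Nat.succPNat 0 = 1 := rfl
    simpa [h0] using this
  · rw [C.mB_neg (by omega), map_zero]
  · rw [C.mB_neg (by omega), map_zero]
  · omega
  · rw [C.mB_neg (by omega), map_zero]
  · rw [C.mB_neg (by omega), map_zero]

/-- The zero mode has a multiplication part as well, so `Γ_{-2}` and `Γ_0` contract in `L_{-2}`, at
`j = 0` and `j = 2`. All other candidates have weight `n + j = 0` or a mode without multiplication
part. -/
theorem contraction_FF {n : ℤ} (hn : -1 ≤ n) (j : ℤ) :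
    cst ((-1) ^ j * (n + j)) • (if -j ≤ j + 2 * n then
      oder (C.cF (-(-j) - 1)) (C.mF (-(j + 2 * n) - 1)) else
      -oder (C.cF (-(j + 2 * n) - 1)) (C.mF (-(-j) - 1))) =
    (if j = 0 then (if n = -1 then algebraMap Hb SP (cst (C.ψ 0 2 / 2)) else 0) else 0) +
    if j = 2 then (if n = -1 then algebraMap Hb SP (cst (C.ψ 0 2 / 2)) else 0) else 0 := by
  have h12 : oder (C.cF 1) (C.mF (-1)) = algebraMap Hb SP (cst (C.ψ 0 2 / 2)) := by
    rw [oder_mF_neg_one, ← Nat.cast_one (R := ℤ), cF_nat]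
    congr 2
    ring
  by_cases hj : n + j = 0
  · have : ((n : ℂ) + j) = 0 := by exact_mod_cast hj
    rw [this, mul_zero, cst_zero, zero_smul]
    split_ifs <;> first | rfl | omega
  by_cases h0 : n = -1 ∧ j = 0
  · obtain ⟨rfl, rfl⟩ := h0
    norm_num
    rw [h12, cst_neg, neg_smul, cst_one, one_smul, neg_neg]
  by_cases h2 : n = -1 ∧ j = 2
  · obtain ⟨rfl, rfl⟩ := h2
    norm_num
    exact h12
  have hr : (if j = 0 then (if n = -1 then algebraMap Hb SP (cst (C.ψ 0 2 / 2)) else 0) else 0) +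
    (if j = 2 then (if n = -1 then algebraMap Hb SP (cst (C.ψ 0 2 / 2)) else 0) else 0) = 0 := by
    split_ifs <;> first | omega | simp
  rw [hr]
  split_ifs with h
  · rw [C.mF_neg (by omega), map_zero, smul_zero]
  · rw [C.mF_neg (by omega), map_zero, neg_zero, smul_zero]

/-- The constant produced by normal ordering in the conjugate of `L_{2n}`. -/
def ordConst (n : ℤ) : ℂ :=
  if n = 0 then 1 / 4 else if n = -1 then (C.φ 1 1 + C.ψ 0 2) / 2 else 0

/-- The summands of the symbol of `L_{2n}`. -/
def summandL (n : ℤ) (f : SP) (p : ℤ) : SP :=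
  cst (1 / 2 * (-1) ^ p) • C.qBB f p (-2 * n - 2 - p) +
    cst (-(1 / 2) * ((-1) ^ p * (n + 1 + p))) • C.qFF f p (-2 * n - 2 - p)

theorem symL_eq (hf : par f = f) {n : ℤ} (hn : -1 ≤ n) {M : ℕ} (hM : 2 ≤ M) :
    C.symL n f M = ∑ j ∈ zrange M, C.summandL n f (j - 1) +
      algebraMap Hb SP (cst (C.ordConst n) * hb 1) := by
  have h1 (j : ℤ) : cst ((-1) ^ (j - 1)) • C.nBB f (-j) (2 * n + j) =
      cst ((-1) ^ (j - 1)) • C.qBB f (j - 1) (-2 * n - 2 - (j - 1)) +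
      if j = 1 then hb 1 • (if n = -1 then algebraMap Hb SP (cst (C.φ 1 1)) else 0) else 0 := by
    have e1 : -(-j) - 1 = j - 1 := by ring
    have e2 : -(2 * n + j) - 1 = -2 * n - 2 - (j - 1) := by ring
    rw [C.nBB_eq hf, C.contraction_BB hn, smul_add, e1, e2]
    refine congrArg _ ?_
    by_cases h : j = 1
    · rw [if_pos h, if_pos h, h, sub_self, zpow_zero, cst_one, one_smul]
    · rw [if_neg h, if_neg h, smul_zero, smul_zero]
  have h2 (j : ℤ) : cst ((-1) ^ j * (n + j)) • C.nFF f (-j) (j + 2 * n) =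
      cst ((-1) ^ j * (n + j)) • C.qFF f (j - 1) (-2 * n - 2 - (j - 1)) +
      ((if j = 0 then hb 1 • (if n = -1 then algebraMap Hb SP (cst (C.ψ 0 2 / 2)) else 0) else 0) +
      if j = 2 then hb 1 • (if n = -1 then algebraMap Hb SP (cst (C.ψ 0 2 / 2)) else 0) else 0) := by
    have e1 : -(-j) - 1 = j - 1 := by ring
    have e2 : -(j + 2 * n) - 1 = -2 * n - 2 - (j - 1) := by ring
    rw [C.nFF_eq hf, smul_add, smul_comm, C.contraction_FF hn, smul_add, e1, e2]
    refine congrArg _ ?_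
    rw [smul_ite (j = 0), smul_ite (j = 2), smul_zero]
  -- The contractions sit at `j = 0, 1, 2`; the bound `2 ≤ M` ensures that the truncated sums
  -- contain all of them.
  have m0 : (0 : ℤ) ∈ zrange M := mem_zrange.mpr (by omega)
  have m1 : (1 : ℤ) ∈ zrange M := mem_zrange.mpr (by omega)
  have m2 : (2 : ℤ) ∈ zrange M := mem_zrange.mpr (by omega)
  rw [symL]
  simp only [h1, h2, Finset.sum_add_distrib, Finset.sum_ite_eq', m0, m1, m2, if_true, summandL]
  have h3 (j : ℤ) : cst (1 / 2 * (-1) ^ (j - 1)) • C.qBB f (j - 1) (-2 * n - 2 - (j - 1)) =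
      cst (1 / 2) • cst ((-1) ^ (j - 1)) • C.qBB f (j - 1) (-2 * n - 2 - (j - 1)) := by
    rw [smul_smul, cst_mul]
  have h4 (j : ℤ) : cst (-(1 / 2) * ((-1) ^ (j - 1) * (n + 1 + (j - 1 : ℤ)))) •
      C.qFF f (j - 1) (-2 * n - 2 - (j - 1)) =
      cst (1 / 2) • cst ((-1) ^ j * (n + j)) • C.qFF f (j - 1) (-2 * n - 2 - (j - 1)) := by
    rw [smul_smul, ← cst_mul]
    congr 2
    rw [zpow_sub_one₀ (by norm_num)]
    push_cast
    ring
  simp only [h3, h4, ← Finset.smul_sum, smul_add]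
  have h5 : algebraMap Hb SP (cst (C.ordConst n) * hb 1) =
      cst (1 / 2) • hb 1 • (if n = -1 then algebraMap Hb SP (cst (C.φ 1 1)) else 0) +
      (if n = 0 then cst (1 / 4) * hb 1 else 0) • (1 : SP) +
      (cst (1 / 2) • hb 1 • (if n = -1 then algebraMap Hb SP (cst (C.ψ 0 2 / 2)) else 0) +
      cst (1 / 2) • hb 1 • (if n = -1 then algebraMap Hb SP (cst (C.ψ 0 2 / 2)) else 0)) := by
    rw [ordConst, Algebra.algebraMap_eq_smul_one]
    split_ifs with h h'
    · omega
    · simp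
    · simp only [Algebra.algebraMap_eq_smul_one, zero_smul, add_zero, smul_smul, ← add_smul]
      congr 1
      have : (C.φ 1 1 + C.ψ 0 2) / 2 = 1 / 2 * C.φ 1 1 + (1 / 2 * (C.ψ 0 2 / 2) +
        1 / 2 * (C.ψ 0 2 / 2)) := by ring
      rw [this, cst_add, cst_add, cst_mul, cst_mul]
      ring
    · simp
  rw [h5]
  abel

theorem finite_support_summandL (hf : par f = f) (n : ℤ) :
    (Function.support (C.summandL n f)).Finite := by
  refine ((C.finite_support_qBB hf (-2 * n - 2)).union
    (C.finite_support_qFF hf (-2 * n - 2))).subset fun p hp => ?_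
  by_contra h
  rw [Set.mem_union, not_or, Function.notMem_support, Function.notMem_support] at h
  refine hp ?_
  rw [summandL, h.1, h.2, smul_zero, smul_zero, add_zero]

/-- The summands of the symbol of `G_{2m+1}`. -/
def summandG (m : ℤ) (f : SP) (p : ℤ) : SP := cst ((-1) ^ p) • C.sBF f p (-2 * m - 3 - p)

theorem symG_eq (m : ℤ) (f : SP) (M : ℕ) :
    C.symG m f M = ∑ j ∈ zrange M, C.summandG m f (j - 1) := by
  refine Finset.sum_congr rfl fun j _ => ?_
  rw [summandG]
  congr 2
  ring

theorem finite_support_summandG (m : ℤ) (f : SP) :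
    (Function.support (C.summandG m f)).Finite := by
  refine (C.finite_support_sBF f (-2 * m - 3)).subset fun p hp h => hp ?_
  rw [summandG]
  exact smul_eq_zero_of_right _ h

/-- The truncated symbols stabilize, because only finitely many summands are nonzero. The stable
value is kept abstract together with its finite sum, so that additive functionals can be applied
termwise. -/
theorem eventually_symL_eq (hf : par f = f) {n : ℤ} (hn : -1 ≤ n) : ∃ X : SP,
    HasFinSum (C.summandL n f) X ∧ ∀ᶠ M : ℕ in atTop,
      C.symL n f M = X + algebraMap Hb SP (cst (C.ordConst n) * hb 1) := by
  have h : HasFinSum (C.summandL n f) (∑ᶠ p, C.summandL n f p) :=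
    ⟨C.finite_support_summandL hf n, rfl⟩
  refine ⟨_, h, ?_⟩
  filter_upwards [(h.comp_equiv (Equiv.subRight 1)).eventually, eventually_ge_atTop 2] with M h1 h2
  rw [C.symL_eq hf hn h2, ← h1]
  rfl

theorem eventually_symG_eq (m : ℤ) (f : SP) : ∃ X : SP,
    HasFinSum (C.summandG m f) X ∧ ∀ᶠ M : ℕ in atTop, C.symG m f M = X := by
  have h : HasFinSum (C.summandG m f) (∑ᶠ p, C.summandG m f p) :=
    ⟨C.finite_support_summandG m f, rfl⟩
  refine ⟨_, h, ?_⟩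
  filter_upwards [(h.comp_equiv (Equiv.subRight 1)).eventually] with M h1
  rw [C.symG_eq, ← h1]
  rfl

end LocalSuperSpectralCurve

namespace LocalSuperSpectralCurve

variable {C : LocalSuperSpectralCurve} {ω : C.Correlators}

/-! ### Coefficients of the diagonal terms -/

theorem pairing_scale_BB {n k : ℕ} (c : Coeffs (n + 2) k) (a b : ℂ) (v v' : ℕ+ → ℂ)
    (u : Fin n → ℕ+ → ℂ) (w : Fin k → ℕ → ℂ) :
    pairing c (Fin.cons (fun i => a * v i) (Fin.cons (fun i => b * v' i) u)) w =
      a * b * pairing c (Fin.cons v (Fin.cons v' u)) w := by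
  rw [pairing, pairing, Finsupp.mul_sum]
  refine Finset.sum_congr rfl fun p _ => ?_
  simp only [Fin.prod_univ_succ, Fin.cons_zero, Fin.cons_succ]
  ring

theorem pairing_scale_FF {n k : ℕ} (c : Coeffs n (k + 2)) (a b : ℂ) (v v' : ℕ → ℂ)
    (u : Fin n → ℕ+ → ℂ) (w : Fin k → ℕ → ℂ) :
    pairing c u (Fin.cons (fun i => a * v i) (Fin.cons (fun i => b * v' i) w)) =
      a * b * pairing c u (Fin.cons v (Fin.cons v' w)) := by
  rw [pairing, pairing, Finsupp.mul_sum]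
  refine Finset.sum_congr rfl fun p _ => ?_
  simp only [Fin.prod_univ_succ, Fin.cons_zero, Fin.cons_succ]
  ring

theorem pairing_scale_F {n k : ℕ} (c : Coeffs n (k + 1)) (b : ℂ) (v : ℕ → ℂ)
    (u : Fin n → ℕ+ → ℂ) (w : Fin k → ℕ → ℂ) :
    pairing c u (Fin.cons (fun i => b * v i) w) = b * pairing c u (Fin.cons v w) := by
  rw [pairing, pairing, Finsupp.mul_sum]
  refine Finset.sum_congr rfl fun p _ => ?_
  simp only [Fin.prod_univ_succ, Fin.cons_zero, Fin.cons_succ]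
  ring

theorem coeff_mul_algebraMap_mul (x y : LS) (c d : ℂ) (N : ℤ) :
    (x * (y * algebraMap ℂ LS c) * algebraMap ℂ LS d).coeff N = c * d * (x * y).coeff N := by
  rw [← mul_assoc, coeff_mul_algebraMap, coeff_mul_algebraMap]
  ring

theorem hasFinSum_evalT_BB {g n k : ℕ} (h : 2 < 2 * g + (n + 2) + k) (u u' : LS →ₗ[ℂ] LS)
    (α : Fin n → ℤ) (β : Fin k → ℤ) (N : ℤ) :
    HasFinSum (fun p => pairing (C.coeffsOf ω g (n + 2) k)
      (Fin.cons (fun i => (u (C.dxiNeg i)).coeff p)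
        (Fin.cons (fun i => (u' (C.dxiNeg i)).coeff (N - p)) fun i => C.cB (α i)))
      fun j => C.cF (β j))
    ((C.evalT (Matrix.vecCons u (Matrix.vecCons u' fun i => coeffAt (α i)))
      (fun j => coeffAt (β j)) (ω g (n + 2) k)).coeff N) := by
  rw [evalT_eq, coeff_finsuppSum]
  simp only [pairing]
  rw [coeffsOf_stable h]
  refine HasFinSum.sum fun q _ => ?_
  simp only [Fin.prod_univ_succ, Matrix.cons_val_zero, Matrix.cons_val_succ, prod_coeffAt_B,
    prod_coeffAt_F, HahnSeries.coeff_smul, coeff_mul_algebraMap_mul, smul_eq_mul, Fin.cons_zero,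
    Fin.cons_succ]
  refine HasFinSum.congr (((hasFinSum_coeff_mul _ _ N).const_mul _).const_mul _) (fun p => ?_) rfl
  ring

theorem hasFinSum_evalT_FF {g n k : ℕ} (h : 2 < 2 * g + n + (k + 2)) (u u' : LS →ₗ[ℂ] LS)
    (α : Fin n → ℤ) (β : Fin k → ℤ) (N : ℤ) :
    HasFinSum (fun p => pairing (C.coeffsOf ω g n (k + 2)) (fun i => C.cB (α i))
      (Fin.cons (fun i => (u (C.etaNeg i)).coeff p)
        (Fin.cons (fun i => (u' (C.etaNeg i)).coeff (N - p)) fun j => C.cF (β j))))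
    ((C.evalT (fun i => coeffAt (α i))
      (Matrix.vecCons u (Matrix.vecCons u' fun j => coeffAt (β j))) (ω g n (k + 2))).coeff N) := by
  rw [evalT_eq, coeff_finsuppSum]
  simp only [pairing]
  rw [coeffsOf_stable h]
  refine HasFinSum.sum fun q _ => ?_
  simp only [Fin.prod_univ_succ, Matrix.cons_val_zero, Matrix.cons_val_succ, prod_coeffAt_B,
    prod_coeffAt_F, HahnSeries.coeff_smul, smul_eq_mul, Fin.cons_zero,
    Fin.cons_succ]
  rw [mul_comm (algebraMap ℂ LS _), coeff_mul_algebraMap_mul]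
  refine HasFinSum.congr (((hasFinSum_coeff_mul _ _ N).const_mul _).const_mul _) (fun p => ?_) rfl
  ring

theorem hasFinSum_evalT_BF {g n k : ℕ} (h : 2 < 2 * g + (n + 1) + (k + 1)) (u u' : LS →ₗ[ℂ] LS)
    (α : Fin n → ℤ) (β : Fin k → ℤ) (N : ℤ) :
    HasFinSum (fun p => pairing (C.coeffsOf ω g (n + 1) (k + 1))
      (Fin.cons (fun i => (u (C.dxiNeg i)).coeff p) fun i => C.cB (α i))
      (Fin.cons (fun i => (u' (C.etaNeg i)).coeff (N - p)) fun j => C.cF (β j)))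
    ((C.evalT (Matrix.vecCons u fun i => coeffAt (α i))
      (Matrix.vecCons u' fun j => coeffAt (β j)) (ω g (n + 1) (k + 1))).coeff N) := by
  rw [evalT_eq, coeff_finsuppSum]
  simp only [pairing]
  rw [coeffsOf_stable h]
  refine HasFinSum.sum fun q _ => ?_
  simp only [Fin.prod_univ_succ, Matrix.cons_val_zero, Matrix.cons_val_succ, prod_coeffAt_B,
    prod_coeffAt_F, HahnSeries.coeff_smul, smul_eq_mul, Fin.cons_zero,
    Fin.cons_succ]
  have (x y : LS) (c d : ℂ) : (x * algebraMap ℂ LS c * (y * algebraMap ℂ LS d)).coeff N =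
      c * d * (x * y).coeff N := by
    rw [mul_mul_mul_comm, ← map_mul, coeff_mul_algebraMap, mul_comm]
  rw [this]
  refine HasFinSum.congr (((hasFinSum_coeff_mul _ _ N).const_mul _).const_mul _) (fun p => ?_) rfl
  ring

theorem diagBB_stable {g n k : ℕ} (h : 2 < 2 * g + (n + 2) + k) (α : Fin n → ℤ) (β : Fin k → ℤ) :
    C.diagBB ω g n k α β = C.evalT
      (Matrix.vecCons LinearMap.id (Matrix.vecCons sigmaB fun i => coeffAt (α i)))
      (fun j => coeffAt (β j)) (ω g (n + 2) k) := by
  unfold diagBB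
  split
  · omega
  · rfl

theorem diagFF_stable {g n k : ℕ} (h : 2 < 2 * g + n + (k + 2)) (α : Fin n → ℤ) (β : Fin k → ℤ) :
    C.diagFF ω g n k α β = C.evalT (fun i => coeffAt (α i))
      (Matrix.vecCons deriv (Matrix.vecCons sigmaF fun j => coeffAt (β j))) (ω g n (k + 2)) := by
  unfold diagFF
  split
  · omega
  · rfl

theorem hcoef_jet_der_der {n k : ℕ} (α : Fin n → ℤ) (β : Fin k → ℤ) (v v' : ℕ+ → ℂ) (f : SP)
    (q : ℤ) : hcoef q (C.jet α β (hb 2 • der v (der v' f))) = hcoef (q - 2)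
      (tay (List.ofFn (Fin.cons v (Fin.cons v' fun i => C.cB (α i))))
        (List.ofFn fun j => C.cF (β j)) f) := by
  rw [map_smul, smul_eq_mul, hcoef_hb_mul, jet, List.ofFn_cons, List.ofFn_cons, tay_cons_left,
    tay_cons_left, der_comm]

theorem hcoef_jet_oder_oder {n k : ℕ} (α : Fin n → ℤ) (β : Fin k → ℤ) (v v' : ℕ → ℂ) (f : SP)
    (q : ℤ) : hcoef q (C.jet α β (hb 2 • oder v (oder v' f))) = -hcoef (q - 2)
      (tay (List.ofFn fun i => C.cB (α i))
        (List.ofFn (Fin.cons v (Fin.cons v' fun j => C.cF (β j)))) f) := by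
  rw [map_smul, smul_eq_mul, hcoef_hb_mul, jet, List.ofFn_cons, List.ofFn_cons, tay_cons_right,
    tay_cons_right, oder_anticomm, map_neg, map_neg]

theorem hcoef_jet_der_oder {n k : ℕ} (α : Fin n → ℤ) (β : Fin k → ℤ) (v : ℕ+ → ℂ) (v' : ℕ → ℂ)
    (f : SP) (q : ℤ) : hcoef q (C.jet α β (hb 2 • der v (oder v' f))) = hcoef (q - 2)
      (tay (List.ofFn (Fin.cons v fun i => C.cB (α i)))
        (List.ofFn (Fin.cons v' fun j => C.cF (β j))) f) := by
  rw [map_smul, smul_eq_mul, hcoef_hb_mul, jet, List.ofFn_cons, List.ofFn_cons, tay_cons_right,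
    tay_cons_left]

theorem neg_one_zpow_sub_of_even {N : ℤ} (hN : Even N) (p : ℤ) : (-1 : ℂ) ^ (N - p) = (-1) ^ p := by
  rw [zpow_sub₀ (by norm_num), hN.neg_one_zpow, one_div, ← inv_zpow]
  norm_num

theorem neg_one_zpow_sub_of_odd {N : ℤ} (hN : Odd N) (p : ℤ) : (-1 : ℂ) ^ (N - p) = -(-1) ^ p := by
  rw [zpow_sub₀ (by norm_num), hN.neg_one_zpow, neg_div, one_div, ← inv_zpow]
  norm_num

/-! ### Coefficients of the quadratic loop equations -/

/-- For even `N` the sign of `σ` on the second factor depends only on `p`. Products of symbols give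
the splittings and second derivatives give the diagonal term. The unstable diagonal value at
`(1,0,0)` is not encoded in `F` and is therefore subtracted. -/
theorem hasFinSum_QBB (hs : C.IsSuperSymmetric ω) {W g n k : ℕ} (hg : g < W) (hn : n + 2 < W)
    (hk : k + 2 < W) (α : Fin n → ℤ) (β : Fin k → ℤ) {N : ℤ} (hN : Even N) :
    HasFinSum (fun p => -(-1) ^ p * hcoef g (C.jet α β (C.qBB (fT (C.coeffsOf ω) W) p (N - p))))
      ((C.QBB ω g n k α β).coeff N -
        if g = 1 ∧ n = 0 ∧ k = 0 then C.omega02Diag.coeff N else 0) := by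
  have h1 := (represents_corrB hs W).hasFinSum ((represents_corrB hs W).smul_shift sigmaB
    (fun p => -(-1) ^ p) 0 (fun f p => by rw [coeff_sigmaB, add_zero])) hg (by omega) (by omega) α β N
  have h1' (p : ℤ) : hcoef g (C.jet α β (C.sB (fT (C.coeffsOf ω) W) p *
      cst (-(-1) ^ (N - p)) • C.sB (fT (C.coeffsOf ω) W) (N - p + 0))) =
      -(-1) ^ p * hcoef g (C.jet α β (C.sB (fT (C.coeffsOf ω) W) p *
        C.sB (fT (C.coeffsOf ω) W) (N - p))) := by
    rw [mul_smul_comm, map_smul, smul_eq_mul, hcoef_cst_mul, add_zero, neg_one_zpow_sub_of_even hN]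
  simp only [h1'] at h1
  have h2 : HasFinSum (fun p => -(-1) ^ p * hcoef g (C.jet α β
      (hb 2 • der (C.cB p) (der (C.cB (N - p)) (fT (C.coeffsOf ω) W)))))
      ((match g with
        | 0 => (0 : LS)
        | g' + 1 => C.diagBB ω g' n k α β).coeff N -
        if g = 1 ∧ n = 0 ∧ k = 0 then C.omega02Diag.coeff N else 0) := by
    simp only [hcoef_jet_der_der]
    match g with
    | 0 =>
      refine HasFinSum.zero.congr (fun p => ?_) ?_
      · rw [hcoef_tay_fT_of_lt (isSuperSymm_coeffsOf hs) W (by norm_num), mul_zero]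
      · simp
    | g + 1 =>
      have h3 (p : ℤ) : hcoef ((g + 1 : ℕ) - 2) (tay (List.ofFn (Fin.cons (C.cB p)
          (Fin.cons (C.cB (N - p)) fun i => C.cB (α i)))) (List.ofFn fun j => C.cF (β j))
          (fT (C.coeffsOf ω) W)) = pairing (C.coeffsOf ω g (n + 2) k) (Fin.cons (C.cB p)
          (Fin.cons (C.cB (N - p)) fun i => C.cB (α i))) fun j => C.cF (β j) := by
        rw [← hcoef_tay_fT (isSuperSymm_coeffsOf hs) (by omega : g < W) hn (by omega : k < W)]
        congr 1
        push_cast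
        ring_nf
      simp only [h3]
      by_cases h : 2 < 2 * g + (n + 2) + k
      · rw [if_neg (by omega), sub_zero]
        rw [diagBB_stable h]
        refine (hasFinSum_evalT_BB h LinearMap.id sigmaB α β N).congr (fun p => ?_) rfl
        have := pairing_scale_BB (C.coeffsOf ω g (n + 2) k) 1 (-(-1) ^ (N - p)) (C.cB p)
          (C.cB (N - p)) (fun i => C.cB (α i)) (fun j => C.cF (β j))
        simp only [one_mul] at this
        rw [neg_one_zpow_sub_of_even hN] at this
        rw [← this]
        simp only [coeff_sigmaB, neg_one_zpow_sub_of_even hN]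
        rfl
      -- The only unstable diagonal term: its part of the potential is zero, and the correction on
      -- the right removes it.
      · obtain ⟨rfl, rfl, rfl⟩ : g = 0 ∧ n = 0 ∧ k = 0 := by omega
        refine HasFinSum.zero.congr (fun p => ?_) ?_
        · rw [coeffsOf_unstable (by omega), pairing, Finsupp.sum_zero_index, mul_zero]
        · simp [diagBB]
  refine (h2.add h1).congr (fun p => ?_) ?_
  · rw [qBB, map_add, map_add]
    ring
  · rw [QBB.eq_def, HahnSeries.coeff_add]
    cases g <;> dsimp only <;> ring

theorem coeff_single_one_mul (f : LS) (p : ℤ) :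
    (HahnSeries.single (1 : ℤ) (1 : ℂ) * f).coeff p = f.coeff (p - 1) := by
  have := HahnSeries.coeff_single_mul_add (r := (1 : ℂ)) (x := f) (a := p - 1) (b := (1 : ℤ))
  rw [one_mul, sub_add_cancel] at this
  exact this

/-- Differentiation supplies the weight `p` and lowers the exponent by one, while `Θ² = z dz` raises
it again. For even `N` each of the two halves of the splitting part equals half of the total. -/
theorem hasFinSum_QFF (hs : C.IsSuperSymmetric ω) {W g n k : ℕ} (hg : g < W) (hn : n + 2 < W)
    (hk : k + 2 < W) (α : Fin n → ℤ) (β : Fin k → ℤ) {N : ℤ} (hN : Even N) :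
    HasFinSum (fun p : ℤ => p * (-1) ^ p *
        hcoef g (C.jet α β (C.qFF (fT (C.coeffsOf ω) W) p (N - p))))
      ((C.QFF ω g n k α β).coeff N +
        if g = 1 ∧ n = 0 ∧ k = 0 then C.omega002Diag.coeff (N - 1) else 0) := by
  have hN1 : Odd (N - 1) := hN.sub_odd odd_one
  have hcF := represents_corrF hs W
  have hsF := hcF.smul_shift sigmaF (fun p => (-1) ^ p) 0
    (fun f p => by rw [coeff_sigmaF, add_zero])
  have hdF := hcF.smul_shift deriv (fun p => (p : ℂ) + 1) 1 coeff_deriv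
  have hdsF := hcF.smul_shift (fun f => deriv (sigmaF f))
    (fun p => ((p : ℂ) + 1) * (-1) ^ (p + 1)) 1
    (fun f p => by rw [coeff_deriv, coeff_sigmaF, mul_assoc])
  have e1 (p : ℤ) : (Equiv.subRight (1 : ℤ)) p = p - 1 := rfl
  have e2 (p : ℤ) : N - 1 - (p - 1) = N - p := by ring
  -- The shift of the summation index undoes the shift produced by the derivative, so that `p` again
  -- labels the undifferentiated series.
  have h1 := (hdF.hasFinSum hsF hg (by omega) (by omega) α β (N - 1)).comp_equiv (Equiv.subRight 1)
  have h2 := (hdsF.hasFinSum hcF hg (by omega) (by omega) α β (N - 1)).comp_equiv (Equiv.subRight 1)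
  simp only [e1, sub_add_cancel, e2, add_zero, mul_smul_comm, smul_mul_assoc, map_smul, smul_eq_mul,
    hcoef_cst_mul, Int.cast_sub, Int.cast_one] at h1 h2
  have h3 : HasFinSum (fun p : ℤ => p * (-1) ^ p * hcoef g (C.jet α β
      (hb 2 • oder (C.cF p) (oder (C.cF (N - p)) (fT (C.coeffsOf ω) W)))))
      ((match g with
        | 0 => (0 : LS)
        | g' + 1 => (-1 / 2 : ℂ) • (C.diagFF ω g' n k α β + sigmaB (C.diagFF ω g' n k α β))).coeff
          (N - 1) + if g = 1 ∧ n = 0 ∧ k = 0 then C.omega002Diag.coeff (N - 1) else 0) := by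
    simp only [hcoef_jet_oder_oder]
    match g with
    | 0 =>
      refine HasFinSum.zero.congr (fun p => ?_) ?_
      · rw [hcoef_tay_fT_of_lt (isSuperSymm_coeffsOf hs) W (by norm_num), neg_zero,
          mul_zero]
      · simp
    | g + 1 =>
      have h3 (p : ℤ) : hcoef ((g + 1 : ℕ) - 2) (tay (List.ofFn fun i => C.cB (α i))
          (List.ofFn (Fin.cons (C.cF p) (Fin.cons (C.cF (N - p)) fun j => C.cF (β j))))
          (fT (C.coeffsOf ω) W)) = pairing (C.coeffsOf ω g n (k + 2)) (fun i => C.cB (α i))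
          (Fin.cons (C.cF p) (Fin.cons (C.cF (N - p)) fun j => C.cF (β j))) := by
        rw [← hcoef_tay_fT (isSuperSymm_coeffsOf hs) (by omega : g < W) (by omega : n < W) hk]
        congr 1
        push_cast
        ring_nf
      -- At odd exponents the one-form pullback acts trivially, so the two diagonal terms combine to
      -- minus the first. That sign matches the one from reordering two odd derivatives.
      have h4 : (((-1 / 2 : ℂ) • (C.diagFF ω g n k α β + sigmaB (C.diagFF ω g n k α β))) : LS).coeff
          (N - 1) = -(C.diagFF ω g n k α β).coeff (N - 1) := by
        rw [HahnSeries.coeff_smul, HahnSeries.coeff_add, coeff_sigmaB, hN1.neg_one_zpow, smul_eq_mul]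
        ring
      simp only [h3, h4]
      by_cases h : 2 < 2 * g + n + (k + 2)
      · rw [if_neg (by omega), add_zero, diagFF_stable h]
        have h5 := ((hasFinSum_evalT_FF h deriv sigmaF α β (N - 1) (ω := ω)).comp_equiv
          (Equiv.subRight 1)).const_mul (-1)
        refine h5.congr (fun p => ?_) (by ring)
        have := pairing_scale_FF (C.coeffsOf ω g n (k + 2)) p ((-1) ^ (N - p)) (C.cF p)
          (C.cF (N - p)) (fun i => C.cB (α i)) (fun j => C.cF (β j))
        rw [neg_one_zpow_sub_of_even hN] at this
        simp only [e1, coeff_deriv, coeff_sigmaF, sub_add_cancel, e2, Int.cast_sub, Int.cast_one,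
          neg_one_zpow_sub_of_even hN]
        rw [mul_neg, ← this, neg_one_mul]
        rfl
      · obtain ⟨rfl, rfl, rfl⟩ : g = 0 ∧ n = 0 ∧ k = 0 := by omega
        refine HasFinSum.zero.congr (fun p => ?_) ?_
        · rw [coeffsOf_unstable (by omega), pairing, Finsupp.sum_zero_index, neg_zero, mul_zero]
        · simp [diagFF]
  refine (h3.add ((h1.const_mul (1 / 2)).add (h2.const_mul (1 / 2)))).congr (fun p => ?_) ?_
  · rw [qFF, map_add, map_add, neg_one_zpow_sub_of_even hN]
    ring
  · rw [QFF.eq_def, coeff_single_one_mul, HahnSeries.coeff_add, HahnSeries.coeff_add,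
      HahnSeries.coeff_smul, HahnSeries.coeff_smul, smul_eq_mul, smul_eq_mul]
    cases g <;> dsimp only <;> ring

/-- For odd `N`, exchanging `z` and `σ(z)` gives equal contributions, both with sign `-(-1)^p`; this
explains the factor `-2`. -/
theorem hasFinSum_QFB (hs : C.IsSuperSymmetric ω) {W g n k : ℕ} (hg : g < W) (hn : n + 2 < W)
    (hk : k + 2 < W) (hodd : Odd k) (α : Fin n → ℤ) (β : Fin k → ℤ) {N : ℤ} (hN : Odd N) :
    HasFinSum (fun p : ℤ => -2 * ((-1) ^ p *
        hcoef g (C.jet α β (C.sBF (fT (C.coeffsOf ω) W) p (N - p)))))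
      ((C.QFB ω g n k α β).coeff N) := by
  have hcF := represents_corrF hs W
  have hcB := represents_corrB hs W
  have hsF := hcF.smul_shift sigmaF (fun p => (-1) ^ p) 0
    (fun f p => by rw [coeff_sigmaF, add_zero])
  have hsB := hcB.smul_shift sigmaB (fun p => -(-1) ^ p) 0
    (fun f p => by rw [coeff_sigmaB, add_zero])
  have h1 := hcB.hasFinSum hsF hg (by omega) (by omega) α β N
  have h2 := hsB.hasFinSum hcF hg (by omega) (by omega) α β N
  simp only [add_zero, mul_smul_comm, smul_mul_assoc, map_smul, smul_eq_mul, hcoef_cst_mul,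
    neg_one_zpow_sub_of_odd hN] at h1 h2
  have h3 : HasFinSum (fun p : ℤ => -2 * ((-1) ^ p * hcoef g (C.jet α β
      (hb 2 • der (C.cB p) (oder (C.cF (N - p)) (fT (C.coeffsOf ω) W))))))
      ((match g with
        | 0 => (0 : LS)
        | g' + 1 => C.diagBF ω g' n k α β + sigmaB (C.diagBF ω g' n k α β)).coeff N) := by
    simp only [hcoef_jet_der_oder]
    match g with
    | 0 =>
      refine HasFinSum.zero.congr (fun p => ?_) rfl
      rw [hcoef_tay_fT_of_lt (isSuperSymm_coeffsOf hs) W (by norm_num),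
        mul_zero, mul_zero]
    | g + 1 =>
      have h3 (p : ℤ) : hcoef ((g + 1 : ℕ) - 2) (tay (List.ofFn (Fin.cons (C.cB p)
          fun i => C.cB (α i))) (List.ofFn (Fin.cons (C.cF (N - p)) fun j => C.cF (β j)))
          (fT (C.coeffsOf ω) W)) = pairing (C.coeffsOf ω g (n + 1) (k + 1))
          (Fin.cons (C.cB p) fun i => C.cB (α i))
          (Fin.cons (C.cF (N - p)) fun j => C.cF (β j)) := by
        rw [← hcoef_tay_fT (isSuperSymm_coeffsOf hs) (by omega : g < W) (by omega : n + 1 < W)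
          (by omega : k + 1 < W)]
        congr 1
        push_cast
        ring_nf
      simp only [h3]
      -- An odd `k` is at least one, so the diagonal correlator has at least three slots and is
      -- stable; no correction term arises.
      have hk0 := hodd.pos
      rw [HahnSeries.coeff_add, coeff_sigmaB, hN.neg_one_zpow]
      have h5 := (hasFinSum_evalT_BF (by omega : 2 < 2 * g + (n + 1) + (k + 1)) LinearMap.id sigmaF
        α β N (ω := ω)).const_mul 2
      refine h5.congr (fun p => ?_) (by rw [diagBF]; ring)
      have := pairing_scale_F (C.coeffsOf ω g (n + 1) (k + 1)) ((-1) ^ (N - p)) (C.cF (N - p))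
        (Fin.cons (C.cB p) fun i => C.cB (α i)) (fun j => C.cF (β j))
      simp only [coeff_sigmaF]
      rw [neg_one_zpow_sub_of_odd hN] at this ⊢
      have h6 : -2 * ((-1) ^ p * pairing (C.coeffsOf ω g (n + 1) (k + 1))
          (Fin.cons (C.cB p) fun i => C.cB (α i))
          (Fin.cons (C.cF (N - p)) fun j => C.cF (β j))) =
          2 * (-(-1) ^ p * pairing (C.coeffsOf ω g (n + 1) (k + 1))
          (Fin.cons (C.cB p) fun i => C.cB (α i))
          (Fin.cons (C.cF (N - p)) fun j => C.cF (β j))) := by ring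
      rw [h6, ← this]
      rfl
  refine (h3.add (h1.add h2)).congr (fun p => ?_) ?_
  · rw [sBF_eq, map_add, map_add]
    ring
  · rw [QFB.eq_def, HahnSeries.coeff_add, HahnSeries.coeff_add]
    cases g <;> dsimp only <;> ring

end LocalSuperSpectralCurve

/-! ### Orders of series -/

theorem OrdGE.mono {a b : ℤ} {x : LS} (h : OrdGE a x) (hab : b ≤ a) : OrdGE b x :=
  fun p hp => h p (by omega)

theorem OrdGE.zero (a : ℤ) : OrdGE a 0 := fun _ _ => rfl

theorem OrdGE.add {a : ℤ} {x y : LS} (hx : OrdGE a x) (hy : OrdGE a y) : OrdGE a (x + y) :=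
  fun p hp => by rw [HahnSeries.coeff_add, hx p hp, hy p hp, add_zero]

theorem OrdGE.sum {ι : Type*} {s : Finset ι} {a : ℤ} {x : ι → LS} (h : ∀ i ∈ s, OrdGE a (x i)) :
    OrdGE a (∑ i ∈ s, x i) :=
  fun p hp => by
    rw [HahnSeries.coeff_sum]
    exact Finset.sum_eq_zero fun i hi => h i hi p hp

theorem OrdGE.zsmul {a : ℤ} {x : LS} (hx : OrdGE a x) (z : ℤ) : OrdGE a (z • x) :=
  fun p hp => by rw [coeff_zsmul, hx p hp, mul_zero]

theorem OrdGE.mul {a b : ℤ} {x y : LS} (hx : OrdGE a x) (hy : OrdGE b y) : OrdGE (a + b) (x * y) := by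
  intro N hN
  refine (hasFinSum_coeff_mul x y N).unique (HasFinSum.zero.congr (fun p => ?_) rfl)
  rcases lt_or_ge p a with h | h
  · rw [hx p h, zero_mul]
  · rw [hy _ (by omega), mul_zero]

theorem OrdGE.splitSum {A B : (g n k : ℕ) → (Fin n → ℤ) → (Fin k → ℤ) → LS} {g n k : ℕ}
    {α : Fin n → ℤ} {β : Fin k → ℤ} {a : ℤ}
    (h : ∀ g₁ g₂ (S : Finset (Fin n)) (R : Finset (Fin k)), g₁ + g₂ = g → OrdGE a
      (A g₁ S.card R.card (restr α S) (restr β R) *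
        B g₂ Sᶜ.card Rᶜ.card (restr α Sᶜ) (restr β Rᶜ))) : OrdGE a (splitSum A B g n k α β) :=
  OrdGE.sum fun p hp => OrdGE.sum fun S _ => OrdGE.sum fun R _ =>
    (h p.1 p.2 S R (Finset.HasAntidiagonal.mem_antidiagonal.mp hp)).zsmul _

namespace LocalSuperSpectralCurve

theorem OrdGE.sigmaF {a : ℤ} {x : LS} (hx : OrdGE a x) : OrdGE a (sigmaF x) :=
  fun p hp => by rw [coeff_sigmaF, hx p hp, mul_zero]

theorem OrdGE.sigmaB {a : ℤ} {x : LS} (hx : OrdGE a x) : OrdGE a (sigmaB x) :=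
  fun p hp => by rw [coeff_sigmaB, hx p hp, mul_zero]

/-! ### Taylor coefficients determine the degree -/

section Jets

variable (C : LocalSuperSpectralCurve)

theorem jet_cons_right {n k : ℕ} (α : Fin n → ℤ) (b : ℤ) (β : Fin k → ℤ) (a : SP) :
    C.jet α (Fin.cons b β : Fin (k + 1) → ℤ) a = C.jet α β (oder (C.cF b) a) := by
  rw [jet, jet, ← tay_cons_right, ← List.ofFn_cons]
  congr 2
  refine congrArg List.ofFn (funext fun j => ?_)
  refine Fin.cases ?_ (fun i => ?_) j <;> simp

theorem jet_cons_left {n k : ℕ} (b : ℤ) (α : Fin n → ℤ) (β : Fin k → ℤ) (a : SP) :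
    C.jet (Fin.cons b α : Fin (n + 1) → ℤ) β a = C.jet α β (der (C.cB b) a) := by
  rw [jet, jet, ← tay_cons_left, ← List.ofFn_cons]
  congr 2
  refine congrArg List.ofFn (funext fun j => ?_)
  refine Fin.cases ?_ (fun i => ?_) j <;> simp

/-- The Taylor coefficients of order `(n, k)` at `ħ^q` vanish. -/
def JetVanish (q : ℤ) (n k : ℕ) (a : SP) : Prop :=
  ∀ (α : Fin n → ℤ) (β : Fin k → ℤ), hcoef q (C.jet α β a) = 0

variable {C}

theorem JetVanish.der {q : ℤ} {n k : ℕ} {a : SP} (h : C.JetVanish q (n + 1) k a) (i : ℕ+) :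
    C.JetVanish q n k (der (Pi.single i 1) a) := by
  intro α β
  rw [← C.cB_neg_eq_single, ← jet_cons_left]
  exact h _ _

/-- Exponents below `-1` give the coordinate directions of `θ^j` with `j ≥ 1`. The exponent `-1`
gives `θ^0` plus a combination of these, and subtraction isolates `θ^0`. -/
theorem JetVanish.oder {q : ℤ} {n k : ℕ} {a : SP} (h : C.JetVanish q n (k + 1) a) (j : ℕ) :
    C.JetVanish q n k (oder (Pi.single j 1) a) := by
  have key (b : ℤ) : C.JetVanish q n k (SuperTR.oder (C.cF b) a) := by
    intro α β
    rw [← jet_cons_right]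
    exact h _ _
  have hpos (j : ℕ) (hj : 0 < j) : C.JetVanish q n k (SuperTR.oder (Pi.single j 1) a) := by
    rw [← C.cF_neg_eq_single hj]
    exact key _
  rcases Nat.eq_zero_or_pos j with rfl | hj
  · obtain ⟨M, hM, hM0⟩ := ((eventually_oder_eq_sum a).and (eventually_gt_atTop 0)).exists
    have h1 := hM (C.cF (-1))
    rw [← Finset.add_sum_erase _ _ (Finset.mem_range.mpr hM0), cF_neg_one, C.ψ_zero, if_pos rfl,
      add_zero, cst_one, one_smul] at h1
    intro α β
    rw [eq_sub_of_add_eq h1.symm, map_sub, map_sub, key (-1) α β, map_sum, map_sum, zero_sub,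
      neg_eq_zero]
    refine Finset.sum_eq_zero fun i hi => ?_
    rw [map_smul, smul_eq_mul, hcoef_cst_mul,
      hpos i (Nat.pos_of_ne_zero (Finset.ne_of_mem_erase hi)) α β, mul_zero]
  · exact hpos j hj

theorem JetVanish.tay_eq {q : ℤ} {a : SP} (I : List ℕ+) (K : List ℕ)
    (h : C.JetVanish q I.length K.length a) :
    hcoef q (tay (I.map fun i => Pi.single i 1) (K.map fun j => Pi.single j 1) a) = 0 := by
  induction I generalizing a with
  | cons i I ih => exact ih (JetVanish.der h i)
  | nil =>
    induction K generalizing a with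
    | cons j K ih =>
      rw [List.map_cons, tay_cons_right]
      exact ih (JetVanish.oder h j)
    | nil => simpa [jet] using h Fin.elim0 Fin.elim0

/-- Vanishing in all basis-coefficient directions implies vanishing in the coordinate directions,
because the latter are finite combinations of the former on each superpolynomial. -/
theorem mem_dge_of_jetVanish {w : ℤ} {a : SP}
    (h : ∀ (q : ℤ) (n k : ℕ), 2 * q + n + k < w → C.JetVanish q n k a) : a ∈ dge w :=
  mem_dge_of_hcoef_tay fun I K q hq => JetVanish.tay_eq I K (h q _ _ hq)

theorem eq_zero_of_eq_neg {z : ℂ} (h : z = -z) : z = 0 := self_eq_neg.mp h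

/-- The loop equations cover only one parity of the number of fermionic slots; for the other parity
the Taylor coefficient equals its own negative. -/
theorem jetVanish_of_par_eq {q : ℤ} {n k : ℕ} {a : SP} (ha : par a = a) (hk : Odd k) :
    C.JetVanish q n k a := by
  intro α β
  have h := tay_par (List.ofFn fun i => C.cB (α i)) (List.ofFn fun j => C.cF (β j)) a
  rw [ha, List.length_ofFn, hk.neg_one_pow, neg_one_mul] at h
  have h1 := congrArg (hcoef q) h
  rw [map_neg] at h1
  exact eq_zero_of_eq_neg h1

theorem jetVanish_of_par_eq_neg {q : ℤ} {n k : ℕ} {a : SP} (ha : par a = -a) (hk : Even k) :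
    C.JetVanish q n k a := by
  intro α β
  have h := tay_par (List.ofFn fun i => C.cB (α i)) (List.ofFn fun j => C.cF (β j)) a
  rw [ha, List.length_ofFn, hk.neg_one_pow, one_mul, map_neg] at h
  have h1 := congrArg (hcoef q) h
  rw [map_neg] at h1
  exact eq_zero_of_eq_neg h1.symm

theorem hcoef_jet_algebraMap {n k : ℕ} (α : Fin n → ℤ) (β : Fin k → ℤ) (c : ℂ) (q : ℤ) :
    hcoef q (C.jet α β (algebraMap Hb SP (cst c * hb 1))) =
      if q = 1 ∧ n = 0 ∧ k = 0 then c else 0 := by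
  rw [jet]
  match n, k with
  | n + 1, k => rw [List.ofFn_succ, tay_algebraMap_cons_left, map_zero, if_neg (by omega)]
  | 0, k + 1 =>
    rw [List.ofFn_succ (n := k), tay_algebraMap_cons_right, map_zero, if_neg (by omega)]
  | 0, 0 =>
    rw [List.ofFn_zero, List.ofFn_zero, tay_nil_nil, AlgHom.commutes]
    change hcoef q (cst c * hb 1) = _
    rw [hcoef_cst_mul_hb]
    simp [eq_comm]

end Jets

variable {C : LocalSuperSpectralCurve} {ω : C.Correlators}

/-! ### The unstable quadratic terms -/

/-- The order of `ω_{0,1|0}` that is guaranteed. -/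
def ordTau (C : LocalSuperSpectralCurve) : ℤ := open Classical in if C.τ 1 = 0 then 1 else 0

theorem ordGE_ofCoeffs (c : ℕ → ℂ) : OrdGE 0 (ofCoeffs c) := fun _ hp => coeff_ofCoeffs_neg c hp

theorem ordGE_omega01 : OrdGE C.ordTau C.omega01 := by
  intro p hp
  rcases lt_or_ge p 0 with h | h
  · exact ordGE_ofCoeffs _ p h
  · rw [ordTau] at hp
    split_ifs at hp with h1
    · obtain rfl : p = (0 : ℕ) := by omega
      rw [omega01, coeff_ofCoeffs_nat]
      exact h1
    · omega

theorem corrB_unstable {n k : ℕ} (h : n + k ≤ 1) (α : Fin n → ℤ) (β : Fin k → ℤ) :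
    OrdGE 0 (C.corrB ω 0 n k α β) ∧ (n = 0 → OrdGE C.ordTau (C.corrB ω 0 n k α β)) ∧
      (k = 1 → C.corrB ω 0 n k α β = 0) := by
  match n, k with
  | 0, 0 =>
    rw [corrB]
    exact ⟨ordGE_ofCoeffs _, fun _ => ordGE_omega01, by simp⟩
  | 1, 0 =>
    rw [corrB]
    exact ⟨ordGE_ofCoeffs _, by simp, by simp⟩
  | 0, 1 =>
    rw [corrB]
    exact ⟨OrdGE.zero _, fun _ => OrdGE.zero _, fun _ => rfl⟩
  | n + 2, k => omega
  | n, k + 2 => omega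
  | 1, 1 => omega

theorem corrF_unstable {n k : ℕ} (h : n + k ≤ 1) (α : Fin n → ℤ) (β : Fin k → ℤ) :
    OrdGE (-1) (C.corrF ω 0 n k α β) ∧ (k = 0 → C.corrF ω 0 n k α β = 0) := by
  match n, k with
  | 0, 0 =>
    rw [corrF]
    exact ⟨OrdGE.zero _, fun _ => rfl⟩
  | 1, 0 =>
    rw [corrF]
    exact ⟨OrdGE.zero _, fun _ => rfl⟩
  | 0, 1 =>
    rw [corrF]
    exact ⟨fun p hp => coeff_omega002_neg hp, by simp⟩
  | n + 2, k => omega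
  | n, k + 2 => omega
  | 1, 1 => omega

theorem card_add_card_compl_fin {n : ℕ} (S : Finset (Fin n)) : S.card + Sᶜ.card = n := by
  rw [Finset.card_add_card_compl, Fintype.card_fin]

/-- Not covered by the hypotheses on `ω`. With at most one further bosonic variable, one factor of
each splitting is `ω_{0,1|0}`, the other is regular, and the fermionic part vanishes. -/
theorem quadraticB_unstable {n : ℕ} (hn : n ≤ 1) (α : Fin n → ℤ) (β : Fin 0 → ℤ) :
    OrdGE C.ordTau (C.QBB ω 0 n 0 α β + C.QFF ω 0 n 0 α β) := by
  have hF (g : ℕ) (hg : g = 0) (S : Finset (Fin n)) (R : Finset (Fin 0)) :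
      C.corrF ω g S.card R.card (restr α S) (restr β R) = 0 := by
    subst hg
    have h1 := card_add_card_compl_fin S
    have h2 := card_add_card_compl_fin R
    exact (corrF_unstable (by omega) _ _).2 (by omega)
  have h1 : OrdGE C.ordTau (C.QBB ω 0 n 0 α β) := by
    rw [QBB.eq_def]
    refine (OrdGE.zero _).add (OrdGE.splitSum fun g₁ g₂ S R hg => ?_)
    obtain ⟨rfl, rfl⟩ : g₁ = 0 ∧ g₂ = 0 := by omega
    have h1 := card_add_card_compl_fin S
    have h2 := card_add_card_compl_fin R
    have hA := corrB_unstable (C := C) (ω := ω) (by omega) (restr α S) (restr β R)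
    have hB := corrB_unstable (C := C) (ω := ω) (by omega) (restr α Sᶜ) (restr β Rᶜ)
    rcases Nat.eq_zero_or_pos S.card with hS | hS
    · exact ((hA.2.1 hS).mul (OrdGE.sigmaB hB.1)).mono (by omega)
    · exact (hA.1.mul (OrdGE.sigmaB (hB.2.1 (by omega)))).mono (by omega)
  have h2 : C.QFF ω 0 n 0 α β = 0 := by
    have h0 : Finset.HasAntidiagonal.antidiagonal (0 : ℕ) = {(0, 0)} := rfl
    rw [QFF.eq_def, splitSum, splitSum]
    simp only [h0, Finset.sum_singleton, hF 0 rfl, map_zero, mul_zero,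
      smul_zero, Finset.sum_const_zero, add_zero]
  rw [h2, add_zero]
  exact h1

/-- Each splitting term has a bosonic factor of order at least that of `ω_{0,1|0}`, and a fermionic
factor with at most a simple pole from `ω_{0,0|2}`. -/
theorem quadraticF_unstable (α : Fin 0 → ℤ) (β : Fin 1 → ℤ) :
    OrdGE (C.ordTau - 1) (C.QFB ω 0 0 1 α β) := by
  have key (R : Finset (Fin 1)) (S : Finset (Fin 0)) :
      (∃ _ : OrdGE C.ordTau (C.corrB ω 0 S.card R.card (restr α S) (restr β R)),
        OrdGE (-1) (C.corrF ω 0 Sᶜ.card Rᶜ.card (restr α Sᶜ) (restr β Rᶜ))) := by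
    have h1 := card_add_card_compl_fin S
    have h2 := card_add_card_compl_fin R
    exact ⟨(corrB_unstable (by omega) _ _).2.1 (by omega), (corrF_unstable (by omega) _ _).1⟩
  rw [QFB.eq_def]
  refine ((OrdGE.zero _).add (OrdGE.splitSum fun g₁ g₂ S R hg => ?_)).add
    (OrdGE.splitSum fun g₁ g₂ S R hg => ?_)
  · obtain ⟨rfl, rfl⟩ : g₁ = 0 ∧ g₂ = 0 := by omega
    exact ((key R S).1.mul (OrdGE.sigmaF (key R S).2)).mono (by omega)
  · obtain ⟨rfl, rfl⟩ : g₁ = 0 ∧ g₂ = 0 := by omega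
    exact ((OrdGE.sigmaB (key R S).1).mul (key R S).2).mono (by omega)

end LocalSuperSpectralCurve

namespace LocalSuperSpectralCurve

variable {C : LocalSuperSpectralCurve} {ω : C.Correlators}

/-! ### The loop equations imply annihilation -/

theorem ordTau_cases (C : LocalSuperSpectralCurve) :
    (C.τ 1 = 0 ∧ C.ordTau = 1 ∧ C.shift = 0 ∧ C.eps = 3) ∨
      (C.τ 1 ≠ 0 ∧ C.ordTau = 0 ∧ C.shift = 2 ∧ C.eps = 1) := by
  by_cases h : C.τ 1 = 0
  · exact Or.inl ⟨h, if_pos h, if_pos h, if_pos h⟩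
  · exact Or.inr ⟨h, if_neg h, if_neg h, if_neg h⟩

theorem coeff_single_neg_three_mul (f : LS) (p : ℤ) :
    (HahnSeries.single (-3 : ℤ) (1 : ℂ) * f).coeff p = f.coeff (p + 3) := by
  have := HahnSeries.coeff_single_mul_add (r := (1 : ℂ)) (x := f) (a := p + 3) (b := (-3 : ℤ))
  rw [one_mul, add_neg_cancel_right] at this
  exact this

/-- Normal-ordering constants against unstable diagonal terms. The singular parts each contribute
`-1/4` at `n = 0`, giving the `ħ/4` in `L_0`; the regular parts give `-φ_{11} - ψ_{02}` at `n = -1`.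
-/
theorem ordConst_eq {n : ℤ} (hn : -1 ≤ n) :
    C.omega02Diag.coeff (-2 * n - 2) - C.omega002Diag.coeff (-2 * n - 2 - 1) =
      -2 * C.ordConst n := by
  have h0 (j : ℕ) : C.ψ j 0 = -C.ψ 0 j := by rw [psi_eq, C.ψ_zero]; ring
  rw [omega02Diag, omega002Diag, HahnSeries.coeff_add, HahnSeries.coeff_add,
    coeff_single_neg_three_mul, ordConst]
  rcases lt_trichotomy n 0 with h | rfl | h
  · obtain rfl : n = -1 := by omega
    have a0 := coeff_ofCoeffs_nat (fun N => -∑ p ∈ Finset.HasAntidiagonal.antidiagonal N,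
      C.φ p.1.succPNat p.2.succPNat * (-1) ^ p.2) 0
    have a2 := coeff_ofCoeffs_nat (fun N => ∑ p ∈ Finset.HasAntidiagonal.antidiagonal N,
      C.omega002Reg p.1 p.2 * ((p.1 : ℂ) - 1) * (-1) ^ (p.2 + 1)) 2
    have hd0 : Finset.HasAntidiagonal.antidiagonal 0 = {((0 : ℕ), (0 : ℕ))} := rfl
    have hd2 : Finset.HasAntidiagonal.antidiagonal 2 = {((0 : ℕ), (2 : ℕ)), (1, 1), (2, 0)} := rfl
    rw [hd0, Finset.sum_singleton] at a0
    rw [hd2] at a2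
    have e0 : (-2 * (-1 : ℤ) - 2) = ((0 : ℕ) : ℤ) := by norm_num
    have e2 : (-2 * (-1 : ℤ) - 2 - 1 + 3) = ((2 : ℕ) : ℤ) := by norm_num
    rw [e2, a2, e0, a0, HahnSeries.coeff_single_of_ne (by norm_num),
      HahnSeries.coeff_single_of_ne (by norm_num)]
    have hp : Nat.succPNat 0 = 1 := rfl
    simp [omega002Reg, h0, hp]
    ring
  · have a0 := coeff_ofCoeffs_nat (fun N => ∑ p ∈ Finset.HasAntidiagonal.antidiagonal N,
      C.omega002Reg p.1 p.2 * ((p.1 : ℂ) - 1) * (-1) ^ (p.2 + 1)) 0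
    have hd0 : Finset.HasAntidiagonal.antidiagonal 0 = {((0 : ℕ), (0 : ℕ))} := rfl
    rw [hd0, Finset.sum_singleton] at a0
    have e0 : (-2 * (0 : ℤ) - 2 - 1 + 3) = ((0 : ℕ) : ℤ) := by norm_num
    have e1 : (-2 * (0 : ℤ) - 2) = -2 := by norm_num
    have e2 : (-2 * (0 : ℤ) - 2 - 1) = -3 := by norm_num
    rw [e0, a0, e2, e1, HahnSeries.coeff_single_same, HahnSeries.coeff_single_same,
      coeff_ofCoeffs_neg _ (by norm_num), if_pos rfl]
    simp [omega002Reg]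
    norm_num
  · rw [coeff_ofCoeffs_neg _ (by omega), coeff_ofCoeffs_neg _ (by omega),
      HahnSeries.coeff_single_of_ne (by omega), HahnSeries.coeff_single_of_ne (by omega),
      if_neg (by omega), if_neg (by omega)]
    ring

/-- The Taylor coefficient at `ħ^q` as an additive map. -/
def jetHom (C : LocalSuperSpectralCurve) (q : ℤ) {n k : ℕ} (α : Fin n → ℤ) (β : Fin k → ℤ) :
    SP →+ ℂ := (hcoef q).comp (C.jet α β).toAddMonoidHom

theorem jetHom_apply (q : ℤ) {n k : ℕ} (α : Fin n → ℤ) (β : Fin k → ℤ) (a : SP) :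
    C.jetHom q α β a = hcoef q (C.jet α β a) := rfl

theorem jetHom_smul (q : ℤ) {n k : ℕ} (α : Fin n → ℤ) (β : Fin k → ℤ) (c : ℂ) (a : SP) :
    C.jetHom q α β (cst c • a) = c * C.jetHom q α β a := by
  rw [jetHom_apply, map_smul, smul_eq_mul, hcoef_cst_mul, jetHom_apply]

theorem even_neg_two_mul_sub_two (n : ℤ) : Even (-2 * n - 2) := ⟨-n - 1, by ring⟩

/-- Reflection `p ↦ N - p` keeps the sign weight for even `N` and negates the antisymmetric symbol,
so the sum equals its own negative. -/
theorem hasFinSum_qFF_alternating {f : SP} (hf : par f = f) (q : ℤ) {n k : ℕ} (α : Fin n → ℤ)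
    (β : Fin k → ℤ) {N : ℤ} (hN : Even N) :
    HasFinSum (fun p => (-1) ^ p * C.jetHom q α β (C.qFF f p (N - p))) 0 := by
  have h : HasFinSum (fun p => (-1) ^ p * C.jetHom q α β (C.qFF f p (N - p)))
      (∑ᶠ p, (-1) ^ p * C.jetHom q α β (C.qFF f p (N - p))) := by
    refine ⟨(C.finite_support_qFF hf N).subset fun p hp h0 => hp ?_, rfl⟩
    change C.qFF f p (N - p) = 0 at h0
    simp only [h0, map_zero, mul_zero]
  have h2 := (h.comp_equiv (Equiv.subLeft N)).unique ((h.const_mul (-1)).congr (fun p => ?_) rfl)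
  · rwa [eq_zero_of_eq_neg (h2.trans (neg_one_mul _))] at h
  · rw [Equiv.subLeft_apply, sub_sub_cancel, neg_one_zpow_sub_of_even hN, C.qFF_anticomm hf, map_neg]
    ring

/-- The fermionic weights are `r + 1 + p` in `L_{2r}` and `p` in `𝒬^{FF}`. The constant difference
meets an alternating sum that vanishes, and `ordConst_eq` matches the scalars. -/
theorem hcoef_jet_symL (hs : C.IsSuperSymmetric ω) {W g n k : ℕ} (hg : g < W) (hn : n + 2 < W)
    (hk : k + 2 < W) (α : Fin n → ℤ) (β : Fin k → ℤ) {r : ℤ} (hr : -1 ≤ r) {X : SP}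
    (hX : HasFinSum (C.summandL r (fT (C.coeffsOf ω) W)) X) :
    hcoef g (C.jet α β (X + algebraMap Hb SP (cst (C.ordConst r) * hb 1))) =
      -(1 / 2) * (C.QBB ω g n k α β + C.QFF ω g n k α β).coeff (-2 * r - 2) := by
  have hf := par_fT (isStableEven_coeffsOf hs) W
  have hN := even_neg_two_mul_sub_two r
  have h1 := hX.map (C.jetHom g α β)
  have hB := (hasFinSum_QBB hs hg hn hk α β hN).const_mul (-(1 / 2))
  have hF := (hasFinSum_QFF hs hg hn hk α β hN).const_mul (-(1 / 2))
  have h0 := (hasFinSum_qFF_alternating (C := C) hf g α β hN).const_mul (-(1 / 2) * ((r : ℂ) + 1))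
  have h2 := h1.unique (((hB.add hF).add h0).congr (fun p => ?_) rfl)
  · rw [map_add, map_add, hcoef_jet_algebraMap, ← jetHom_apply, h2, HahnSeries.coeff_add]
    have hc := ordConst_eq (C := C) hr
    by_cases h : g = 1 ∧ n = 0 ∧ k = 0
    · rw [if_pos h, if_pos h, if_pos (by exact_mod_cast h)]
      linear_combination (1 / 2) * hc
    · rw [if_neg h, if_neg h, if_neg (by exact_mod_cast h)]
      ring
  · rw [summandL, map_add, jetHom_smul, jetHom_smul, ← jetHom_apply, ← jetHom_apply]
    ring

theorem jetVanish_qBB (hs : C.IsSuperSymmetric ω) (W : ℕ) {q : ℤ} (hq : q < 0) (n k : ℕ) (p p' : ℤ) :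
    C.JetVanish q n k (C.qBB (fT (C.coeffsOf ω) W) p p') := by
  intro α β
  rw [qBB, map_add, map_add, (represents_corrB hs W).mul_neg (represents_corrB hs W) _ _ _ _ hq,
    hcoef_jet_der_der, hcoef_tay_fT_of_lt (isSuperSymm_coeffsOf hs) W (by omega), add_zero]

theorem jetVanish_qFF (hs : C.IsSuperSymmetric ω) (W : ℕ) {q : ℤ} (hq : q < 0) (n k : ℕ) (p p' : ℤ) :
    C.JetVanish q n k (C.qFF (fT (C.coeffsOf ω) W) p p') := by
  intro α β
  rw [qFF, map_add, map_add, (represents_corrF hs W).mul_neg (represents_corrF hs W) _ _ _ _ hq,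
    hcoef_jet_oder_oder, hcoef_tay_fT_of_lt (isSuperSymm_coeffsOf hs) W (by omega), neg_zero,
    add_zero]

theorem jetVanish_sBF (hs : C.IsSuperSymmetric ω) (W : ℕ) {q : ℤ} (hq : q < 0) (n k : ℕ) (p p' : ℤ) :
    C.JetVanish q n k (C.sBF (fT (C.coeffsOf ω) W) p p') := by
  intro α β
  rw [sBF_eq, map_add, map_add, (represents_corrB hs W).mul_neg (represents_corrF hs W) _ _ _ _ hq,
    hcoef_jet_der_oder, hcoef_tay_fT_of_lt (isSuperSymm_coeffsOf hs) W (by omega), add_zero]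

theorem par_summandL {f : SP} (hf : par f = f) (n p : ℤ) :
    par (C.summandL n f p) = C.summandL n f p := by
  have h1 : par (C.qBB f p (-2 * n - 2 - p)) = C.qBB f p (-2 * n - 2 - p) := by
    rw [qBB, map_add, map_mul, C.par_sB hf, C.par_sB hf, map_smul, ← der_par, ← der_par, hf]
  have h2 : par (C.qFF f p (-2 * n - 2 - p)) = C.qFF f p (-2 * n - 2 - p) := by
    have h3 (w w' : ℕ → ℂ) : par (oder w (oder w' f)) = oder w (oder w' f) := by
      have := oder_par w (oder w' f)
      rw [par_oder hf, map_neg] at this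
      exact (neg_injective this).symm
    rw [qFF, map_add, map_mul, C.par_sF hf, C.par_sF hf, map_smul, h3, neg_mul_neg]
  rw [summandL, map_add, map_smul, map_smul, h1, h2]

theorem par_summandG {f : SP} (hf : par f = f) (m p : ℤ) :
    par (C.summandG m f p) = -C.summandG m f p := by
  rw [summandG, map_smul, sBF_eq, map_add, map_mul, C.par_sB hf, C.par_sF hf, map_smul, ← der_par,
    par_oder hf, map_neg, smul_neg, mul_neg, ← neg_add, smul_neg]

/-- At the odd exponent `-2i - 1` a one-form and its pullback have equal coefficients, so the linear
loop equation kills twice the Taylor coefficient. In the unstable cases the series is regular. -/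
theorem annihilates_J (hs : C.IsSuperSymmetric ω) (hl : C.SuperLoopEquations ω) {i : ℤ}
    (hi : 1 ≤ i) : Annihilates (J (2 * i)) (C.coeffsOf ω) := by
  rw [C.annihilates_J_iff (isStableEven_coeffsOf hs) (by omega)]
  intro w
  refine ⟨w.toNat + 3, fun W hW => mem_dge_of_jetVanish (C := C) fun q n k hq => ?_⟩
  rcases Nat.even_or_odd k with hk | hk
  · intro α β
    rcases lt_or_ge q 0 with h | h
    · exact hcoef_jet_sB_of_neg hs W α β _ h
    · lift q to ℕ using h
      rw [hcoef_jet_sB hs (by omega) (by omega) (by omega)]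
      by_cases hst : 2 < 2 * q + (n + 1) + k
      · have h1 := hl.linearB q n k α β hk hst (-(2 * i) - 1) (by omega)
        have hodd : Odd (-(2 * i) - 1) := ⟨-i - 1, by ring⟩
        rw [HahnSeries.coeff_add, coeff_sigmaB, hodd.neg_one_zpow] at h1
        linear_combination (1 / 2) * h1
      · obtain rfl : q = 0 := by omega
        exact (corrB_unstable (by omega) α β).1 _ (by omega)
  · exact jetVanish_of_par_eq (C.par_sB (par_fT (isStableEven_coeffsOf hs) W) _) hk

theorem annihilates_Gam (hs : C.IsSuperSymmetric ω) (hl : C.SuperLoopEquations ω) {i : ℤ}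
    (hi : 1 ≤ i) : Annihilates (Gam (2 * i - 1)) (C.coeffsOf ω) := by
  rw [C.annihilates_Gam_iff (isStableEven_coeffsOf hs) (by omega)]
  intro w
  refine ⟨w.toNat + 3, fun W hW => mem_dge_of_jetVanish (C := C) fun q n k hq => ?_⟩
  rcases Nat.even_or_odd k with hk | hk
  · exact jetVanish_of_par_eq_neg (C.par_sF (par_fT (isStableEven_coeffsOf hs) W) _) hk
  · intro α β
    rcases lt_or_ge q 0 with h | h
    · exact hcoef_jet_sF_of_neg hs W α β _ h
    · lift q to ℕ using h
      rw [hcoef_jet_sF hs (by omega) (by omega) (by omega)]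
      by_cases hst : 2 < 2 * q + n + (k + 1)
      · have h1 := hl.linearF q n k α β hk hst (-(2 * i - 1) - 1) (by omega)
        have heven : Even (-(2 * i - 1) - 1) := ⟨-i, by ring⟩
        rw [HahnSeries.coeff_add, coeff_sigmaF, heven.neg_one_zpow] at h1
        linear_combination (1 / 2) * h1
      · obtain rfl : q = 0 := by omega
        exact (corrF_unstable (by omega) α β).1 _ (by omega)

theorem annihilates_L (hs : C.IsSuperSymmetric ω) (hl : C.SuperLoopEquations ω) {r : ℤ}
    (hr : -C.ordTau ≤ r) : Annihilates (C.conj (L r)) (C.coeffsOf ω) := by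
  rw [C.annihilates_L_iff (isStableEven_coeffsOf hs)]
  intro w
  refine ⟨w.toNat + 3, fun W hW => ?_⟩
  have hr1 : -1 ≤ r := by rcases C.ordTau_cases with h | h <;> omega
  have hf := par_fT (isStableEven_coeffsOf hs) W
  obtain ⟨X, hX, hev⟩ := C.eventually_symL_eq hf hr1
  filter_upwards [hev] with M hM
  rw [hM]
  refine mem_dge_of_jetVanish (C := C) fun q n k hq => ?_
  rcases Nat.even_or_odd k with hk | hk
  · intro α β
    rcases lt_or_ge q 0 with h | h
    · rw [map_add, map_add, hcoef_jet_algebraMap, if_neg (by omega), add_zero, ← jetHom_apply]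
      refine (hX.map (C.jetHom q α β)).unique (HasFinSum.zero.congr (fun p => ?_) rfl)
      rw [summandL, map_add, jetHom_smul, jetHom_smul, jetHom_apply, jetHom_apply,
        jetVanish_qBB hs W h n k _ _ α β, jetVanish_qFF hs W h n k _ _ α β, mul_zero, mul_zero,
        add_zero]
    · lift q to ℕ using h
      rw [hcoef_jet_symL hs (by omega) (by omega) (by omega) α β hr1 hX]
      -- The constraint `r ≥ -ordTau` on the modes is exactly what puts the exponent `-2r - 2` below
      -- the order in the loop equation, and also below the weaker bound in the unstable cases.
      by_cases hst : 2 < 2 * q + (n + 1) + k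
      · rw [hl.quadraticB q n k α β hk hst _ (by rcases C.ordTau_cases with h | h <;> omega),
          mul_zero]
      · have hk0 : k = 0 := by
          obtain ⟨j, rfl⟩ := hk
          omega
        obtain ⟨rfl, hn⟩ : q = 0 ∧ n ≤ 1 := by omega
        subst hk0
        rw [quadraticB_unstable hn α β _ (by rcases C.ordTau_cases with h | h <;> omega), mul_zero]
  · refine jetVanish_of_par_eq ?_ hk
    rw [map_add, AlgHom.commutes]
    congr 1
    exact (hX.map (par : SP →+ SP)).unique (hX.congr (fun p => par_summandL hf r p) rfl)

theorem annihilates_G (hs : C.IsSuperSymmetric ω) (hl : C.SuperLoopEquations ω) {r : ℤ}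
    (hr : -C.ordTau ≤ r) : Annihilates (C.conj (G r)) (C.coeffsOf ω) := by
  rw [C.annihilates_G_iff (isStableEven_coeffsOf hs)]
  intro w
  refine ⟨w.toNat + 3, fun W hW => ?_⟩
  have hf := par_fT (isStableEven_coeffsOf hs) W
  obtain ⟨X, hX, hev⟩ := C.eventually_symG_eq r (fT (C.coeffsOf ω) W)
  filter_upwards [hev] with M hM
  rw [hM]
  refine mem_dge_of_jetVanish (C := C) fun q n k hq => ?_
  rcases Nat.even_or_odd k with hk | hk
  · refine jetVanish_of_par_eq_neg ?_ hk
    have h1 := (hX.map (par : SP →+ SP)).unique ((hX.map (-AddMonoidHom.id SP)).congr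
      (fun p => par_summandG hf r p) rfl)
    exact h1
  · intro α β
    rcases lt_or_ge q 0 with h | h
    · rw [← jetHom_apply]
      refine (hX.map (C.jetHom q α β)).unique (HasFinSum.zero.congr (fun p => ?_) rfl)
      rw [summandG, jetHom_smul, jetHom_apply, jetVanish_sBF hs W h n k _ _ α β, mul_zero]
    · lift q to ℕ using h
      have hodd : Odd (-2 * r - 3) := ⟨-r - 2, by ring⟩
      have h1 := (hX.map (C.jetHom q α β)).unique (((hasFinSum_QFB hs (by omega : q < W)
        (by omega : n + 2 < W) (by omega : k + 2 < W) hk α β hodd).const_mul (-(1 / 2))).congr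
        (fun p => by rw [summandG, jetHom_smul, jetHom_apply]; ring) rfl)
      rw [← jetHom_apply, h1]
      by_cases hst : 2 < 2 * q + n + (k + 1)
      · rw [hl.quadraticF q n k α β hk hst _ (by rcases C.ordTau_cases with h | h <;> omega),
          mul_zero]
      · have hk1 := hk.pos
        obtain ⟨rfl, rfl, rfl⟩ : q = 0 ∧ n = 0 ∧ k = 1 := by omega
        rw [quadraticF_unstable α β _ (by rcases C.ordTau_cases with h | h <;> omega), mul_zero]

theorem isFreeEnergy_coeffsOf (hs : C.IsSuperSymmetric ω) (hl : C.SuperLoopEquations ω) :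
    IsFreeEnergy C (C.coeffsOf ω) where
  stable := (isStableEven_coeffsOf hs).stable
  even := (isStableEven_coeffsOf hs).even
  symm g n k := (isSuperSymm_coeffsOf hs g n k).symm
  antisymm g n k := (isSuperSymm_coeffsOf hs g n k).antisymm
  annihilated := by
    rintro T ⟨i, hi, rfl | rfl | ⟨n, hn, rfl⟩ | ⟨m, hm, rfl⟩⟩
    · exact annihilates_J hs hl hi
    · exact annihilates_Gam hs hl hi
    · exact annihilates_L hs hl (by rcases C.ordTau_cases with h | h <;> omega)
    · exact annihilates_G hs hl (by rcases C.ordTau_cases with h | h <;> omega)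

end LocalSuperSpectralCurve

/-! ### Uniqueness of the free energy -/

/-- The Taylor coefficient at `ħ^q` as an additive map. -/
def tayHom (q : ℤ) (l : List (ℕ+ → ℂ)) (m : List (ℕ → ℂ)) : SP →+ ℂ :=
  (hcoef q).comp (tay l m).toAddMonoidHom

theorem tayHom_apply (q : ℤ) (l : List (ℕ+ → ℂ)) (m : List (ℕ → ℂ)) (a : SP) :
    tayHom q l m a = hcoef q (tay l m a) := rfl

theorem tayHom_smul (q : ℤ) (l : List (ℕ+ → ℂ)) (m : List (ℕ → ℂ)) (c : ℂ) (a : SP) :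
    tayHom q l m (cst c • a) = c * tayHom q l m a := by
  rw [tayHom_apply, map_smul, smul_eq_mul, hcoef_cst_mul, tayHom_apply]

/-- Two even potentials of positive degree that agree up to constants in degrees below `χ - 2`. -/
structure AgreeBelow (χ : ℤ) (f f' : SP) : Prop where
  par_left : par f = f
  par_right : par f' = f'
  left : f ∈ dge 1
  right : f' ∈ dge 1
  der : ∀ v, der v (f' - f) ∈ dge (χ - 3)
  oder : ∀ v, oder v (f' - f) ∈ dge (χ - 3)

/-- A component `F_{g,n|k}` has degree `2g + n + k - 2`. The unequal constants `F_{g,0|0}` may have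
low degree, so only derivatives of the difference are controlled. -/
theorem agreeBelow_fT {F F' : FreeCoeffs} (hF : IsStableEven F) (hF' : IsStableEven F') {χ : ℕ}
    (h : ∀ g n k, 2 * g + n + k < χ → (n ≠ 0 ∨ k ≠ 0) → F' g n k = F g n k) (W : ℕ) :
    AgreeBelow χ (fT F W) (fT F' W) := by
  have key (g n k : ℕ) : (n = 0 ∧ k = 0) ∨ fTerm F' g n k - fTerm F g n k ∈ dge (χ - 2) := by
    by_cases h0 : n = 0 ∧ k = 0
    · exact Or.inl h0
    · refine Or.inr ?_
      by_cases h1 : 2 * g + n + k < χ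
      · rw [fTerm_eq, fTerm_eq, h g n k h1 (by tauto), sub_self]
        exact zero_mem _
      · exact dge_anti (by omega) (sub_mem (fTerm_mem F' g n k) (fTerm_mem F g n k))
  have hconst (F : FreeCoeffs) (g : ℕ) : ∃ c, fTerm F g 0 0 = algebraMap Hb SP c := by
    refine ⟨(cst (1 / ((Nat.factorial 0 : ℂ) * (Nat.factorial 0 : ℂ))) * hb ((g : ℤ) - 1)) *
      ((F g 0 0).sum fun _ c => cst c), ?_⟩
    rw [fTerm_eq, Algebra.smul_def, map_mul _ (_ * _) (Finsupp.sum _ _)]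
    congr 1
    rw [Finsupp.sum, Finsupp.sum, map_sum]
    refine Finset.sum_congr rfl fun p _ => ?_
    simp [Algebra.smul_def]
  have hd : fT F' W - fT F W = ∑ g ∈ Finset.range W, ∑ n ∈ Finset.range W, ∑ k ∈ Finset.range W,
      (fTerm F' g n k - fTerm F g n k) := by
    simp only [fT_eq, Finset.sum_sub_distrib]
  refine ⟨par_fT hF W, par_fT hF' W, fT_mem hF W, fT_mem hF' W, fun v => ?_, fun v => ?_⟩
  · rw [hd]
    simp only [map_sum]
    refine sum_mem fun g _ => sum_mem fun n _ => sum_mem fun k _ => ?_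
    rcases key g n k with ⟨rfl, rfl⟩ | h
    · obtain ⟨c, hc⟩ := hconst F g
      obtain ⟨c', hc'⟩ := hconst F' g
      rw [hc, hc', map_sub, LocalSuperSpectralCurve.der_algebraMap,
        LocalSuperSpectralCurve.der_algebraMap, sub_zero]
      exact zero_mem _
    · exact dge_anti (by omega) (der_mem_dge v h)
  · rw [hd]
    simp only [map_sum]
    refine sum_mem fun g _ => sum_mem fun n _ => sum_mem fun k _ => ?_
    rcases key g n k with ⟨rfl, rfl⟩ | h
    · obtain ⟨c, hc⟩ := hconst F g
      obtain ⟨c', hc'⟩ := hconst F' g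
      rw [hc, hc', map_sub, LocalSuperSpectralCurve.oder_algebraMap,
        LocalSuperSpectralCurve.oder_algebraMap, sub_zero]
      exact zero_mem _
    · exact dge_anti (by omega) (oder_mem_dge v h)

/-! ### Linearization of the constraints at the lowest undetermined order. -/

namespace LocalSuperSpectralCurve

variable (C : LocalSuperSpectralCurve) {χ : ℤ} {f f' : SP}

theorem mB_sub_mem (p : ℤ) : C.mB p - algebraMap Hb SP (cst (C.omega01.coeff p)) ∈ dge 1 := by
  obtain ⟨N, rfl⟩ | hp := exists_eq_natCast_or_neg p
  · rw [mB_nat, omega01, coeff_ofCoeffs_nat, add_sub_cancel_left]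
    exact cst_smul_mem_dge (xv_mem_dge _) _
  · rw [C.mB_neg hp, omega01, coeff_ofCoeffs_neg _ hp, cst_zero, map_zero, sub_zero]
    exact zero_mem _

theorem sB_sub_mem (hf : f ∈ dge 1) (p : ℤ) :
    C.sB f p - algebraMap Hb SP (cst (C.omega01.coeff p)) ∈ dge 1 := by
  rw [sB, add_sub_right_comm]
  exact add_mem (C.mB_sub_mem p) (dge_anti (by norm_num) (hb_der_mem _ hf))

theorem sB_sub_sB (f f' : SP) (p : ℤ) :
    C.sB f' p - C.sB f p = hb 1 • der (C.cB p) (f' - f) := by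
  rw [sB, sB, add_sub_add_left_eq_sub, ← smul_sub, map_sub]

theorem sF_sub_sF (f f' : SP) (p : ℤ) :
    C.sF f' p - C.sF f p = hb 1 • oder (C.cF p) (f' - f) := by
  rw [sF, sF, add_sub_add_left_eq_sub, ← smul_sub, map_sub]

theorem sB_sub_sB_mem (h : AgreeBelow χ f f') (p : ℤ) : C.sB f' p - C.sB f p ∈ dge (χ - 1) := by
  rw [sB_sub_sB]
  exact dge_anti (by omega) (hb_smul_mem_dge (h.der _) 1)

theorem sF_sub_sF_mem (h : AgreeBelow χ f f') (p : ℤ) : C.sF f' p - C.sF f p ∈ dge (χ - 1) := by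
  rw [sF_sub_sF]
  exact dge_anti (by omega) (hb_smul_mem_dge (h.oder _) 1)

/-- The difference of linear symbols has degree at least `χ - 1`, so modulo degree `χ` only the
constant part of the other factor, a coefficient of `ω_{0,1|0}`, survives. The second-derivative
term gains one degree from `ħ²`. -/
theorem qBB_sub_qBB_mem (h : AgreeBelow χ f f') (p q : ℤ) :
    C.qBB f' p q - C.qBB f p q - (cst (C.omega01.coeff q) • (C.sB f' p - C.sB f p) +
      cst (C.omega01.coeff p) • (C.sB f' q - C.sB f q)) ∈ dge χ := by
  have h1 := dge_anti (w := χ) (by omega)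
    (mul_mem_dge (C.sB_sub_sB_mem h p) (C.sB_sub_mem h.right q))
  have h2 := dge_anti (w := χ) (by omega)
    (mul_mem_dge (C.sB_sub_mem h.left p) (C.sB_sub_sB_mem h q))
  have h3 := dge_anti (w := χ) (by omega)
    (hb_smul_mem_dge (der_mem_dge (C.cB p) (h.der (C.cB q))) 2)
  refine (congrArg (· ∈ dge χ) ?_).mp (add_mem (add_mem h1 h2) h3)
  simp only [qBB, Algebra.smul_def, map_sub]
  rw [mul_sub (C.sB f' p - C.sB f p), ← Algebra.commutes (cst (C.omega01.coeff q))]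
  noncomm_ring

/-- Fermionic symbols have no constant part, so both product terms already reach degree `χ`. -/
theorem qFF_sub_qFF_mem (h : AgreeBelow χ f f') (p q : ℤ) :
    C.qFF f' p q - C.qFF f p q ∈ dge χ := by
  have h1 := dge_anti (w := χ) (by omega)
    (mul_mem_dge (C.sF_sub_sF_mem h p) (C.sF_mem h.right q))
  have h2 := dge_anti (w := χ) (by omega)
    (mul_mem_dge (C.sF_mem h.left p) (C.sF_sub_sF_mem h q))
  have h3 := dge_anti (w := χ) (by omega)
    (hb_smul_mem_dge (oder_mem_dge (C.cF p) (h.oder (C.cF q))) 2)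
  refine (congrArg (· ∈ dge χ) ?_).mp (add_mem (add_mem h1 h2) h3)
  rw [qFF, qFF, map_sub, map_sub, smul_sub]
  noncomm_ring

theorem sBF_sub_sBF_mem (h : AgreeBelow χ f f') (p q : ℤ) :
    C.sBF f' p q - C.sBF f p q - cst (C.omega01.coeff p) • (C.sF f' q - C.sF f q) ∈ dge χ := by
  have h1 := dge_anti (w := χ) (by omega)
    (mul_mem_dge (C.sB_sub_sB_mem h p) (C.sF_mem h.right q))
  have h2 := dge_anti (w := χ) (by omega)
    (mul_mem_dge (C.sB_sub_mem h.left p) (C.sF_sub_sF_mem h q))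
  have h3 := dge_anti (w := χ) (by omega)
    (hb_smul_mem_dge (der_mem_dge (C.cB p) (h.oder (C.cF q))) 2)
  refine (congrArg (· ∈ dge χ) ?_).mp (add_mem (add_mem h1 h2) h3)
  simp only [sBF_eq, Algebra.smul_def, map_sub]
  noncomm_ring

variable {C} {g : ℤ} {l : List (ℕ+ → ℂ)} {m : List (ℕ → ℂ)}

theorem tayHom_summandL_sub (h : AgreeBelow χ f f') (hg : 2 * g + l.length + m.length < χ)
    (n p : ℤ) : tayHom g l m (C.summandL n f' p) - tayHom g l m (C.summandL n f p) =
      1 / 2 * (-1) ^ p *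
        (C.omega01.coeff (-2 * n - 2 - p) * tayHom g l m (C.sB f' p - C.sB f p) +
        C.omega01.coeff p *
          tayHom g l m (C.sB f' (-2 * n - 2 - p) - C.sB f (-2 * n - 2 - p))) := by
  have h1 := hcoef_tay_of_mem_dge l m (C.qBB_sub_qBB_mem h p (-2 * n - 2 - p)) hg
  have h2 := hcoef_tay_of_mem_dge l m (C.qFF_sub_qFF_mem h p (-2 * n - 2 - p)) hg
  rw [← tayHom_apply] at h1 h2
  rw [map_sub, map_add, tayHom_smul, tayHom_smul, map_sub] at h1
  rw [map_sub] at h2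
  rw [summandL, summandL, map_add, map_add, tayHom_smul, tayHom_smul, tayHom_smul, tayHom_smul]
  linear_combination (1 / 2 * (-1) ^ p) * h1 + (-(1 / 2) * ((-1) ^ p * (n + 1 + p))) * h2

theorem tayHom_summandG_sub (h : AgreeBelow χ f f') (hg : 2 * g + l.length + m.length < χ)
    (n p : ℤ) : tayHom g l m (C.summandG n f' p) - tayHom g l m (C.summandG n f p) =
      (-1) ^ p * (C.omega01.coeff p *
          tayHom g l m (C.sF f' (-2 * n - 3 - p) - C.sF f (-2 * n - 3 - p))) := by
  have h1 := hcoef_tay_of_mem_dge l m (C.sBF_sub_sBF_mem h p (-2 * n - 3 - p)) hg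
  rw [← tayHom_apply] at h1
  rw [map_sub, tayHom_smul, map_sub] at h1
  rw [summandG, summandG, tayHom_smul, tayHom_smul]
  linear_combination ((-1) ^ p) * h1

/-- A sequence on which the Virasoro-type recursions with coefficients `τ` act trivially vanishes
if it is finitely supported and its even part vanishes. -/
theorem eq_zero_of_tau_recursion {t : ℤ → ℂ} (heven : ∀ i, 0 ≤ i → t (2 * i) = 0)
    {P : ℤ} (hP : ∀ i, P < i → t i = 0)
    (hrec : ∀ n, -C.ordTau ≤ n →
      HasFinSum (fun p : ℤ => (-1) ^ p * (C.omega01.coeff p * t (2 * n + 1 + p))) 0)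
    {i : ℤ} (hi : 0 ≤ i) : t i = 0 := by
  have key (d : ℕ) : ∀ i, 0 ≤ i → P - i < d → t i = 0 := by
    induction d with
    | zero => exact fun i _ h => hP i (by push_cast at h; omega)
    | succ d ih =>
      intro i hi hd
      rcases Int.even_or_odd' i with ⟨j, rfl | rfl⟩
      · exact heven j (by omega)
      -- The leading coefficient is `τ_1` for irregular and `τ_3` for regular curves, nonzero by
      -- admissibility.
      · have hlead : C.omega01.coeff (2 * C.ordTau) ≠ 0 := by
          rcases C.ordTau_cases with ⟨h1, h2, -⟩ | ⟨h1, h2, -⟩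
          · rw [h2, omega01]
            have := coeff_ofCoeffs_nat (fun a => C.τ a.succPNat) 2
            rw [show (2 * 1 : ℤ) = ((2 : ℕ) : ℤ) by norm_num, this]
            intro h3
            have := C.admissible
            change C.τ 3 = 0 at h3
            rw [h1, h3] at this
            simp at this
          · rw [h2, omega01]
            have := coeff_ofCoeffs_nat (fun a => C.τ a.succPNat) 0
            rw [show (2 * 0 : ℤ) = ((0 : ℕ) : ℤ) by norm_num, this]
            exact h1
        -- This mode makes `p = 2 ordTau` hit the index `2j + 1`. Smaller `p` have zero coefficient,
        -- except `τ_2` for regular curves, which meets an even index; larger `p` meet larger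
        -- indices, already known to vanish.
        have hsum := hrec (j - C.ordTau) (by omega)
        have h2 := hsum.unique (HasFinSum.of_support (s := {2 * C.ordTau}) fun p hp => ?_)
        · rw [Finset.sum_singleton, show 2 * (j - C.ordTau) + 1 + 2 * C.ordTau = 2 * j + 1 by ring]
            at h2
          have h3 : ((-1 : ℂ) ^ (2 * C.ordTau)) ≠ 0 := zpow_ne_zero _ (by norm_num)
          have h4 := h2.symm
          simp only [mul_eq_zero, h3, hlead, false_or] at h4
          exact h4
        · rw [Finset.mem_singleton] at hp
          rcases lt_or_gt_of_ne hp with hlt | hgt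
          · by_cases h1 : p = 1
            · subst h1
              have h5 : C.ordTau = 1 := by rcases C.ordTau_cases with h | h <;> omega
              rw [h5, show 2 * (j - 1) + 1 + 1 = 2 * j by ring, heven j (by omega), mul_zero,
                mul_zero]
            · rw [ordGE_omega01 p (by rcases C.ordTau_cases with h | h <;> omega), zero_mul,
                mul_zero]
          · rw [ih _ (by omega) (by push_cast at hd; omega), mul_zero, mul_zero]
  exact key (P - i + 1).toNat i hi (by omega)

end LocalSuperSpectralCurve

theorem pairing_single {n k : ℕ} (c : Coeffs n k) (i : Fin n → ℕ+) (j : Fin k → ℕ) :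
    pairing c (fun a => Pi.single (i a) 1) (fun b => Pi.single (j b) 1) = c (i, j) := by
  classical
  rw [pairing, Finsupp.sum, Finset.sum_eq_single (i, j)]
  · simp
  · rintro ⟨i', j'⟩ _ hne
    by_cases h : i' = i
    · obtain ⟨b, hb⟩ : ∃ b, j' b ≠ j b := by
        by_contra! h'
        exact hne (Prod.ext h (funext h'))
      rw [Finset.prod_eq_zero (i := b) (Finset.mem_univ b) (Pi.single_eq_of_ne hb _), mul_zero,
        mul_zero]
    · obtain ⟨a, ha⟩ : ∃ a, i' a ≠ i a := by
        by_contra! h'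
        exact h (funext h')
      rw [Finset.prod_eq_zero (i := a) (Finset.mem_univ a) (Pi.single_eq_of_ne ha _), zero_mul,
        mul_zero]
  · intro h
    rw [Finsupp.notMem_support_iff.mp h, zero_mul]

/-! ### Comparison of two free energies. -/

namespace IsFreeEnergy

variable {C : LocalSuperSpectralCurve} {F F' : FreeCoeffs}

theorem isStableEven (h : IsFreeEnergy C F) : IsStableEven F := ⟨h.stable, h.even⟩

theorem isSuperSymm (h : IsFreeEnergy C F) (g n k : ℕ) : IsSuperSymm (F g n k) :=
  ⟨h.symm g n k, h.antisymm g n k⟩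

theorem sB_mem (h : IsFreeEnergy C F) {i : ℤ} (hi : 1 ≤ i) (w : ℤ) :
    ∃ W₀ : ℕ, ∀ W ≥ W₀, C.sB (fT F W) (-(2 * i) - 1) ∈ dge w :=
  (C.annihilates_J_iff h.isStableEven (by omega)).mp
    (h.annihilated _ ⟨i, hi, Or.inl rfl⟩) w

theorem sF_mem (h : IsFreeEnergy C F) {i : ℤ} (hi : 1 ≤ i) (w : ℤ) :
    ∃ W₀ : ℕ, ∀ W ≥ W₀, C.sF (fT F W) (-(2 * i - 1) - 1) ∈ dge w :=
  (C.annihilates_Gam_iff h.isStableEven (by omega)).mp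
    (h.annihilated _ ⟨i, hi, Or.inr (Or.inl rfl)⟩) w

theorem symL_mem (h : IsFreeEnergy C F) {r : ℤ} (hr : -C.ordTau ≤ r) (w : ℤ) :
    ∃ W₀ : ℕ, ∀ W ≥ W₀, ∀ᶠ M : ℕ in atTop, C.symL r (fT F W) M ∈ dge w :=
  (C.annihilates_L_iff h.isStableEven r).mp (h.annihilated _ ⟨r + 1 + C.ordTau, by omega,
    Or.inr (Or.inr (Or.inl ⟨r, by rcases C.ordTau_cases with h | h <;> omega, rfl⟩))⟩) w

theorem symG_mem (h : IsFreeEnergy C F) {r : ℤ} (hr : -C.ordTau ≤ r) (w : ℤ) :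
    ∃ W₀ : ℕ, ∀ W ≥ W₀, ∀ᶠ M : ℕ in atTop, C.symG r (fT F W) M ∈ dge w :=
  (C.annihilates_G_iff h.isStableEven r).mp (h.annihilated _ ⟨r + 1 + C.ordTau, by omega,
    Or.inr (Or.inr (Or.inr ⟨r, by rcases C.ordTau_cases with h | h <;> omega, rfl⟩))⟩) w

theorem tayHom_sB_sub (h : IsFreeEnergy C F) (h' : IsFreeEnergy C F') {W g n k : ℕ} (hg : g < W)
    (hn : n + 1 < W) (hk : k < W) (v : Fin n → ℕ+ → ℂ) (w : Fin k → ℕ → ℂ) (p : ℤ) :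
    tayHom g (List.ofFn v) (List.ofFn w) (C.sB (fT F' W) p - C.sB (fT F W) p) =
      pairing (F' g (n + 1) k) (Fin.cons (C.cB p) v) w -
        pairing (F g (n + 1) k) (Fin.cons (C.cB p) v) w := by
  rw [C.sB_sub_sB, tayHom_apply, map_smul, smul_eq_mul, hcoef_hb_mul, ← tay_cons_left,
    ← List.ofFn_cons, map_sub, map_sub, hcoef_tay_fT h.isSuperSymm hg hn hk,
    hcoef_tay_fT h'.isSuperSymm hg hn hk]

theorem tayHom_sF_sub (h : IsFreeEnergy C F) (h' : IsFreeEnergy C F') {W g n k : ℕ} (hg : g < W)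
    (hn : n < W) (hk : k + 1 < W) (v : Fin n → ℕ+ → ℂ) (w : Fin k → ℕ → ℂ) (p : ℤ) :
    tayHom g (List.ofFn v) (List.ofFn w) (C.sF (fT F' W) p - C.sF (fT F W) p) =
      pairing (F' g n (k + 1)) v (Fin.cons (C.cF p) w) -
        pairing (F g n (k + 1)) v (Fin.cons (C.cF p) w) := by
  rw [C.sF_sub_sF, tayHom_apply, map_smul, smul_eq_mul, hcoef_hb_mul, ← tay_cons_right,
    ← List.ofFn_cons, map_sub, map_sub, hcoef_tay_fT h.isSuperSymm hg hn hk,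
    hcoef_tay_fT h'.isSuperSymm hg hn hk]

/-- Free energies that agree below the order of `F_{g,n+1|k}` agree on `F_{g,n+1|k}`. -/
theorem pairing_eq_B (h : IsFreeEnergy C F) (h' : IsFreeEnergy C F') {g n k : ℕ}
    (ih : ∀ g' n' k', 2 * g' + n' + k' < 2 * g + (n + 1) + k → (n' ≠ 0 ∨ k' ≠ 0) →
      F' g' n' k' = F g' n' k')
    (v : Fin n → ℕ+ → ℂ) (w : Fin k → ℕ → ℂ) (i : ℕ+) :
    pairing (F' g (n + 1) k) (Fin.cons (Pi.single i 1) v) w =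
      pairing (F g (n + 1) k) (Fin.cons (Pi.single i 1) v) w := by
  obtain ⟨s, hs⟩ : ∃ s : ℤ → ℂ, s = fun p => pairing (F' g (n + 1) k) (Fin.cons (C.cB p) v) w -
    pairing (F g (n + 1) k) (Fin.cons (C.cB p) v) w := ⟨_, rfl⟩
  have hT (W : ℕ) (hW : g + n + k + 2 ≤ W) (p : ℤ) : tayHom g (List.ofFn v) (List.ofFn w)
      (C.sB (fT F' W) p - C.sB (fT F W) p) = s p := by
    rw [hs, tayHom_sB_sub h h' (by omega) (by omega) (by omega)]
  have hlen : 2 * (g : ℤ) + (List.ofFn v).length + (List.ofFn w).length <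
      (2 * g + (n + 1) + k : ℕ) := by
    rw [List.length_ofFn, List.length_ofFn]
    push_cast
    omega
  obtain ⟨P, hP⟩ : ∃ P : ℕ, ∀ q : ℤ, q < -P → s q = 0 := by
    obtain ⟨P, hP⟩ := C.exists_sB_eq_zero (fT F (g + n + k + 2))
    obtain ⟨P', hP'⟩ := C.exists_sB_eq_zero (fT F' (g + n + k + 2))
    refine ⟨P + P', fun q hq => ?_⟩
    rw [← hT _ le_rfl, (hP q (by omega)).1, (hP' q (by omega)).1, sub_zero, map_zero]
  -- The recursion also needs the even index `0`, where no operator `J_0` is available; there the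
  -- direction itself is zero, as no `dξ_{-i}` has a `z^{-1}` term.
  have h0 : s (-1) = 0 := by
    have : C.cB (-1) = fun i => 0 * C.cB (-1) i := by
      funext i
      rw [zero_mul, show (-1 : ℤ) = -((0 : ℕ) : ℤ) - 1 by norm_num, C.cB_neg, if_neg i.ne_zero]
    have hz (c : Coeffs (n + 1) k) : pairing c (Fin.cons (C.cB (-1)) v) w = 0 := by
      rw [this, pairing]
      refine Finset.sum_eq_zero fun p _ => ?_
      simp only [Fin.prod_univ_succ, Fin.cons_zero, zero_mul, mul_zero]
    rw [hs]
    simp only [hz, sub_zero]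
  have ht := LocalSuperSpectralCurve.eq_zero_of_tau_recursion (C := C) (t := fun i => s (-i - 1))
    (P := P) (i := i) (fun i hi => ?_) (fun i hi => hP _ (by omega)) (fun r hr => ?_) (by omega)
  · rw [hs] at ht
    simp only [C.cB_neg_eq_single] at ht
    exact sub_eq_zero.mp ht
  · rcases hi.eq_or_lt with rfl | hi
    · exact h0
    · obtain ⟨W, h1⟩ := h.sB_mem hi (2 * g + (n + 1) + k : ℕ)
      obtain ⟨W', h1'⟩ := h'.sB_mem hi (2 * g + (n + 1) + k : ℕ)
      rw [← hT (W + W' + g + n + k + 2) (by omega)]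
      exact hcoef_tay_of_mem_dge _ _ (sub_mem (h1' _ (by omega)) (h1 _ (by omega))) hlen
  · obtain ⟨W, h1⟩ := h.symL_mem hr (2 * g + (n + 1) + k : ℕ)
    obtain ⟨W', h1'⟩ := h'.symL_mem hr (2 * g + (n + 1) + k : ℕ)
    obtain ⟨V, hV⟩ : ∃ V, V = W + W' + g + n + k + 2 := ⟨_, rfl⟩
    have hr1 : -1 ≤ r := by rcases C.ordTau_cases with h | h <;> omega
    have hag := agreeBelow_fT h.isStableEven h'.isStableEven ih V
    obtain ⟨X, hX, hev⟩ := C.eventually_symL_eq hag.par_left hr1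
    obtain ⟨X', hX', hev'⟩ := C.eventually_symL_eq hag.par_right hr1
    obtain ⟨M, h2, h2', h3, h3'⟩ :=
      (hev.and (hev'.and ((h1 V (by omega)).and (h1' V (by omega))))).exists
    have hXX : tayHom g (List.ofFn v) (List.ofFn w) (X' - X) = 0 := by
      refine hcoef_tay_of_mem_dge _ _ ?_ hlen
      have := sub_mem h3' h3
      rwa [h2, h2', add_sub_add_right_eq_sub] at this
    have hN := LocalSuperSpectralCurve.even_neg_two_mul_sub_two r
    -- The linearized symbol contains this sum and its reflection, each with weight `1/2`. The range
    -- is finite because `ω_{0,1|0}` is regular and `s` has bounded poles.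
    have hA := HasFinSum.of_support (s := Finset.Icc 0 (-2 * r - 2 + P))
      (c := fun p : ℤ => (-1) ^ p * (C.omega01.coeff p * s (-2 * r - 2 - p))) fun p hp => by
        rw [Finset.mem_Icc, not_and_or] at hp
        rcases hp with hp | hp
        · rw [LocalSuperSpectralCurve.ordGE_omega01 p
            (by rcases C.ordTau_cases with h | h <;> omega), zero_mul, mul_zero]
        · rw [hP _ (by omega), mul_zero, mul_zero]
    have hsum := ((hX'.map (tayHom g (List.ofFn v) (List.ofFn w))).add
      ((hX.map (tayHom g (List.ofFn v) (List.ofFn w))).const_mul (-1))).unique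
      (((hA.add (hA.comp_equiv (Equiv.subLeft (-2 * r - 2)))).const_mul (1 / 2)).congr
        (fun p => ?_) rfl)
    · refine hA.congr (fun p => ?_) ?_
      · rw [show -(2 * r + 1 + p) - 1 = -2 * r - 2 - p by ring]
      · rw [map_sub] at hXX
        linear_combination hsum - hXX
    · rw [neg_one_mul, ← sub_eq_add_neg, LocalSuperSpectralCurve.tayHom_summandL_sub hag hlen,
        hT V (by omega), hT V (by omega), Equiv.subLeft_apply, sub_sub_cancel,
        LocalSuperSpectralCurve.neg_one_zpow_sub_of_even hN]
      ring

/-- Free energies that agree below the order of `F_{g,n|k+1}` agree on `F_{g,n|k+1}` at indices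
with a nonzero fermionic mode. -/
theorem pairing_eq_F (h : IsFreeEnergy C F) (h' : IsFreeEnergy C F') {g n k : ℕ}
    (ih : ∀ g' n' k', 2 * g' + n' + k' < 2 * g + n + (k + 1) → (n' ≠ 0 ∨ k' ≠ 0) →
      F' g' n' k' = F g' n' k')
    (v : Fin n → ℕ+ → ℂ) (w : Fin k → ℕ → ℂ) {j : ℕ} (hj : 0 < j) :
    pairing (F' g n (k + 1)) v (Fin.cons (Pi.single j 1) w) =
      pairing (F g n (k + 1)) v (Fin.cons (Pi.single j 1) w) := by
  obtain ⟨s, hs⟩ : ∃ s : ℤ → ℂ, s = fun p => pairing (F' g n (k + 1)) v (Fin.cons (C.cF p) w) -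
    pairing (F g n (k + 1)) v (Fin.cons (C.cF p) w) := ⟨_, rfl⟩
  have hT (W : ℕ) (hW : g + n + k + 2 ≤ W) (p : ℤ) : tayHom g (List.ofFn v) (List.ofFn w)
      (C.sF (fT F' W) p - C.sF (fT F W) p) = s p := by
    rw [hs, tayHom_sF_sub h h' (by omega) (by omega) (by omega)]
  have hlen : 2 * (g : ℤ) + (List.ofFn v).length + (List.ofFn w).length <
      (2 * g + n + (k + 1) : ℕ) := by
    rw [List.length_ofFn, List.length_ofFn]
    push_cast
    omega
  obtain ⟨P, hP⟩ : ∃ P : ℕ, ∀ q : ℤ, q < -P → s q = 0 := by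
    obtain ⟨P, hP⟩ := C.exists_sF_eq_zero (fT F (g + n + k + 2))
    obtain ⟨P', hP'⟩ := C.exists_sF_eq_zero (fT F' (g + n + k + 2))
    refine ⟨P + P', fun q hq => ?_⟩
    rw [← hT _ le_rfl, (hP q (by omega)).1, (hP' q (by omega)).1, sub_zero, map_zero]
  -- The index `i` stands for the mode `θ^{i+1}`: the operators `Γ_{2i-1}` then remove even indices
  -- and `G_{2r+1}` has the shift `2r + 1 + p` required by the recursion, as in the bosonic case.
  have ht := LocalSuperSpectralCurve.eq_zero_of_tau_recursion (C := C) (t := fun i => s (-i - 2))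
    (P := P) (i := j - 1) (fun i hi => ?_) (fun i hi => hP _ (by omega)) (fun r hr => ?_)
    (by omega)
  · rw [hs] at ht
    rw [show -((j : ℤ) - 1) - 2 = -j - 1 by ring] at ht
    simp only [C.cF_neg_eq_single hj] at ht
    exact sub_eq_zero.mp ht
  · obtain ⟨W, h1⟩ := h.sF_mem (i := i + 1) (by omega) (2 * g + n + (k + 1) : ℕ)
    obtain ⟨W', h1'⟩ := h'.sF_mem (i := i + 1) (by omega) (2 * g + n + (k + 1) : ℕ)
    rw [← hT (W + W' + g + n + k + 2) (by omega),
      show -(2 * i) - 2 = -(2 * (i + 1) - 1) - 1 by ring]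
    exact hcoef_tay_of_mem_dge _ _ (sub_mem (h1' _ (by omega)) (h1 _ (by omega))) hlen
  · obtain ⟨W, h1⟩ := h.symG_mem hr (2 * g + n + (k + 1) : ℕ)
    obtain ⟨W', h1'⟩ := h'.symG_mem hr (2 * g + n + (k + 1) : ℕ)
    obtain ⟨V, hV⟩ : ∃ V, V = W + W' + g + n + k + 2 := ⟨_, rfl⟩
    have hag := agreeBelow_fT h.isStableEven h'.isStableEven ih V
    obtain ⟨X, hX, hev⟩ := C.eventually_symG_eq r (fT F V)
    obtain ⟨X', hX', hev'⟩ := C.eventually_symG_eq r (fT F' V)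
    obtain ⟨M, h2, h2', h3, h3'⟩ :=
      (hev.and (hev'.and ((h1 V (by omega)).and (h1' V (by omega))))).exists
    have hXX : tayHom g (List.ofFn v) (List.ofFn w) (X' - X) = 0 := by
      refine hcoef_tay_of_mem_dge _ _ ?_ hlen
      have := sub_mem h3' h3
      rwa [h2, h2'] at this
    refine ((hX'.map (tayHom g (List.ofFn v) (List.ofFn w))).add
      ((hX.map (tayHom g (List.ofFn v) (List.ofFn w))).const_mul (-1))).congr (fun p => ?_) ?_
    · rw [neg_one_mul, ← sub_eq_add_neg, LocalSuperSpectralCurve.tayHom_summandG_sub hag hlen,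
        hT V (by omega), show -(2 * r + 1 + p) - 2 = -2 * r - 3 - p by ring]
    · rw [neg_one_mul, ← sub_eq_add_neg, ← map_sub, hXX]

theorem cons_single {ι : Type*} [DecidableEq ι] {n : ℕ} (i : Fin (n + 1) → ι) :
    (fun a => Pi.single (i a) (1 : ℂ)) =
      (Fin.cons (Pi.single (i 0) 1) fun a => Pi.single (i a.succ) 1 : Fin (n + 1) → ι → ℂ) := by
  funext a
  refine Fin.cases rfl (fun b => rfl) a

/-- The free energy is unique up to the constants `F_{g,0|0}`. -/
theorem eq_of_ne_zero (h : IsFreeEnergy C F) (h' : IsFreeEnergy C F') (g n k : ℕ)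
    (hnk : n ≠ 0 ∨ k ≠ 0) : F' g n k = F g n k := by
  obtain ⟨χ, hχ⟩ : ∃ χ, χ = 2 * g + n + k := ⟨_, rfl⟩
  induction χ using Nat.strong_induction_on generalizing g n k with
  | _ χ ih =>
  subst hχ
  have ih' (g' n' k' : ℕ) (h1 : 2 * g' + n' + k' < 2 * g + n + k) (h2 : n' ≠ 0 ∨ k' ≠ 0) :
      F' g' n' k' = F g' n' k' := ih _ h1 g' n' k' h2 rfl
  ext ⟨i, j⟩
  match n with
  | n + 1 =>
    rw [← pairing_single, ← pairing_single, cons_single i]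
    exact h.pairing_eq_B h' ih' _ _ _
  | 0 =>
    rcases Nat.even_or_odd k with hk | hk
    -- Without bosonic slots there are at least two fermionic ones. If the first index is the zero
    -- mode, either the second is not and a swap brings it forward, or both are zero and
    -- antisymmetry makes both coefficients vanish.
    · obtain ⟨k, rfl⟩ : ∃ k', k = k' + 2 := by
        obtain ⟨a, rfl⟩ := hk
        exact ⟨2 * (a - 1), by omega⟩
      have key (j : Fin (k + 2) → ℕ) (hj : 0 < j 0) :
          F' g 0 (k + 2) (i, j) = F g 0 (k + 2) (i, j) := by
        rw [← pairing_single, ← pairing_single, cons_single j]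
        exact h.pairing_eq_F h' ih' _ _ hj
      have hswap (F : FreeCoeffs) (hF : IsFreeEnergy C F) :
          F g 0 (k + 2) (i, j ∘ Equiv.swap 0 1) = -F g 0 (k + 2) (i, j) := by
        rw [hF.antisymm, Equiv.Perm.sign_swap (by simp)]
        simp
      rcases Nat.eq_zero_or_pos (j 0) with h0 | h0
      · rcases Nat.eq_zero_or_pos (j 1) with h1 | h1
        · have hj : j ∘ Equiv.swap 0 1 = j := by
            rw [Equiv.comp_swap_eq_update, h0, h1]
            funext a
            by_cases ha0 : a = 0
            · subst ha0
              simp [h0]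
            · by_cases ha1 : a = 1
              · subst ha1
                simp [h1]
              · simp [ha0, ha1]
          have a1 := hswap F h
          have a2 := hswap F' h'
          rw [hj] at a1 a2
          rw [self_eq_neg.mp a1, self_eq_neg.mp a2]
        · have := key (j ∘ Equiv.swap 0 1) (by simpa using h1)
          rw [hswap F h, hswap F' h'] at this
          exact neg_injective this
      · exact key j h0
    · rw [h.even _ _ _ hk, h'.even _ _ _ hk]

end IsFreeEnergy

end SuperTR

end

open SuperTR in
theorem theorem4p3 (C : LocalSuperSpectralCurve) (ω : C.Correlators)
    (hsymm : C.IsSuperSymmetric ω) (hloop : C.SuperLoopEquations ω) :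
    ∃ F : FreeCoeffs, IsFreeEnergy C F ∧
      (∀ F' : FreeCoeffs, IsFreeEnergy C F' →
        ∀ g n k, (n ≠ 0 ∨ k ≠ 0) → F' g n k = F g n k) ∧
      ∀ g n k, 2 < 2 * g + n + k → ∀ Fhat : Coeffs n k,
        IsExpansion C (ω g n k) Fhat ↔ Fhat = F g n k := by
  refine ⟨C.coeffsOf ω, LocalSuperSpectralCurve.isFreeEnergy_coeffsOf hsymm hloop, ?_, ?_⟩
  · intro F' hF'
    exact (LocalSuperSpectralCurve.isFreeEnergy_coeffsOf hsymm hloop).eq_of_ne_zero hF'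
  · intro g n k h Fhat
    rw [LocalSuperSpectralCurve.isExpansion_iff, LocalSuperSpectralCurve.coeffsOf_stable h]
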